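/- **Setting.** Let $W$ be a probability measure on $\mathbb R$ all of whose moments $\int x^k\,dW(x)$, $k\ge 0$, are finite, and let $d\ge 0$ be an integer. For a finite simple graph $G$ on $N$ vertices, attach to the edges independent weights $w$ with law $W$, and let $G_w$ be the resulting weighted graph. Its adjacency matrix is the real symmetric matrix whose $(u,v)$ entry is $w_{uv}$ if $u$ and $v$ are adjacent and $0$ otherwise. Let $\lambda_1\le\dots\le\lambda_N$ be the eigenvalues of this matrix, with multiplicity. The (random) spectral measure of $G_w$ is $\nu_{G_w}=\frac1N\sum_{j=1}^N\delta_{\lambda_j}$, and $\nu_{d,G,W}=\mathbb E_w[\nu_{G_w}]$ denotes its average over the weights. Write $n_{\rm cyc}(k;G)$ for the number of cycles of length $k$ in $G$, and $|G|$ for the number of vertices of $G$. **Theorem.** For every $d$ and $W$ as above there is a probability measure $\nu_{d,W}$ on $\mathbb R$ with finite moments of all orders, depending only on $d$ and $W$, such that for every sequence of simple $d$-regular graphs $G_i$ with $|G_i|\to\infty$ and $n_{\rm cyc}(k;G_i)=o(|G_i|)$ as $i\to\infty$ for each fixed $k\ge 3$: 1. the averaged spectral measures $\nu_{d,G_i,W}$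 converge weakly to $\nu_{d,W}$; 2. for every $k\ge 0$ the $k$-th moment of $\nu_{d,G_i,W}$ converges to the $k$-th moment of $\nu_{d,W}$; 3. the random spectral measures $\nu_{(G_i)_w}$ converge weakly in probability to $\nu_{d,W}$, i.e. for every bounded continuous $f:\mathbb R\to\mathbb R$ the random variables $\int f\,d\nu_{(G_i)_w}$ converge in probability to $\int f\,d\nu_{d,W}$. In the unweighted case (every weight equal to $1$, i.e. $W=\delta_1$) and $d\ge 2$, $\nu_{d,W}$ is Kesten's measure, the measure with density $$f_d(x)=\begin{cases}\dfrac{d}{2\pi(d^2-x^2)}\sqrt{4(d-1)-x^2}, & |x|\le 2\sqrt{d-1},\\[1ex] 0,&\text{otherwise.}\end{cases}$$ Moreover, as $d\to\infty$, Kesten's measure, rescaled by $x\mapsto x/(2\sqrt{d-1})$ so that it is supported on $[-1,1]$, converges weakly to the semicircle distribution with density $\frac2\pi\sqrt{1-x^2}$ on $[-1,1]$. -/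

import Mathlib

open MeasureTheory Filter Topology
open scoped BoundedContinuousFunction

namespace SpectralLimit

/-- The adjacency matrix of the graph `G` whose edges carry the weights `w`: the `(i, j)` entry is
the weight of the edge `{i, j}` if `i` and `j` are adjacent, and `0` otherwise. -/
def weightedAdj {V : Type*} (G : SimpleGraph V) [DecidableRel G.Adj] (w : Sym2 V → ℝ) :
    Matrix V V ℝ :=
  Matrix.of fun i j => if G.Adj i j then w s(i, j) else 0

theorem isHermitian_weightedAdj {V : Type*} (G : SimpleGraph V) [DecidableRel G.Adj]
    (w : Sym2 V → ℝ) : (weightedAdj G w).IsHermitian := by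
  ext i j
  simp [weightedAdj, G.adj_comm i j, Sym2.eq_swap]

/-- The uniform probability measure `(1/N) ∑ δ_{λ_j}` on the spectrum (with multiplicity) of the
graph `G` on `N` vertices with edge weights `w`. -/
noncomputable def spectralMeasure {V : Type*} [Fintype V] [DecidableEq V] (G : SimpleGraph V)
    [DecidableRel G.Adj] (w : Sym2 V → ℝ) : Measure ℝ :=
  (Fintype.card V : ENNReal)⁻¹ •
    ∑ j : V, Measure.dirac ((isHermitian_weightedAdj G w).eigenvalues j)

theorem continuous_weightedAdj {U : Type*} (G : SimpleGraph U) [DecidableRel G.Adj] :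
    Continuous (weightedAdj G : (Sym2 U → ℝ) → Matrix U U ℝ) := by
  refine continuous_matrix fun i j => ?_
  simp only [weightedAdj, Matrix.of_apply]
  split_ifs <;> fun_prop

section Measurability

variable {V : Type*} [Fintype V] [DecidableEq V]

theorem trace_aeval_eq_sum_eigenvalues {A : Matrix V V ℝ} (hA : A.IsHermitian)
    (p : Polynomial ℝ) : ∑ j, p.eval (hA.eigenvalues j) = (Polynomial.aeval A p).trace := by
  have hA' : IsSelfAdjoint A := hA
  rw [← cfc_polynomial p A, hA.cfc_eq, Matrix.IsHermitian.cfc, Unitary.conjStarAlgAut_apply,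
    Matrix.trace_mul_cycle]
  simp [Matrix.trace_diagonal]

theorem continuous_sum_eval_eigenvalues (G : SimpleGraph V) [DecidableRel G.Adj]
    (p : Polynomial ℝ) : Continuous fun w : Sym2 V → ℝ =>
      ∑ j, p.eval ((isHermitian_weightedAdj G w).eigenvalues j) := by
  simp_rw [trace_aeval_eq_sum_eigenvalues]
  refine Continuous.matrix_trace ?_
  exact (Polynomial.continuous_aeval p).comp (continuous_weightedAdj G)

theorem measurable_sum_eigenvalues (G : SimpleGraph V) [DecidableRel G.Adj]
    {f : ℝ → ℝ} (hf : Continuous f) : Measurable fun w : Sym2 V → ℝ =>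
      ∑ j, f ((isHermitian_weightedAdj G w).eigenvalues j) := by
  have h (n : ℕ) : ∃ p : Polynomial ℝ, ∀ x ∈ Set.Icc (-(n : ℝ)) n,
      |p.eval x - f x| < 1 / ((n : ℝ) + 1) :=
    exists_polynomial_near_of_continuousOn _ _ f hf.continuousOn _ (by positivity)
  choose p hp using h
  refine measurable_of_tendsto_metrizable
    (fun n => (continuous_sum_eval_eigenvalues G (p n)).measurable) ?_
  refine tendsto_pi_nhds.2 fun w => tendsto_finsetSum _ fun j _ => ?_
  set x := (isHermitian_weightedAdj G w).eigenvalues j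
  rw [tendsto_iff_dist_tendsto_zero]
  refine squeeze_zero' (.of_forall fun _ => dist_nonneg) ?_
    tendsto_one_div_add_atTop_nhds_zero_nat
  filter_upwards [eventually_ge_atTop ⌈|x|⌉₊] with n hn
  exact (hp n x (abs_le.1 ((Nat.le_ceil _).trans (by exact_mod_cast hn)))).le

/-- The spectral measure depends measurably on the weights. -/
theorem measurable_spectralMeasure (G : SimpleGraph V) [DecidableRel G.Adj] :
    Measurable (spectralMeasure G : (Sym2 V → ℝ) → Measure ℝ) := by
  have key : ∀ s : Set ℝ, IsClosed s → Measurable fun w : Sym2 V → ℝ =>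
      spectralMeasure G w s := by
    intro s hs
    have hδ (n : ℕ) : 0 < 1 / ((n : ℝ) + 1) := by positivity
    have hm : Measurable fun w : Sym2 V → ℝ =>
        ∑ j, s.indicator (fun _ => (1 : ℝ)) ((isHermitian_weightedAdj G w).eigenvalues j) := by
      refine measurable_of_tendsto_metrizable (fun n => measurable_sum_eigenvalues G
        (f := fun x => ((thickenedIndicator (hδ n) s x : NNReal) : ℝ)) (by fun_prop)) ?_
      refine tendsto_pi_nhds.2 fun w => tendsto_finsetSum _ fun j _ => ?_
      have := tendsto_pi_nhds.1 (thickenedIndicator_tendsto_indicator_closure hδ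
        tendsto_one_div_add_atTop_nhds_zero_nat s)
          ((isHermitian_weightedAdj G w).eigenvalues j)
      rw [hs.closure_eq] at this
      have h2 := (NNReal.tendsto_coe.2 this)
      convert h2 using 2
      by_cases hx : (isHermitian_weightedAdj G w).eigenvalues j ∈ s <;> simp [hx]
    have e : (fun w : Sym2 V → ℝ => spectralMeasure G w s) = fun w =>
        (Fintype.card V : ENNReal)⁻¹ * ENNReal.ofReal (∑ j,
          s.indicator (fun _ => (1 : ℝ)) ((isHermitian_weightedAdj G w).eigenvalues j)) := by
      ext w
      rw [spectralMeasure, Measure.smul_apply, smul_eq_mul, Measure.finsetSum_apply,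
        ENNReal.ofReal_sum_of_nonneg fun j _ => Set.indicator_nonneg (by simp) _]
      congr 1
      refine Finset.sum_congr rfl fun j _ => ?_
      rw [Measure.dirac_apply' _ hs.measurableSet]
      by_cases hx : (isHermitian_weightedAdj G w).eigenvalues j ∈ s <;> simp [hx]
    rw [e]
    exact hm.ennreal_ofReal.const_mul _
  have hfin (w : Sym2 V → ℝ) : IsFiniteMeasure (spectralMeasure G w) := by
    refine ⟨?_⟩
    rcases isEmpty_or_nonempty V with hV | hV
    · simp [spectralMeasure]
    · rw [spectralMeasure, Measure.smul_apply, Measure.finsetSum_apply]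
      simp [ENNReal.mul_lt_top_iff, ENNReal.inv_lt_top, Fintype.card_pos]
  exact .measure_of_isPiSystem (borel_eq_generateFrom_isClosed (α := ℝ) ▸ BorelSpace.measurable_eq)
    isPiSystem_isClosed (fun s hs => key s hs) (key _ isClosed_univ)

end Measurability

/-- The law of a family of independent weights, one for each unordered pair of vertices, each with
law `W`. -/
noncomputable def weightLaw (V : Type*) [Fintype V] [DecidableEq V] (W : Measure ℝ) :
    Measure (Sym2 V → ℝ) :=
  Measure.pi fun _ => W

/-- The average of the spectral measures of the weighted graphs `G_w` over iid weights `w` with law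
`W`, i.e. the measure `A ↦ ∫ (spectralMeasure G w) A d(weightLaw W)(w)`. -/
noncomputable def meanSpectralMeasure {V : Type*} [Fintype V] [DecidableEq V] (G : SimpleGraph V)
    [DecidableRel G.Adj] (W : Measure ℝ) : Measure ℝ :=
  (weightLaw V W).bind (spectralMeasure G)

/-- The number of cycles of length `k` in `G`, counted as subgraphs. -/
noncomputable def numCycles {V : Type*} (G : SimpleGraph V) (k : ℕ) : ℕ :=
  {H : G.Subgraph | ∃ (v : V) (p : G.Walk v v),
    p.IsCycle ∧ p.length = k ∧ p.toSubgraph = H}.ncard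

/-- All moments of `μ` are finite. -/
def HasFiniteMoments (μ : Measure ℝ) : Prop :=
  ∀ k : ℕ, Integrable (fun x : ℝ => x ^ k) μ

/-- Weak convergence `μ i → μ'` of measures on the real line. -/
def WeaklyTendsto (μ : ℕ → Measure ℝ) (μ' : Measure ℝ) : Prop :=
  ∀ f : ℝ →ᵇ ℝ, Tendsto (fun i => ∫ x, f x ∂(μ i)) atTop (𝓝 (∫ x, f x ∂μ'))

/-- Weak convergence in probability `ρ i → μ'` of random measures on the real line, where the `i`-th
random measure `ρ i` is defined on its own probability space `(Ω i, P i)`. -/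
def WeaklyTendstoInProbability {Ω : ℕ → Type*} [∀ i, MeasurableSpace (Ω i)]
    (P : ∀ i, Measure (Ω i)) (ρ : ∀ i, Ω i → Measure ℝ) (μ' : Measure ℝ) : Prop :=
  ∀ f : ℝ →ᵇ ℝ, ∀ ε : ℝ, 0 < ε →
    Tendsto (fun i => P i {ω | ε ≤ |∫ x, f x ∂(ρ i ω) - ∫ x, f x ∂μ'|}) atTop (𝓝 0)

/-- The density of Kesten's measure. -/
noncomputable def kestenDensity (d : ℕ) (x : ℝ) : ℝ :=
  if |x| ≤ 2 * √((d : ℝ) - 1) then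
    (d : ℝ) / (2 * Real.pi * ((d : ℝ) ^ 2 - x ^ 2)) * √(4 * ((d : ℝ) - 1) - x ^ 2)
  else 0

/-- Kesten's measure (meaningful for `d ≥ 2`). -/
noncomputable def kestenMeasure (d : ℕ) : Measure ℝ :=
  volume.withDensity fun x => ENNReal.ofReal (kestenDensity d x)

/-- The semicircle distribution on `[-1, 1]` (variance `1/4`). -/
noncomputable def semicircleMeasure : Measure ℝ :=
  volume.withDensity fun x =>
    ENNReal.ofReal (if |x| ≤ 1 then 2 / Real.pi * √(1 - x ^ 2) else 0)

end SpectralLimit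

/-! The normalised trace of the `k`-th power of the weighted adjacency matrix is the average over
the vertices `v` of the weighted closed walks of length `k` at `v`, and such walks see only the ball
of radius `k` about `v`. When short cycles are rare, all but `o(N)` of these balls are copies of the
ball in the `d`-regular tree (`card_not_isTreelikeAt_le`), and there the expectation is the tree's
own number `treeMoment d W k`. Vertices with disjoint balls contribute independent terms, so the
variance tends to zero and the traces converge in `L²`
(`IsTreelikeSeq.tendsto_integral_sq_trace_sub`). This is the convergence of moments.

Weak convergence needs another argument, since finite moments alone do not guarantee that the
limiting moments determine a measure. The weights are truncated to `[-M, M]`. For bounded weights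
the spectra lie in `[-dM, dM]`, where polynomials approximate a continuous `f` uniformly, and the
`L²` convergence of traces suffices. The truncation error is controlled uniformly in the graph by a
coupling of Hoffman–Wielandt type (`exists_coupling_eigenvalues`): the eigenvalues move, in
quadratic mean, by at most the normalised Frobenius distance, whose expected square is `d` times the
second moment of what was cut off. So the averages of `f` converge in `L¹` to a number independent
of the sequence (`IsTreelikeSeq.exists_tendsto_integral_abs_sub`). Tightness turns these numbers
into a measure, and Markov's inequality gives convergence in probability. One treelike sequence must
exist for the limit to be defined; it comes from Cayley graphs of large girth
(`exists_isTreelikeSeq`).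

For unit weights, walks in the tree are counted by a recursion on the distance to the root. With `x
= 2√q cos θ` and `q = d - 1`, the integrals of `x ^ k` times the spherical functions of the tree
against Kesten's density satisfy the same recursion (`integral_pow_mul_spherical`), so the moments
agree; compact support does the rest. The semicircle limit is dominated convergence of the rescaled
densities. -/

namespace SpectralLimit

/-! ### The `d`-regular tree of reduced words and its coverings of regular graphs. -/

/-- The neighbour along the edge with label `a` in the `d`-regular tree, whose vertices are the
reduced words over `Fin d`. -/
def step {d : ℕ} (a : Fin d) : List (Fin d) → List (Fin d)
  | [] => [a]
  | b :: l => if a = b then l else a :: b :: l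

/-- A word is reduced if no two consecutive letters agree. -/
def IsReduced {d : ℕ} (l : List (Fin d)) : Prop := l.IsChain (· ≠ ·)

section Words

variable {d : ℕ}

theorem isReduced_nil : IsReduced ([] : List (Fin d)) := List.isChain_nil

theorem IsReduced.of_cons {a : Fin d} {l : List (Fin d)} (h : IsReduced (a :: l)) :
    IsReduced l := List.IsChain.of_cons h

theorem IsReduced.step_eq_cons {a : Fin d} {l : List (Fin d)} (h : IsReduced (a :: l)) :
    step a l = a :: l := by
  cases l with
  | nil => rfl
  | cons b l =>
    have : a ≠ b := (List.isChain_cons_cons.1 h).1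
    simp [step, this]

theorem IsReduced.step {l : List (Fin d)} (h : IsReduced l) (a : Fin d) :
    IsReduced (step a l) := by
  cases l with
  | nil => exact List.isChain_singleton _
  | cons b l =>
    by_cases hab : a = b
    · simpa [SpectralLimit.step, hab] using h.of_cons
    · simp only [SpectralLimit.step, hab, if_false]
      exact List.isChain_cons_cons.2 ⟨hab, h⟩

theorem step_cons_self (a : Fin d) (l : List (Fin d)) : step a (a :: l) = l := by simp [step]

theorem IsReduced.step_step {l : List (Fin d)} (h : IsReduced l) (a : Fin d) :
    SpectralLimit.step a (SpectralLimit.step a l) = l := by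
  cases l with
  | nil => simp [SpectralLimit.step]
  | cons b l =>
    by_cases hab : a = b
    · subst hab
      rw [step_cons_self, h.step_eq_cons]
    · simp [SpectralLimit.step, hab]

theorem length_step_le (a : Fin d) (l : List (Fin d)) : (step a l).length ≤ l.length + 1 := by
  cases l with
  | nil => simp [step]
  | cons b l =>
    by_cases hab : a = b
    · simp only [step, hab, if_true, List.length_cons]; omega
    · simp [step, hab]

/-- The reduced words of length at most `R`: the ball of radius `R` in the tree. -/
noncomputable def words (d R : ℕ) : Finset (List (Fin d)) :=
  (Set.Finite.subset (List.finite_length_le (Fin d) R)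
    (show {l | IsReduced l ∧ l.length ≤ R} ⊆ {l | l.length ≤ R} from fun _ h => h.2)).toFinset

@[simp] theorem mem_words {R : ℕ} {l : List (Fin d)} :
    l ∈ words d R ↔ IsReduced l ∧ l.length ≤ R := by
  simp [words]

/-- The sum of the weights of all walks of length `k` in the tree from `l` to the root, where the
weight of a walk is the product of the weights `ω` of its edges. -/
def treeWalk (ω : Sym2 (List (Fin d)) → ℝ) : ℕ → List (Fin d) → ℝ
  | 0, l => if l = [] then 1 else 0
  | k + 1, l => ∑ a, ω s(l, step a l) * treeWalk ω k (step a l)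

/-- A walk of length `k` from `l` never leaves the ball of radius `l.length + k`. The set `sym2`
holds all pairs in the ball, not only edges; the superfluous coordinates are harmless. -/
theorem treeWalk_congr {ω ω' : Sym2 (List (Fin d)) → ℝ} {R : ℕ}
    (h : ∀ e ∈ (words d R).sym2, ω e = ω' e) (k : ℕ) (l : List (Fin d)) (hl : IsReduced l)
    (hk : l.length + k ≤ R) : treeWalk ω k l = treeWalk ω' k l := by
  induction k generalizing l with
  | zero => rfl
  | succ k ih =>
    simp only [treeWalk]
    refine Finset.sum_congr rfl fun a _ => ?_
    have h1 := length_step_le a l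
    rw [ih _ (hl.step a) (by omega), h]
    rw [Finset.mk_mem_sym2_iff]
    exact ⟨mem_words.2 ⟨hl, by omega⟩, mem_words.2 ⟨hl.step a, by omega⟩⟩

/-- A covering of the graph `G` by the `d`-regular tree. -/
def IsCover {V : Type*} (G : SimpleGraph V) (φ : List (Fin d) → V) : Prop :=
  ∀ l, Function.Injective (fun a => φ (step a l)) ∧
    Set.range (fun a => φ (step a l)) = G.neighborSet (φ l)

/-- The ball of radius `R` around `v` in `G` is isomorphic to the ball in the `d`-regular tree. -/
def IsTreelikeAt {V : Type*} (G : SimpleGraph V) (d R : ℕ) (v : V) : Prop :=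
  ∃ φ : List (Fin d) → V, IsCover G φ ∧ φ [] = v ∧ Set.InjOn φ (words d R)

variable {V : Type*} {G : SimpleGraph V}

theorem IsCover.adj {φ : List (Fin d) → V} (hφ : IsCover G φ) (a : Fin d)
    (l : List (Fin d)) : G.Adj (φ l) (φ (step a l)) := by
  have : φ (step a l) ∈ G.neighborSet (φ l) := by rw [← (hφ l).2]; exact ⟨a, rfl⟩
  exact this

/-- The images under `φ` of the edges of the path in the tree from `l` to the root. -/
def pathEdges (φ : List (Fin d) → V) : List (Fin d) → List (Sym2 V)
  | [] => []
  | a :: l => s(φ (a :: l), φ l) :: pathEdges φ l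

/-- If two consecutive edges had the same image, two different letters would lead from one word to
the same vertex, against local injectivity. So reduced words give non-backtracking walks. -/
theorem IsCover.isChain_pathEdges {φ : List (Fin d) → V} (hφ : IsCover G φ)
    (l : List (Fin d)) (hl : IsReduced l) : (pathEdges φ l).IsChain (· ≠ ·) := by
  induction l with
  | nil => exact List.isChain_nil
  | cons a l ih =>
    cases l with
    | nil => exact List.isChain_singleton _
    | cons b l =>
      refine List.isChain_cons_cons.2 ⟨fun h => ?_, ih hl.of_cons⟩
      have h1 : φ (step a (b :: l)) = φ (step b (b :: l)) := by
        rw [hl.step_eq_cons, step_cons_self]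
        rwa [Sym2.eq_swap, Sym2.congr_right] at h
      exact (List.isChain_cons_cons.1 hl).1 ((hφ _).1 h1)

theorem IsCover.exists_walk {φ : List (Fin d) → V} (hφ : IsCover G φ) (l : List (Fin d))
    (hl : IsReduced l) : ∃ p : G.Walk (φ l) (φ []),
      p.support = l.tails.map φ ∧ p.edges = pathEdges φ l ∧ p.length = l.length := by
  induction l with
  | nil => exact ⟨.nil, by simp [pathEdges]⟩
  | cons a l ih =>
    obtain ⟨p, h1, h2, h3⟩ := ih hl.of_cons
    have hadj := (hφ.adj a l).symm
    rw [hl.step_eq_cons] at hadj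
    exact ⟨.cons hadj p, by simp [h1], by simp [h2, pathEdges], by simp [h3]⟩

/-- Unique path lifting: starting from the root, local injectivity recovers each letter in turn from
the vertices visited. -/
theorem IsCover.eq_of_map_tails_eq {φ : List (Fin d) → V} (hφ : IsCover G φ)
    {l l' : List (Fin d)} (hl : IsReduced l) (hl' : IsReduced l')
    (h : l.tails.map φ = l'.tails.map φ) : l = l' := by
  induction l generalizing l' with
  | nil =>
    have := congrArg List.length h
    simp at this
    exact this.symm
  | cons a l ih =>
    cases l' with
    | nil =>
      have := congrArg List.length h
      simp at this
    | cons b l' =>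
      simp only [List.tails_cons, List.map_cons, List.cons.injEq] at h
      have h1 := ih hl.of_cons hl'.of_cons h.2
      subst h1
      have h2 : φ (step a l) = φ (step b l) := by
        rw [hl.step_eq_cons, hl'.step_eq_cons, h.1]
      rw [(hφ l).1 h2]

variable [Fintype V] [DecidableRel G.Adj]

/-- The graph need not be `d`-edge-colourable, so labels of neighbours chosen vertex by vertex do
not match along edges. Each word therefore carries, besides its image, a permutation of the letters;
on extension by `a` it is chosen so that the letter `a` leads back. -/
theorem exists_cover (hG : G.IsRegularOfDegree d) (v : V) :
    ∃ φ : List (Fin d) → V, IsCover G φ ∧ φ [] = v := by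
  have h1 (u : V) : ∃ f : Fin d → V, Function.Injective f ∧ Set.range f = G.neighborSet u := by
    have e : Fin d ≃ G.neighborFinset u :=
      ((G.neighborFinset u).equivFinOfCardEq (by rw [G.card_neighborFinset_eq_degree, hG u])).symm
    refine ⟨fun a => e a, Subtype.val_injective.comp e.injective, ?_⟩
    ext x
    constructor
    · rintro ⟨a, rfl⟩
      have := (e a).2
      rwa [SimpleGraph.mem_neighborFinset] at this
    · intro hx
      exact ⟨e.symm ⟨x, by simpa using hx⟩, by simp⟩
  choose nb hinj hrange using h1
  -- The summand `Unit` supplies a default for non-adjacent pairs, as `Fin d` may be empty.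
  have h2 (u u' : V) : ∃ b : Fin d ⊕ Unit, G.Adj u u' → ∃ b', b = .inl b' ∧ nb u b' = u' := by
    by_cases h : G.Adj u u'
    · have : u' ∈ Set.range (nb u) := by rw [hrange]; exact h
      obtain ⟨b, hb⟩ := this
      exact ⟨.inl b, fun _ => ⟨b, rfl, hb⟩⟩
    · exact ⟨.inr (), fun h' => absurd h' h⟩
  choose back hback using h2
  let st : List (Fin d) → V × Equiv.Perm (Fin d) := fun l => l.rec (v, 1) fun a _ s =>
    (nb s.1 (s.2 a), (back (nb s.1 (s.2 a)) s.1).elim (fun b => Equiv.swap a b) (fun _ => 1))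
  have hst (a : Fin d) (l : List (Fin d)) : (st (step a l)).1 = nb (st l).1 ((st l).2 a) := by
    cases l with
    | nil => rfl
    | cons b l =>
      by_cases hab : a = b
      · subst hab
        rw [step_cons_self]
        have hadj : G.Adj (nb (st l).1 ((st l).2 a)) (st l).1 := by
          have : nb (st l).1 ((st l).2 a) ∈ G.neighborSet (st l).1 := by
            rw [← hrange]; exact ⟨_, rfl⟩
          exact this.symm
        obtain ⟨b', hb', h3⟩ := hback _ _ hadj
        change _ = nb (nb (st l).1 ((st l).2 a)) ((back (nb (st l).1 ((st l).2 a)) (st l).1).elim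
          (fun b => Equiv.swap a b) (fun _ => 1) a)
        rw [hb']
        simp [h3]
      · simp only [step, hab, if_false]
        rfl
  refine ⟨fun l => (st l).1, fun l => ⟨?_, ?_⟩, rfl⟩
  · simp_rw [hst]
    exact (hinj _).comp (st l).2.injective
  · simp_rw [hst]
    rw [← hrange]
    exact (st l).2.surjective.range_comp (nb (st l).1)

variable [DecidableEq V]

/-- Walks in the graph lift to the tree, one step at a time, by local bijectivity alone. Injectivity
on the ball serves only at the end of the walk, where a lift ending over `φ []` must end at the root
itself. -/
theorem IsCover.pow_weightedAdj_apply {φ : List (Fin d) → V} (hφ : IsCover G φ) {R : ℕ}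
    (hinj : Set.InjOn φ (words d R)) (w : Sym2 V → ℝ) (k : ℕ) (l : List (Fin d))
    (hl : IsReduced l) (hk : l.length + k ≤ R) :
    (weightedAdj G w ^ k) (φ l) (φ []) = treeWalk (fun e => w (e.map φ)) k l := by
  induction k generalizing l with
  | zero =>
    have : φ l = φ [] ↔ l = [] :=
      hinj.eq_iff (by simp [hl]; omega) (by simp [isReduced_nil])
    simp [treeWalk, Matrix.one_apply, this]
  | succ k ih =>
    rw [pow_succ', Matrix.mul_apply]
    have hs : ∀ u, u ∉ Finset.univ.image (fun a => φ (step a l)) →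
        weightedAdj G w (φ l) u * (weightedAdj G w ^ k) u (φ []) = 0 := by
      intro u hu
      have : ¬ G.Adj (φ l) u := by
        intro h
        have h' : u ∈ G.neighborSet (φ l) := h
        rw [← (hφ l).2] at h'
        exact hu (by simpa using h')
      simp [weightedAdj, this]
    rw [← Finset.sum_subset (Finset.subset_univ (Finset.univ.image (fun a => φ (step a l))))
      (fun u _ hu => hs u hu), Finset.sum_image ((hφ l).1.injOn)]
    simp only [treeWalk]
    refine Finset.sum_congr rfl fun a _ => ?_
    have h1 := length_step_le a l
    rw [ih _ (hl.step a) (by omega)]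
    simp [weightedAdj, hφ.adj a l]

end Words

/-! ### Balls in regular graphs, and short cycles near vertices that are not treelike. -/

section Balls

variable {V : Type*} [Fintype V] (G : SimpleGraph V)

open scoped Classical in
/-- The vertices that can be reached from `v` by a walk of length at most `R`. -/
noncomputable def ball (R : ℕ) (v : V) : Finset V :=
  Finset.univ.filter fun u => ∃ p : G.Walk v u, p.length ≤ R

variable {G}

theorem mem_ball {R : ℕ} {u v : V} : u ∈ ball G R v ↔ ∃ p : G.Walk v u, p.length ≤ R := by
  simp [ball]

theorem self_mem_ball (R : ℕ) (v : V) : v ∈ ball G R v := mem_ball.2 ⟨.nil, by simp⟩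

theorem mem_ball_comm {R : ℕ} {u v : V} : u ∈ ball G R v ↔ v ∈ ball G R u := by
  simp only [mem_ball]
  constructor <;> rintro ⟨p, hp⟩ <;> exact ⟨p.reverse, by simpa using hp⟩

theorem ball_subset_ball_succ {k : ℕ} {u v : V} (h : G.Adj v u) :
    ball G k u ⊆ ball G (k + 1) v := by
  intro x hx
  obtain ⟨p, hp⟩ := mem_ball.1 hx
  exact mem_ball.2 ⟨.cons h p, by simpa using hp⟩

theorem mem_ball_of_not_disjoint {k : ℕ} {u v : V} (h : ¬ Disjoint (ball G k u) (ball G k v)) :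
    v ∈ ball G (2 * k) u := by
  obtain ⟨x, hx, hy⟩ := Finset.not_disjoint_iff.1 h
  obtain ⟨p, hp⟩ := mem_ball.1 hx
  obtain ⟨q, hq⟩ := mem_ball.1 hy
  exact mem_ball.2 ⟨p.append q.reverse, by simp; omega⟩

variable [DecidableEq V]

theorem card_ball_le [DecidableRel G.Adj] {d : ℕ} (hG : G.IsRegularOfDegree d) (R : ℕ) (v : V) :
    (ball G R v).card ≤ (d + 1) ^ R := by
  induction R generalizing v with
  | zero =>
    have : ball G 0 v ⊆ {v} := by
      intro u hu
      obtain ⟨p, hp⟩ := mem_ball.1 hu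
      have := SimpleGraph.Walk.eq_of_length_eq_zero (Nat.le_zero.1 hp)
      simp [this]
    simpa using Finset.card_le_card this
  | succ R ih =>
    have : ball G (R + 1) v ⊆ {v} ∪ (G.neighborFinset v).biUnion (ball G R) := by
      intro u hu
      obtain ⟨p, hp⟩ := mem_ball.1 hu
      cases p with
      | nil => simp
      | cons h p =>
        refine Finset.mem_union_right _ (Finset.mem_biUnion.2 ⟨_, by simpa using h, ?_⟩)
        exact mem_ball.2 ⟨p, by simpa using hp⟩
    have hpos : 1 ≤ (d + 1) ^ R := Nat.one_le_pow _ _ (by omega)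
    calc (ball G (R + 1) v).card
        ≤ 1 + ((G.neighborFinset v).biUnion (ball G R)).card :=
          (Finset.card_le_card this).trans ((Finset.card_union_le _ _).trans (by simp))
      _ ≤ 1 + d * (d + 1) ^ R := by
          gcongr
          refine (Finset.card_biUnion_le_card_mul _ _ _ fun u _ => ih u).trans ?_
          rw [G.card_neighborFinset_eq_degree, hG v]
      _ ≤ (d + 1) ^ (R + 1) := by rw [pow_succ]; nlinarith

/-- The two words give non-backtracking walks with the same ends. In an acyclic graph such walks are
paths and a path is determined by its ends, so unique lifting would make the words equal. Hence the
union `H` of the edges of the walks contains a cycle, which has no more edges than the two walks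
together and meets one of them. -/
theorem IsCover.exists_isCycle {d : ℕ} {φ : List (Fin d) → V} (hφ : IsCover G φ)
    {l l' : List (Fin d)} (hl : IsReduced l) (hl' : IsReduced l') (hne : l ≠ l')
    (h : φ l = φ l') : ∃ (x : V) (c : G.Walk x x), c.IsCycle ∧
      c.length ≤ l.length + l'.length ∧ x ∈ ball G (max l.length l'.length) (φ []) := by
  obtain ⟨p, hp1, hp2, hp3⟩ := hφ.exists_walk l hl
  obtain ⟨q, hq1, hq2, hq3⟩ := hφ.exists_walk l' hl'
  set H : SimpleGraph V := SimpleGraph.fromEdgeSet {e | e ∈ p.edges ∨ e ∈ q.edges} with hH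
  have hHe (e) : e ∈ H.edgeSet ↔ e ∈ p.edges ∨ e ∈ q.edges := by
    rw [hH, SimpleGraph.edgeSet_fromEdgeSet]
    simp only [Set.mem_sdiff, Set.mem_ofPred_eq, and_iff_left_iff_imp]
    rintro (h | h) he
    · exact G.not_isDiag_of_mem_edgeSet (p.edges_subset_edgeSet h) he
    · exact G.not_isDiag_of_mem_edgeSet (q.edges_subset_edgeSet h) he
  have hHG : H ≤ G := by
    rw [← SimpleGraph.edgeSet_subset_edgeSet]
    intro e he
    rcases (hHe e).1 he with h | h
    · exact p.edges_subset_edgeSet h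
    · exact q.edges_subset_edgeSet h
  have hH' : ¬ H.IsAcyclic := by
    intro hac
    set p' := p.transfer H fun e he => (hHe e).2 (.inl he) with hp'
    set q' := q.transfer H fun e he => (hHe e).2 (.inr he) with hq'
    have hpp : p'.IsPath := by
      rw [hac.isPath_iff_isChain, hp', SimpleGraph.Walk.edges_transfer, hp2]
      exact hφ.isChain_pathEdges l hl
    have hqq : (q'.copy h.symm rfl).IsPath := by
      rw [SimpleGraph.Walk.isPath_copy, hac.isPath_iff_isChain, hq',
        SimpleGraph.Walk.edges_transfer, hq2]
      exact hφ.isChain_pathEdges l' hl'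
    have := (hac.subsingleton_path _ _).elim ⟨p', hpp⟩ ⟨_, hqq⟩
    have h2 := congrArg (fun r : H.Path _ _ => r.1.support) this
    simp only [SimpleGraph.Walk.support_copy, hp', hq', SimpleGraph.Walk.support_transfer, hp1,
      hq1] at h2
    exact hne (hφ.eq_of_map_tails_eq hl hl' h2)
  rw [SimpleGraph.IsAcyclic] at hH'
  push Not at hH'
  obtain ⟨x, c, hc⟩ := hH'
  refine ⟨x, c.mapLe hHG, hc.mapLe hHG, ?_, ?_⟩
  · rw [SimpleGraph.Walk.length_map, ← c.length_edges, ← hp3, ← hq3, ← p.length_edges,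
      ← q.length_edges, ← List.length_append]
    refine (List.Nodup.subperm hc.edges_nodup fun e he => ?_).length_le
    exact List.mem_append.2 ((hHe e).1 (c.edges_subset_edgeSet he))
  · have hx : x ∈ p.support ∨ x ∈ q.support := by
      cases c with
      | nil => exact absurd rfl hc.ne_nil
      | @cons _ y _ hxy c' =>
        rcases (hHe s(x, y)).1 hxy with h | h
        · exact .inl (p.fst_mem_support_of_mem_edges h)
        · exact .inr (q.fst_mem_support_of_mem_edges h)
    rcases hx with hx | hx
    · refine mem_ball.2 ⟨(p.dropUntil x hx).reverse, ?_⟩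
      have := p.length_dropUntil_le_length hx
      rw [SimpleGraph.Walk.length_reverse]
      omega
    · refine mem_ball.2 ⟨(q.dropUntil x hx).reverse, ?_⟩
      have := q.length_dropUntil_le_length hx
      rw [SimpleGraph.Walk.length_reverse]
      omega

variable [DecidableRel G.Adj]

-- A covering that is not injective on the ball produces a cycle of length at most `2 * R` meeting
-- the ball. So the bad vertices lie in the `R`-balls about the vertices of short cycles.
open scoped Classical in
theorem card_not_isTreelikeAt_le {d : ℕ} (hG : G.IsRegularOfDegree d) (R : ℕ) :
    (Finset.univ.filter fun v => ¬ IsTreelikeAt G d R v).card ≤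
      ∑ k ∈ Finset.Icc 3 (2 * R), numCycles G k * ((k + 1) * (d + 1) ^ R) := by
  set cyc : ℕ → Finset G.Subgraph := fun k => Finset.univ.filter fun H =>
    ∃ (v : V) (p : G.Walk v v), p.IsCycle ∧ p.length = k ∧ p.toSubgraph = H with hcyc
  have hcard (k) : (cyc k).card = numCycles G k := by
    rw [numCycles, ← Set.ncard_coe_finset]
    congr 1
    ext H
    simp [hcyc]
  have hsub : (Finset.univ.filter fun v => ¬ IsTreelikeAt G d R v) ⊆
      (Finset.Icc 3 (2 * R)).biUnion fun k => (cyc k).biUnion fun H =>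
        H.verts.toFinset.biUnion fun x => ball G R x := by
    intro v hv
    obtain ⟨φ, hφ, h0⟩ := exists_cover hG v
    have hni : ¬ Set.InjOn φ (words d R) := fun hi =>
      (Finset.mem_filter.1 hv).2 ⟨φ, hφ, h0, hi⟩
    simp only [Set.InjOn] at hni
    push Not at hni
    obtain ⟨l, hl, l', hl', he, hne⟩ := hni
    simp only [Finset.mem_coe, mem_words] at hl hl'
    obtain ⟨x, c, hc, hlen, hx⟩ := hφ.exists_isCycle hl.1 hl'.1 hne he
    simp only [Finset.mem_biUnion]
    refine ⟨c.length, Finset.mem_Icc.2 ⟨hc.three_le_length, by omega⟩, c.toSubgraph, ?_, x, ?_, ?_⟩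
    · simp only [hcyc, Finset.mem_filter, Finset.mem_univ, true_and]
      exact ⟨x, c, hc, rfl, rfl⟩
    · simp
    · rw [mem_ball_comm, ← h0]
      obtain ⟨p, hp⟩ := mem_ball.1 hx
      exact mem_ball.2 ⟨p, hp.trans (max_le hl.2 hl'.2)⟩
  refine (Finset.card_le_card hsub).trans (Finset.card_biUnion_le.trans ?_)
  refine Finset.sum_le_sum fun k _ => ?_
  rw [← hcard]
  refine Finset.card_biUnion_le_card_mul _ _ _ fun H hH => ?_
  refine (Finset.card_biUnion_le_card_mul _ _ _ fun x _ => card_ball_le hG R x).trans ?_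
  gcongr
  obtain ⟨v, p, -, rfl, rfl⟩ := (Finset.mem_filter.1 hH).2
  have : p.toSubgraph.verts.toFinset ⊆ p.support.toFinset := by
    intro x; simp
  -- The support of a closed walk lists its base point twice, whence the crude `k + 1` for a cycle
  -- of length `k`.
  exact (Finset.card_le_card this).trans (p.support.toFinset_card_le.trans (by simp))

end Balls

/-! ### Marginals of independent weights and the moments of the weighted tree. -/

open ProbabilityTheory

theorem map_pi_comp_injective {ι κ : Type*} [Fintype ι] [Fintype κ] (W : Measure ℝ)
    [IsProbabilityMeasure W] {g : κ → ι} (hg : Function.Injective g) :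
    (Measure.pi fun _ : ι => W).map (fun w s => w (g s)) = Measure.pi fun _ : κ => W := by
  symm
  refine Measure.pi_eq fun t ht => ?_
  rw [Measure.map_apply (by fun_prop) (MeasurableSet.univ_pi ht)]
  have hpre : (fun (w : ι → ℝ) s => w (g s)) ⁻¹' Set.univ.pi t =
      Set.univ.pi (Function.extend g t fun _ => Set.univ) := by
    ext w
    simp only [Set.mem_preimage, Set.mem_pi, Set.mem_univ, true_implies]
    constructor
    · intro h i
      by_cases hi : ∃ s, g s = i
      · obtain ⟨s, rfl⟩ := hi
        rw [hg.extend_apply]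
        exact h s
      · rw [Function.extend_apply' _ _ _ hi]
        trivial
    · intro h s
      have := h (g s)
      rwa [hg.extend_apply] at this
  rw [hpre, Measure.pi_pi]
  symm
  refine Fintype.prod_of_injective g hg _ _ (fun i hi => ?_) fun s => ?_
  · rw [Function.extend_apply' _ _ _ hi, measure_univ]
  · rw [hg.extend_apply]

/-- The expected number of closed walks of length `k` at the root of the `d`-regular tree, weighted
by the product of the weights of their edges, for independent edge weights of law `W`. -/
noncomputable def treeMoment (d : ℕ) (W : Measure ℝ) (k : ℕ) : ℝ :=
  ∫ ω, treeWalk (Function.extend Subtype.val ω 0) k []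
    ∂(Measure.pi fun _ : (words d k).sym2 => W)

theorem injOn_sym2_map {α β : Type*} {s : Finset α} {φ : α → β} (h : Set.InjOn φ s) :
    Set.InjOn (Sym2.map φ) s.sym2 := by
  intro e he e' he' hee
  induction e with | _ x y
  induction e' with | _ x' y'
  simp only [Finset.mem_coe, Finset.mk_mem_sym2_iff] at he he'
  simp only [Sym2.map_mk, Sym2.eq_iff] at hee ⊢
  rcases hee with ⟨h1, h2⟩ | ⟨h1, h2⟩
  · exact .inl ⟨h he.1 he'.1 h1, h he.2 he'.2 h2⟩
  · exact .inr ⟨h he.1 he'.2 h1, h he.2 he'.1 h2⟩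

theorem continuous_treeWalk {d : ℕ} {X : Type*} [TopologicalSpace X]
    {F : X → Sym2 (List (Fin d)) → ℝ} (hF : ∀ e, Continuous fun x => F x e) (k : ℕ)
    (l : List (Fin d)) : Continuous fun x => treeWalk (F x) k l := by
  induction k generalizing l with
  | zero => exact continuous_const
  | succ k ih =>
    simp only [treeWalk]
    exact continuous_finsetSum _ fun a _ => (hF _).mul (ih _)

theorem continuous_extend_val {E : Type*} (S : Finset E) (e : E) :
    Continuous fun ω : S → ℝ => Function.extend Subtype.val ω (0 : E → ℝ) e := by
  by_cases he : e ∈ S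
  · have (ω : S → ℝ) : Function.extend Subtype.val ω (0 : E → ℝ) e = ω ⟨e, he⟩ :=
      Subtype.val_injective.extend_apply ω 0 ⟨e, he⟩
    simp_rw [this]
    exact continuous_apply _
  · have (ω : S → ℝ) : Function.extend Subtype.val ω (0 : E → ℝ) e = 0 := by
      rw [Function.extend_apply']
      · rfl
      · rintro ⟨x, rfl⟩
        exact he x.2
    simp_rw [this]
    exact continuous_const

/-! ### First and second moments of diagonal entries of powers, and the variance of the trace. -/

section Graph

variable {V : Type*} [Fintype V] [DecidableEq V] {G : SimpleGraph V} [DecidableRel G.Adj] {d : ℕ}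

instance (W : Measure ℝ) [IsProbabilityMeasure W] : IsProbabilityMeasure (weightLaw V W) := by
  unfold weightLaw; infer_instance

/-- The cover maps pairs in the tree ball injectively to pairs of vertices, so the pulled-back
weights are again independent with law `W`. -/
theorem IsTreelikeAt.integral_pow_weightedAdj {v : V} {k : ℕ} (h : IsTreelikeAt G d k v)
    (W : Measure ℝ) [IsProbabilityMeasure W] :
    ∫ w, (weightedAdj G w ^ k) v v ∂(weightLaw V W) = treeMoment d W k := by
  obtain ⟨φ, hφ, rfl, hinj⟩ := h
  have hg : Function.Injective fun e : (words d k).sym2 => e.1.map φ := by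
    intro e e' hee
    exact Subtype.ext (injOn_sym2_map hinj e.2 e'.2 hee)
  rw [treeMoment, ← map_pi_comp_injective W hg, integral_map]
  · refine integral_congr_ae (.of_forall fun w => ?_)
    change (weightedAdj G w ^ k) (φ []) (φ []) = _
    rw [hφ.pow_weightedAdj_apply hinj w k [] isReduced_nil (by simp)]
    refine treeWalk_congr (R := k) (fun e he => ?_) k [] isReduced_nil (by simp)
    exact (Subtype.val_injective.extend_apply
      (fun e : (words d k).sym2 => w (e.1.map φ)) 0 ⟨e, he⟩).symm
  · exact (measurable_pi_lambda _ fun s => measurable_pi_apply _).aemeasurable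
  · exact (continuous_treeWalk (continuous_extend_val _) k []).aestronglyMeasurable

theorem pow_weightedAdj_congr {w w' : Sym2 V → ℝ} (k : ℕ) (v u : V)
    (h : ∀ e ∈ (ball G k v).sym2, w e = w' e) :
    (weightedAdj G w ^ k) v u = (weightedAdj G w' ^ k) v u := by
  induction k generalizing v with
  | zero => simp
  | succ k ih =>
    simp only [pow_succ', Matrix.mul_apply]
    refine Finset.sum_congr rfl fun x _ => ?_
    by_cases hx : G.Adj v x
    · rw [ih x fun e he => h e (Finset.sym2_mono (ball_subset_ball_succ hx) he)]
      simp only [weightedAdj, Matrix.of_apply, hx, if_true]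
      rw [h]
      rw [Finset.mk_mem_sym2_iff]
      exact ⟨self_mem_ball _ _, ball_subset_ball_succ hx (self_mem_ball _ _)⟩
    · simp [weightedAdj, hx]

theorem abs_pow_weightedAdj_le (hG : G.IsRegularOfDegree d) {w : Sym2 V → ℝ} {K : ℝ} (hK : 0 ≤ K)
    (k : ℕ) (v u : V) (h : ∀ e ∈ (ball G k v).sym2, |w e| ≤ K) :
    |(weightedAdj G w ^ k) v u| ≤ (d * K) ^ k := by
  induction k generalizing v with
  | zero =>
    by_cases huv : v = u <;> simp [huv]
  | succ k ih =>
    simp only [pow_succ', Matrix.mul_apply]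
    have h1 : ∀ x ∈ Finset.univ, x ∉ G.neighborFinset v →
        weightedAdj G w v x * (weightedAdj G w ^ k) x u = 0 := by
      intro x _ hx
      have : ¬ G.Adj v x := by simpa using hx
      simp [weightedAdj, this]
    rw [← Finset.sum_subset (Finset.subset_univ (G.neighborFinset v)) h1]
    refine (Finset.abs_sum_le_sum_abs _ _).trans ?_
    have h2 : ∀ x ∈ G.neighborFinset v,
        |weightedAdj G w v x * (weightedAdj G w ^ k) x u| ≤ K * (d * K) ^ k := by
      intro x hx
      have hx : G.Adj v x := by simpa using hx
      rw [abs_mul]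
      gcongr
      · simp only [weightedAdj, Matrix.of_apply, hx, if_true]
        refine h _ ?_
        rw [Finset.mk_mem_sym2_iff]
        exact ⟨self_mem_ball _ _, ball_subset_ball_succ hx (self_mem_ball _ _)⟩
      · exact ih x fun e he => h e (Finset.sym2_mono (ball_subset_ball_succ hx) he)
    refine (Finset.sum_le_card_nsmul _ _ _ h2).trans ?_
    rw [G.card_neighborFinset_eq_degree, hG v, nsmul_eq_mul, mul_assoc]

/-- There are at most `d ^ k` walks, each bounded by the `k`-th power of the largest weight in the
ball. Replacing that maximum by a sum makes the expectation depend on one moment of `W` and the size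
of the ball only. -/
theorem sq_pow_weightedAdj_le (hG : G.IsRegularOfDegree d) (w : Sym2 V → ℝ) (k : ℕ) (v u : V) :
    ((weightedAdj G w ^ k) v u) ^ 2 ≤
      (d : ℝ) ^ (2 * k) * ∑ e ∈ (ball G k v).sym2, w e ^ (2 * k) := by
  have hne : (ball G k v).sym2.Nonempty :=
    ⟨s(v, v), Finset.mk_mem_sym2_iff.2 ⟨self_mem_ball _ _, self_mem_ball _ _⟩⟩
  obtain ⟨e₀, he₀, hmax⟩ := Finset.exists_max_image _ (fun e => |w e|) hne
  have h1 := abs_pow_weightedAdj_le hG (abs_nonneg (w e₀)) k v u hmax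
  calc ((weightedAdj G w ^ k) v u) ^ 2 = |(weightedAdj G w ^ k) v u| ^ 2 := (sq_abs _).symm
    _ ≤ ((d * |w e₀|) ^ k) ^ 2 := by gcongr
    _ = d ^ (2 * k) * w e₀ ^ (2 * k) := by
      rw [← pow_mul, mul_comm k 2, mul_pow, (even_two_mul k).pow_abs]
    _ ≤ _ := by
      gcongr
      exact Finset.single_le_sum (f := fun e => w e ^ (2 * k))
        (fun e _ => (even_two_mul k).pow_nonneg _) he₀

theorem continuous_pow_weightedAdj (k : ℕ) (v u : V) :
    Continuous fun w => (weightedAdj G w ^ k) v u :=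
  ((continuous_weightedAdj G).pow k).matrix_elem v u

/-- A bound for the second moment of the entries of the `k`-th power of the adjacency matrix. -/
noncomputable def powBound (d : ℕ) (W : Measure ℝ) (k : ℕ) : ℝ :=
  (d : ℝ) ^ (2 * k) * ((((d + 1) ^ k + 1) ^ 2 : ℕ) * ∫ x, x ^ (2 * k) ∂W)

theorem powBound_nonneg (d : ℕ) (W : Measure ℝ) (k : ℕ) : 0 ≤ powBound d W k := by
  have : 0 ≤ ∫ x, x ^ (2 * k) ∂W := integral_nonneg fun x => (even_two_mul k).pow_nonneg x
  unfold powBound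
  positivity

variable {W : Measure ℝ} [IsProbabilityMeasure W]

theorem integrable_weight_pow (hW : HasFiniteMoments W) (e : Sym2 V) (k : ℕ) :
    Integrable (fun w => w e ^ k) (weightLaw V W) :=
  integrable_comp_eval (μ := fun _ : Sym2 V => W) (i := e) (f := fun x : ℝ => x ^ k) (hW k)

theorem integral_weight_comp (e : Sym2 V) {f : ℝ → ℝ} (hf : Measurable f) :
    ∫ w, f (w e) ∂(weightLaw V W) = ∫ x, f x ∂W :=
  integral_comp_eval (μ := fun _ : Sym2 V => W) hf.aestronglyMeasurable

theorem memLp_pow_weightedAdj (hG : G.IsRegularOfDegree d) (hW : HasFiniteMoments W) (k : ℕ)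
    (v u : V) : MemLp (fun w => (weightedAdj G w ^ k) v u) 2 (weightLaw V W) := by
  rw [memLp_two_iff_integrable_sq (continuous_pow_weightedAdj k v u).aestronglyMeasurable]
  refine Integrable.mono' (((integrable_finsetSum ((ball G k v).sym2) fun e _ =>
    integrable_weight_pow hW e (2 * k))).const_mul ((d : ℝ) ^ (2 * k)))
    ((continuous_pow_weightedAdj k v u).pow 2).aestronglyMeasurable (.of_forall fun w => ?_)
  rw [Real.norm_of_nonneg (sq_nonneg _)]
  exact sq_pow_weightedAdj_le hG w k v u

theorem integral_sq_pow_weightedAdj_le (hG : G.IsRegularOfDegree d) (hW : HasFiniteMoments W)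
    (k : ℕ) (v u : V) :
    ∫ w, ((weightedAdj G w ^ k) v u) ^ 2 ∂(weightLaw V W) ≤ powBound d W k := by
  have hi : Integrable (fun w : Sym2 V → ℝ =>
      (d : ℝ) ^ (2 * k) * ∑ e ∈ (ball G k v).sym2, w e ^ (2 * k)) (weightLaw V W) :=
    (integrable_finsetSum _ fun e _ => integrable_weight_pow hW e (2 * k)).const_mul _
  refine (integral_mono (memLp_pow_weightedAdj hG hW k v u).integrable_sq hi
    fun w => sq_pow_weightedAdj_le hG w k v u).trans ?_
  rw [integral_const_mul, integral_finsetSum _ fun e _ => integrable_weight_pow hW e (2 * k)]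
  rw [Finset.sum_congr rfl fun e _ => integral_weight_comp (W := W) e
    (f := fun x => x ^ (2 * k)) (by fun_prop), Finset.sum_const, nsmul_eq_mul, powBound]
  have : 0 ≤ ∫ x, x ^ (2 * k) ∂W := integral_nonneg fun x => (even_two_mul k).pow_nonneg x
  gcongr
  rw [Finset.card_sym2]
  refine (Nat.choose_le_pow _ _).trans ?_
  gcongr
  exact card_ball_le hG k v

/-- The two entries are functions of weights on disjoint sets of pairs. -/
theorem indepFun_pow_weightedAdj {k : ℕ} {u v : V} (h : Disjoint (ball G k u) (ball G k v)) :
    IndepFun (fun w => (weightedAdj G w ^ k) u u) (fun w => (weightedAdj G w ^ k) v v)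
      (weightLaw V W) := by
  have hdisj : Disjoint (ball G k u).sym2 (ball G k v).sym2 := by
    rw [Finset.disjoint_left] at h ⊢
    intro e
    induction e with | _ x y
    rw [Finset.mk_mem_sym2_iff, Finset.mk_mem_sym2_iff]
    exact fun h1 h2 => h h1.1 h2.1
  have h1 := (iIndepFun_pi (μ := fun _ : Sym2 V => W) (X := fun _ x => x)
    fun _ => aemeasurable_id).indepFun_finset _ _ hdisj fun e => measurable_pi_apply e
  let F (x : V) : ((ball G k x).sym2 → ℝ) → ℝ := fun ω =>
    (weightedAdj G (Function.extend Subtype.val ω 0) ^ k) x x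
  have hF (x : V) : Measurable (F x) :=
    ((continuous_pow_weightedAdj k x x).comp
      (continuous_pi fun e => continuous_extend_val _ e)).measurable
  have h2 (x : V) (w : Sym2 V → ℝ) :
      (weightedAdj G w ^ k) x x = F x fun e : (ball G k x).sym2 => w e :=
    pow_weightedAdj_congr k x x fun e he => (Subtype.val_injective.extend_apply
      (fun e : (ball G k x).sym2 => w e.1) 0 ⟨e, he⟩).symm
  have h3 := h1.comp (hF u) (hF v)
  refine h3.congr ?_ ?_ <;> exact .of_forall fun w => (h2 _ w).symm


/-- A bound for the second moment of the deviation of a diagonal entry of the `k`-th power of the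
adjacency matrix from `treeMoment d W k`. -/
noncomputable def devBound (d : ℕ) (W : Measure ℝ) (k : ℕ) : ℝ :=
  2 * powBound d W k + 2 * treeMoment d W k ^ 2

theorem devBound_nonneg (d : ℕ) (W : Measure ℝ) (k : ℕ) : 0 ≤ devBound d W k := by
  have := powBound_nonneg d W k
  unfold devBound
  positivity

theorem memLp_pow_weightedAdj_sub (hG : G.IsRegularOfDegree d) (hW : HasFiniteMoments W) (k : ℕ)
    (v : V) : MemLp (fun w => (weightedAdj G w ^ k) v v - treeMoment d W k) 2 (weightLaw V W) :=
  (memLp_pow_weightedAdj hG hW k v v).sub (memLp_const _)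

theorem integral_sq_pow_weightedAdj_sub_le (hG : G.IsRegularOfDegree d) (hW : HasFiniteMoments W)
    (k : ℕ) (v : V) :
    ∫ w, ((weightedAdj G w ^ k) v v - treeMoment d W k) ^ 2 ∂(weightLaw V W) ≤ devBound d W k := by
  have h1 := (memLp_pow_weightedAdj hG hW k v v).integrable_sq
  calc _ ≤ ∫ w, (2 * ((weightedAdj G w ^ k) v v) ^ 2 + 2 * treeMoment d W k ^ 2)
        ∂(weightLaw V W) := by
        refine integral_mono (memLp_pow_weightedAdj_sub hG hW k v).integrable_sq
          ((h1.const_mul 2).add (integrable_const _)) fun w => ?_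
        dsimp only
        nlinarith [sq_nonneg ((weightedAdj G w ^ k) v v + treeMoment d W k)]
    _ ≤ devBound d W k := by
        rw [integral_add (h1.const_mul 2) (integrable_const _), integral_const_mul,
          integral_const, probReal_univ, one_smul, devBound]
        have := integral_sq_pow_weightedAdj_le hG hW k v v
        linarith

theorem integral_mul_pow_weightedAdj_sub_le (hG : G.IsRegularOfDegree d) (hW : HasFiniteMoments W)
    (k : ℕ) (u v : V) :
    ∫ w, ((weightedAdj G w ^ k) u u - treeMoment d W k) *
      ((weightedAdj G w ^ k) v v - treeMoment d W k) ∂(weightLaw V W) ≤ devBound d W k := by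
  have hu := memLp_pow_weightedAdj_sub hG hW k u
  have hv := memLp_pow_weightedAdj_sub hG hW k v
  have hu' := integral_sq_pow_weightedAdj_sub_le hG hW k u
  have hv' := integral_sq_pow_weightedAdj_sub_le hG hW k v
  calc _ ≤ ∫ w, (2⁻¹ * ((weightedAdj G w ^ k) u u - treeMoment d W k) ^ 2 +
        2⁻¹ * ((weightedAdj G w ^ k) v v - treeMoment d W k) ^ 2) ∂(weightLaw V W) := by
        refine integral_mono (hu.integrable_mul hv)
          ((hu.integrable_sq.const_mul _).add (hv.integrable_sq.const_mul _)) fun w => ?_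
        dsimp only [Pi.mul_apply]
        nlinarith [sq_nonneg ((weightedAdj G w ^ k) u u - (weightedAdj G w ^ k) v v)]
    _ ≤ devBound d W k := by
        rw [integral_add (hu.integrable_sq.const_mul _) (hv.integrable_sq.const_mul _),
          integral_const_mul, integral_const_mul]
        linarith

theorem IsTreelikeAt.integral_mul_pow_weightedAdj_sub (hG : G.IsRegularOfDegree d)
    (hW : HasFiniteMoments W) {k : ℕ} {u v : V} (hu : IsTreelikeAt G d k u)
    (h : Disjoint (ball G k u) (ball G k v)) :
    ∫ w, ((weightedAdj G w ^ k) u u - treeMoment d W k) *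
      ((weightedAdj G w ^ k) v v - treeMoment d W k) ∂(weightLaw V W) = 0 := by
  have h1 := (indepFun_pow_weightedAdj (W := W) h).comp
    (φ := fun x => x - treeMoment d W k) (ψ := fun x => x - treeMoment d W k)
    (by fun_prop) (by fun_prop)
  have h2 := h1.integral_fun_mul_eq_mul_integral
    (memLp_pow_weightedAdj_sub hG hW k u).aestronglyMeasurable
    (memLp_pow_weightedAdj_sub hG hW k v).aestronglyMeasurable
  simp only [Function.comp_apply] at h2
  rw [h2, integral_sub ((memLp_pow_weightedAdj hG hW k u u).integrable one_le_two)
    (integrable_const _), hu.integral_pow_weightedAdj, integral_const, probReal_univ, one_smul,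
    sub_self, zero_mul]

-- Expand the square as a double sum of covariances over `u` and `v`. If `u` is treelike its factor
-- is centred, so by independence only `v` within distance `2 * k` contribute; `v` itself need not
-- be treelike. A bad `u` is charged for all `N` partners.
open scoped Classical in
theorem integral_sq_trace_sub_le (hG : G.IsRegularOfDegree d) (hW : HasFiniteMoments W)
    [Nonempty V] (k : ℕ) :
    ∫ w, ((Fintype.card V : ℝ)⁻¹ * (weightedAdj G w ^ k).trace - treeMoment d W k) ^ 2
      ∂(weightLaw V W) ≤ devBound d W k * ((((d + 1) ^ (2 * k) : ℕ) +
        (Finset.univ.filter fun v => ¬ IsTreelikeAt G d k v).card) / Fintype.card V) := by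
  set N : ℝ := (Fintype.card V : ℝ) with hN
  set m := treeMoment d W k
  set B := Finset.univ.filter fun v => ¬ IsTreelikeAt G d k v with hB
  have hNpos : 0 < N := by rw [hN]; exact_mod_cast Fintype.card_pos
  set Y : V → (Sym2 V → ℝ) → ℝ := fun v w => (weightedAdj G w ^ k) v v - m with hY
  have hYi (u v : V) : Integrable (fun w => Y u w * Y v w) (weightLaw V W) :=
    (memLp_pow_weightedAdj_sub hG hW k u).integrable_mul (memLp_pow_weightedAdj_sub hG hW k v)
  have h1 (w : Sym2 V → ℝ) : (N⁻¹ * (weightedAdj G w ^ k).trace - m) ^ 2 =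
      (N⁻¹) ^ 2 * ∑ u, ∑ v, Y u w * Y v w := by
    rw [← Finset.sum_mul_sum, ← sq, ← mul_pow]
    congr 1
    simp only [hY, Finset.sum_sub_distrib, Matrix.trace, Matrix.diag_apply, Finset.sum_const,
      Finset.card_univ, nsmul_eq_mul, ← hN]
    field_simp
  simp_rw [h1]
  rw [integral_const_mul, integral_finsetSum _ fun u _ => integrable_finsetSum _ fun v _ => hYi u v]
  simp_rw [integral_finsetSum Finset.univ fun v _ => hYi _ v]
  have hD := devBound_nonneg d W k
  have h2 (u : V) : ∑ v, ∫ w, Y u w * Y v w ∂(weightLaw V W) ≤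
      devBound d W k * ((d + 1) ^ (2 * k) : ℕ) + devBound d W k * (if u ∈ B then N else 0) := by
    by_cases hu : u ∈ B
    · rw [if_pos hu]
      have : ∑ v, ∫ w, Y u w * Y v w ∂(weightLaw V W) ≤ ∑ _v : V, devBound d W k :=
        Finset.sum_le_sum fun v _ => integral_mul_pow_weightedAdj_sub_le hG hW k u v
      rw [Finset.sum_const, Finset.card_univ, nsmul_eq_mul, ← hN] at this
      have : 0 ≤ devBound d W k * ((d + 1) ^ (2 * k) : ℕ) := by positivity
      linarith
    · rw [if_neg hu, mul_zero, add_zero]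
      have hu' : IsTreelikeAt G d k u := by simpa [hB] using hu
      rw [← Finset.sum_subset (Finset.subset_univ (ball G (2 * k) u))]
      · refine (Finset.sum_le_card_nsmul _ _ _ fun v _ =>
          integral_mul_pow_weightedAdj_sub_le hG hW k u v).trans ?_
        rw [nsmul_eq_mul, mul_comm]
        gcongr
        exact card_ball_le hG _ _
      · intro v _ hv
        exact hu'.integral_mul_pow_weightedAdj_sub hG hW
          (not_not.1 fun h => hv (mem_ball_of_not_disjoint h))
  calc _ ≤ (N⁻¹) ^ 2 * ∑ u, (devBound d W k * ((d + 1) ^ (2 * k) : ℕ) +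
        devBound d W k * (if u ∈ B then N else 0)) := by
        gcongr with u
        exact h2 u
    _ = _ := by
        rw [Finset.sum_add_distrib, Finset.sum_const, ← Finset.mul_sum, Finset.card_univ,
          nsmul_eq_mul, ← hN, Finset.sum_ite_mem, Finset.univ_inter, Finset.sum_const,
          nsmul_eq_mul]
        field_simp

end Graph

/-! ### Convergence of normalised traces along treelike sequences. -/

/-- A sequence of `d`-regular graphs whose sizes tend to infinity and which have few short
cycles. -/
structure IsTreelikeSeq (d : ℕ) (N : ℕ → ℕ) (G : ∀ i, SimpleGraph (Fin (N i)))
    [∀ i, DecidableRel (G i).Adj] : Prop where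
  regular : ∀ i, (G i).IsRegularOfDegree d
  tendsto_card : Tendsto N atTop atTop
  numCycles_isLittleO : ∀ k : ℕ, 3 ≤ k →
    (fun i => (numCycles (G i) k : ℝ)) =o[atTop] fun i => (N i : ℝ)

section Seq

variable {d : ℕ} {N : ℕ → ℕ} {G : ∀ i, SimpleGraph (Fin (N i))} [∀ i, DecidableRel (G i).Adj]

theorem IsTreelikeSeq.eventually_pos (h : IsTreelikeSeq d N G) : ∀ᶠ i in atTop, 0 < N i :=
  h.tendsto_card.eventually_gt_atTop 0

open scoped Classical in
theorem IsTreelikeSeq.tendsto_card_not_isTreelikeAt (h : IsTreelikeSeq d N G) (R : ℕ) :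
    Tendsto (fun i => ((Finset.univ.filter fun v => ¬ IsTreelikeAt (G i) d R v).card : ℝ) / N i)
      atTop (𝓝 0) := by
  have h1 : Tendsto (fun i => ∑ k ∈ Finset.Icc 3 (2 * R),
      (numCycles (G i) k : ℝ) / N i * (((k + 1) * (d + 1) ^ R : ℕ) : ℝ)) atTop (𝓝 0) := by
    rw [← Finset.sum_const_zero (s := Finset.Icc 3 (2 * R))]
    refine tendsto_finsetSum _ fun k hk => ?_
    have := (h.numCycles_isLittleO k (Finset.mem_Icc.1 hk).1).tendsto_div_nhds_zero
    simpa using this.mul_const (((k + 1) * (d + 1) ^ R : ℕ) : ℝ)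
  refine squeeze_zero (fun i => by positivity) (fun i => ?_) h1
  simp_rw [div_mul_eq_mul_div, ← Finset.sum_div]
  gcongr
  exact_mod_cast card_not_isTreelikeAt_le (h.regular i) R

theorem IsTreelikeSeq.tendsto_integral_sq_trace_sub (h : IsTreelikeSeq d N G) {W : Measure ℝ}
    [IsProbabilityMeasure W] (hW : HasFiniteMoments W) (k : ℕ) :
    Tendsto (fun i => ∫ w, ((N i : ℝ)⁻¹ * (weightedAdj (G i) w ^ k).trace - treeMoment d W k) ^ 2
      ∂(weightLaw (Fin (N i)) W)) atTop (𝓝 0) := by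
  classical
  have h1 := (((tendsto_natCast_atTop_atTop (R := ℝ)).comp h.tendsto_card).const_div_atTop
    ((((d + 1) ^ (2 * k) : ℕ) : ℝ))).add (h.tendsto_card_not_isTreelikeAt k)
  have h2 := h1.const_mul (devBound d W k)
  rw [add_zero, mul_zero] at h2
  refine squeeze_zero' (.of_forall fun i => integral_nonneg fun w => sq_nonneg _) ?_ h2
  filter_upwards [h.eventually_pos] with i hi
  have : Nonempty (Fin (N i)) := ⟨⟨0, hi⟩⟩
  have h3 := integral_sq_trace_sub_le (h.regular i) hW k
  rw [Fintype.card_fin, add_div] at h3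
  exact h3

end Seq

/-! ### Stability of the spectral measure under changes of the weights. -/

theorem sum_sq_eq_trace {V : Type*} [Fintype V] (M : Matrix V V ℝ) :
    ∑ i, ∑ j, M i j ^ 2 = (M * M.transpose).trace := by
  simp [Matrix.trace, Matrix.mul_apply, sq]

/-- The eigenvalues of two symmetric matrices admit a coupling whose quadratic cost is the squared
Frobenius distance of the matrices. -/
theorem exists_coupling_eigenvalues {V : Type*} [Fintype V] [DecidableEq V] {A B : Matrix V V ℝ}
    (hA : A.IsHermitian) (hB : B.IsHermitian) : ∃ P : V → V → ℝ, (∀ i j, 0 ≤ P i j) ∧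
      (∀ i, ∑ j, P i j = 1) ∧ (∀ j, ∑ i, P i j = 1) ∧
      ∑ i, ∑ j, P i j * (hA.eigenvalues i - hB.eigenvalues j) ^ 2 =
        ∑ x, ∑ y, (A x y - B x y) ^ 2 := by
  set U : Matrix V V ℝ := (hA.eigenvectorUnitary : Matrix V V ℝ) with hU
  set Q : Matrix V V ℝ := (hB.eigenvectorUnitary : Matrix V V ℝ) with hQ
  have hUU : U * U.transpose = 1 := by
    rw [← Matrix.conjTranspose_eq_transpose_of_trivial]
    exact Unitary.coe_mul_star_self hA.eigenvectorUnitary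
  have hQQ : Q * Q.transpose = 1 := by
    rw [← Matrix.conjTranspose_eq_transpose_of_trivial]
    exact Unitary.coe_mul_star_self hB.eigenvectorUnitary
  have hUU' : U.transpose * U = 1 := mul_eq_one_comm.1 hUU
  have hQQ' : Q.transpose * Q = 1 := mul_eq_one_comm.1 hQQ
  have hAs : A = U * Matrix.diagonal hA.eigenvalues * U.transpose := by
    conv_lhs => rw [hA.spectral_theorem, Unitary.conjStarAlgAut_apply]
    rfl
  have hBs : B = Q * Matrix.diagonal hB.eigenvalues * Q.transpose := by
    conv_lhs => rw [hB.spectral_theorem, Unitary.conjStarAlgAut_apply]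
    rfl
  set O := U.transpose * Q with hO
  have hOO : O * O.transpose = 1 := by
    rw [hO, Matrix.transpose_mul, Matrix.transpose_transpose, Matrix.mul_assoc,
      ← Matrix.mul_assoc Q, hQQ, Matrix.one_mul, hUU']
  have hOO' : O.transpose * O = 1 := mul_eq_one_comm.1 hOO
  -- The squared entries of an orthogonal matrix form a doubly stochastic matrix.
  refine ⟨fun i j => O i j ^ 2, fun i j => sq_nonneg _, fun i => ?_, fun j => ?_, ?_⟩
  · have := congrFun (congrFun hOO i) i
    simpa [Matrix.mul_apply, ← sq] using this
  · have := congrFun (congrFun hOO' j) j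
    simpa [Matrix.mul_apply, ← sq] using this
  -- Between the two eigenbases, `A - B` has entries `O i j` times the difference of the
  -- eigenvalues, and orthogonal changes of basis preserve the Frobenius norm.
  · have h1 : U.transpose * (A - B) * Q =
        Matrix.diagonal hA.eigenvalues * O - O * Matrix.diagonal hB.eigenvalues := by
      conv_lhs => rw [hAs, hBs]
      rw [Matrix.mul_sub, Matrix.sub_mul, hO]
      congr 1
      · simp only [← Matrix.mul_assoc, hUU', Matrix.one_mul]
      · simp only [Matrix.mul_assoc, hQQ', Matrix.mul_one]
    have h2 : ∑ i, ∑ j, (U.transpose * (A - B) * Q) i j ^ 2 = ∑ x, ∑ y, (A - B) x y ^ 2 := by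
      rw [sum_sq_eq_trace, sum_sq_eq_trace]
      simp only [Matrix.transpose_mul, Matrix.transpose_transpose]
      rw [Matrix.mul_assoc, ← Matrix.mul_assoc Q, hQQ, Matrix.one_mul, Matrix.mul_assoc,
        Matrix.trace_mul_comm]
      simp only [Matrix.mul_assoc, hUU, Matrix.mul_one]
    simp only [Matrix.sub_apply] at h2
    rw [← h2, h1]
    refine Finset.sum_congr rfl fun i _ => Finset.sum_congr rfl fun j _ => ?_
    simp only [Matrix.sub_apply, Matrix.diagonal_mul, Matrix.mul_diagonal]
    ring

theorem sum_sq_eigenvalues {V : Type*} [Fintype V] [DecidableEq V] {A : Matrix V V ℝ}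
    (hA : A.IsHermitian) : ∑ i, hA.eigenvalues i ^ 2 = ∑ x, ∑ y, A x y ^ 2 := by
  have h := trace_aeval_eq_sum_eigenvalues hA (Polynomial.X ^ 2)
  have hs : A.transpose = A := by
    rw [← Matrix.conjTranspose_eq_transpose_of_trivial]; exact hA
  rw [sum_sq_eq_trace, hs]
  simpa [sq] using h

/-- The form suited to a quadratic coupling, although `f` need not be uniformly continuous. For
large `x` the term in `x ^ 2` absorbs the oscillation of `f`; for `x` and `y` far apart the term in
`(x - y) ^ 2` does; otherwise uniform continuity on a compact interval applies. -/
theorem BoundedContinuousFunction.exists_abs_sub_le (f : ℝ →ᵇ ℝ) {η c : ℝ} (hη : 0 < η)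
    (hc : 0 < c) : ∃ C, 0 ≤ C ∧ ∀ x y, |f x - f y| ≤ η + c * x ^ 2 + C * (x - y) ^ 2 := by
  set S := 2 * ‖f‖ with hS
  have hS0 : 0 ≤ S := by positivity
  have hf (x y) : |f x - f y| ≤ S := f.dist_le_two_norm x y
  obtain ⟨K, hK0, hK⟩ : ∃ K : ℝ, 0 < K ∧ S ≤ c * K ^ 2 := by
    refine ⟨S / c + 1, by positivity, ?_⟩
    have : S = c * (S / c) := by field_simp
    have h0 : 0 ≤ S / c := by positivity
    nlinarith [mul_pos hc hc, mul_nonneg hc.le h0, sq_nonneg (S / c)]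
  have huc : UniformContinuousOn f (Set.Icc (-(K + 1)) (K + 1)) :=
    isCompact_Icc.uniformContinuousOn_of_continuous f.continuous.continuousOn
  obtain ⟨δ, hδ, hδf⟩ := Metric.uniformContinuousOn_iff.1 huc η hη
  -- The cap `1` keeps `y` in `[-(K + 1), K + 1]` when `|x| ≤ K`.
  set δ' := min δ 1 with hδ'
  have hδ'0 : 0 < δ' := lt_min hδ one_pos
  refine ⟨S / δ' ^ 2, by positivity, fun x y => ?_⟩
  have hc2 : 0 ≤ S / δ' ^ 2 * (x - y) ^ 2 := by positivity
  have hc1 : 0 ≤ c * x ^ 2 := by positivity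
  by_cases hx : |x| ≤ K
  · by_cases hxy : |x - y| < δ'
    · have h1 := hδf x ⟨by linarith [(abs_le.1 hx).1], by linarith [(abs_le.1 hx).2]⟩ y
        ⟨by linarith [(abs_le.1 hx).1, (abs_lt.1 hxy).2, min_le_right δ 1],
          by linarith [(abs_le.1 hx).2, (abs_lt.1 hxy).1, min_le_right δ 1]⟩
        (hxy.trans_le (min_le_left _ _))
      rw [Real.dist_eq] at h1
      linarith
    · have h1 : δ' ^ 2 ≤ (x - y) ^ 2 := by
        rw [← sq_abs (x - y)]
        exact pow_le_pow_left₀ hδ'0.le (not_lt.1 hxy) 2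
      have h2 : S ≤ S / δ' ^ 2 * (x - y) ^ 2 := by
        rw [div_mul_eq_mul_div, le_div_iff₀ (by positivity)]
        gcongr
      linarith [hf x y]
  · have h1 : K ^ 2 ≤ x ^ 2 := by
      rw [← sq_abs x]
      exact pow_le_pow_left₀ hK0.le (not_le.1 hx).le 2
    have h2 : c * K ^ 2 ≤ c * x ^ 2 := by gcongr
    linarith [hf x y]

section Graph

variable {V : Type*} [Fintype V] [DecidableEq V] {G : SimpleGraph V} [DecidableRel G.Adj] {d : ℕ}

instance isProbabilityMeasure_spectralMeasure [Nonempty V] (w : Sym2 V → ℝ) :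
    IsProbabilityMeasure (spectralMeasure G w) := by
  refine ⟨?_⟩
  rw [spectralMeasure, Measure.smul_apply, Measure.finsetSum_apply]
  simp only [measure_univ, Finset.sum_const, Finset.card_univ, nsmul_eq_mul, mul_one, smul_eq_mul]
  exact ENNReal.inv_mul_cancel (by simp) (by simp)

theorem integral_spectralMeasure (w : Sym2 V → ℝ) (f : ℝ → ℝ) :
    ∫ x, f x ∂(spectralMeasure G w) =
      (Fintype.card V : ℝ)⁻¹ * ∑ j, f ((isHermitian_weightedAdj G w).eigenvalues j) := by
  rw [spectralMeasure, integral_smul_measure,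
    integral_finsetSum_measure fun j _ => integrable_dirac (by simp)]
  simp

theorem integral_pow_spectralMeasure (w : Sym2 V → ℝ) (k : ℕ) :
    ∫ x, x ^ k ∂(spectralMeasure G w) = (Fintype.card V : ℝ)⁻¹ * (weightedAdj G w ^ k).trace := by
  rw [integral_spectralMeasure]
  have := trace_aeval_eq_sum_eigenvalues (isHermitian_weightedAdj G w) (Polynomial.X ^ k)
  simp only [Polynomial.eval_pow, Polynomial.eval_X, Polynomial.aeval_X_pow] at this
  rw [this]

theorem measurable_integral_spectralMeasure {f : ℝ → ℝ} (hf : Continuous f) :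
    Measurable fun w => ∫ x, f x ∂(spectralMeasure G w) := by
  simp_rw [integral_spectralMeasure]
  exact (measurable_sum_eigenvalues G hf).const_mul _

theorem abs_integral_spectralMeasure_le (w : Sym2 V → ℝ) (f : ℝ →ᵇ ℝ) :
    |∫ x, f x ∂(spectralMeasure G w)| ≤ ‖f‖ := by
  rw [integral_spectralMeasure, abs_mul, abs_inv, Nat.abs_cast]
  rcases isEmpty_or_nonempty V with hV | hV
  · simp
  · rw [inv_mul_le_iff₀ (by exact_mod_cast Fintype.card_pos)]
    refine (Finset.abs_sum_le_sum_abs _ _).trans ?_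
    refine (Finset.sum_le_card_nsmul _ _ _ fun j _ => f.norm_coe_le_norm _).trans ?_
    simp

theorem integrable_integral_spectralMeasure (P : Measure (Sym2 V → ℝ)) [IsFiniteMeasure P]
    (f : ℝ →ᵇ ℝ) : Integrable (fun w => ∫ x, f x ∂(spectralMeasure G w)) P :=
  Integrable.of_bound (measurable_integral_spectralMeasure f.continuous).aestronglyMeasurable ‖f‖
    (.of_forall fun w => abs_integral_spectralMeasure_le w f)

/-- The pointwise inequality is summed against the coupling of the two spectra, whose marginals are
uniform. -/
theorem abs_integral_spectralMeasure_sub_le [Nonempty V] {f : ℝ → ℝ} {η c C : ℝ}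
    (hf : ∀ x y, |f x - f y| ≤ η + c * x ^ 2 + C * (x - y) ^ 2) (w w' : Sym2 V → ℝ) :
    |∫ x, f x ∂(spectralMeasure G w) - ∫ x, f x ∂(spectralMeasure G w')| ≤
      η + c * ((Fintype.card V : ℝ)⁻¹ * ∑ x, ∑ y, weightedAdj G w x y ^ 2) +
      C * ((Fintype.card V : ℝ)⁻¹ *
        ∑ x, ∑ y, (weightedAdj G w x y - weightedAdj G w' x y) ^ 2) := by
  obtain ⟨P, hP0, hP1, hP2, hP⟩ := exists_coupling_eigenvalues (isHermitian_weightedAdj G w)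
    (isHermitian_weightedAdj G w')
  rw [integral_spectralMeasure, integral_spectralMeasure, ← hP, ← sum_sq_eigenvalues
    (isHermitian_weightedAdj G w)]
  set a := (isHermitian_weightedAdj G w).eigenvalues
  set b := (isHermitian_weightedAdj G w').eigenvalues
  have hN : (0 : ℝ) < Fintype.card V := by exact_mod_cast Fintype.card_pos
  have h1 : ∑ i, f (a i) = ∑ i, ∑ j, P i j * f (a i) := by
    simp_rw [← Finset.sum_mul, hP1, one_mul]
  have h2 : ∑ j, f (b j) = ∑ i, ∑ j, P i j * f (b j) := by
    rw [Finset.sum_comm]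
    simp_rw [← Finset.sum_mul, hP2, one_mul]
  have h3 : ∑ i, a i ^ 2 = ∑ i, ∑ j, P i j * a i ^ 2 := by
    simp_rw [← Finset.sum_mul, hP1, one_mul]
  have h4 : η = (Fintype.card V : ℝ)⁻¹ * ∑ i, ∑ j, P i j * η := by
    simp_rw [← Finset.sum_mul, hP1]
    simp
  have h5 : |∑ i, f (a i) - ∑ j, f (b j)| ≤
      ∑ i, ∑ j, P i j * (η + c * a i ^ 2 + C * (a i - b j) ^ 2) := by
    rw [h1, h2, ← Finset.sum_sub_distrib]
    simp_rw [← Finset.sum_sub_distrib, ← mul_sub]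
    refine (Finset.abs_sum_le_sum_abs _ _).trans (Finset.sum_le_sum fun i _ => ?_)
    refine (Finset.abs_sum_le_sum_abs _ _).trans (Finset.sum_le_sum fun j _ => ?_)
    rw [abs_mul, abs_of_nonneg (hP0 i j)]
    exact mul_le_mul_of_nonneg_left (hf _ _) (hP0 i j)
  rw [← mul_sub, abs_mul, abs_of_pos (inv_pos.2 hN)]
  refine (mul_le_mul_of_nonneg_left h5 (inv_pos.2 hN).le).trans (le_of_eq ?_)
  conv_rhs => rw [h4, h3]
  simp only [mul_add, Finset.sum_add_distrib, Finset.mul_sum]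
  congr 1
  · congr 1
    refine Finset.sum_congr rfl fun i _ => Finset.sum_congr rfl fun j _ => ?_
    ring
  · refine Finset.sum_congr rfl fun i _ => Finset.sum_congr rfl fun j _ => ?_
    ring

/-- Gershgorin's theorem: the diagonal vanishes and each row has `d` entries of size at most `M`. -/
theorem abs_eigenvalues_le (hG : G.IsRegularOfDegree d) {w : Sym2 V → ℝ} {M : ℝ}
    (hw : ∀ e, |w e| ≤ M) (j : V) :
    |(isHermitian_weightedAdj G w).eigenvalues j| ≤ d * M := by
  set hA := isHermitian_weightedAdj G w
  have h1 : Module.End.HasEigenvalue (Matrix.toLin' (weightedAdj G w)) (hA.eigenvalues j) := by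
    rw [Module.End.hasEigenvalue_iff_mem_spectrum, Matrix.spectrum_toLin']
    exact hA.eigenvalues_mem_spectrum_real j
  obtain ⟨k, hk⟩ := eigenvalue_mem_ball h1
  have h2 : weightedAdj G w k k = 0 := by simp [weightedAdj]
  rw [h2, mem_closedBall_zero_iff, Real.norm_eq_abs] at hk
  refine hk.trans ?_
  have h3 : ∑ x ∈ Finset.univ.erase k, ‖weightedAdj G w k x‖ ≤
      ∑ x, if x ∈ G.neighborFinset k then M else 0 := by
    refine (Finset.sum_le_sum_of_subset_of_nonneg (Finset.erase_subset _ _)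
      fun _ _ _ => norm_nonneg _).trans (Finset.sum_le_sum fun x _ => ?_)
    by_cases hx : G.Adj k x
    · simpa [weightedAdj, hx] using hw _
    · simp [weightedAdj, hx]
  refine h3.trans ?_
  rw [Finset.sum_ite_mem, Finset.univ_inter, Finset.sum_const, G.card_neighborFinset_eq_degree,
    hG k, nsmul_eq_mul]

variable {W : Measure ℝ} [IsProbabilityMeasure W]

/-- Every row has exactly `d` weights, so the value does not depend on the graph. It is used for the
weights themselves and for the part of them removed by truncation. -/
theorem integral_sum_sq_weightedAdj (hG : G.IsRegularOfDegree d) [Nonempty V] {g : ℝ → ℝ}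
    (hg : Measurable g) (hgi : Integrable (fun x => g x ^ 2) W) :
    Integrable (fun w : Sym2 V → ℝ => (Fintype.card V : ℝ)⁻¹ *
      ∑ x, ∑ y, (if G.Adj x y then g (w s(x, y)) else 0) ^ 2) (weightLaw V W) ∧
    ∫ w, (Fintype.card V : ℝ)⁻¹ * ∑ x, ∑ y, (if G.Adj x y then g (w s(x, y)) else 0) ^ 2
      ∂(weightLaw V W) = d * ∫ x, g x ^ 2 ∂W := by
  have hi (x y : V) : Integrable (fun w : Sym2 V → ℝ =>
      (if G.Adj x y then g (w s(x, y)) else 0) ^ 2) (weightLaw V W) := by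
    by_cases h : G.Adj x y
    · simp only [h, if_true]
      exact integrable_comp_eval (μ := fun _ : Sym2 V => W) (f := fun x => g x ^ 2) hgi
    · simp [h]
  refine ⟨(integrable_finsetSum _ fun x _ => integrable_finsetSum _ fun y _ => hi x y).const_mul _,
    ?_⟩
  rw [integral_const_mul, integral_finsetSum _ fun x _ => integrable_finsetSum _ fun y _ => hi x y]
  have h1 (x : V) : ∫ w, ∑ y, (if G.Adj x y then g (w s(x, y)) else 0) ^ 2 ∂(weightLaw V W) =
      d * ∫ x, g x ^ 2 ∂W := by
    rw [integral_finsetSum _ fun y _ => hi x y]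
    have h2 (y : V) : ∫ w, (if G.Adj x y then g (w s(x, y)) else 0) ^ 2 ∂(weightLaw V W) =
        if y ∈ G.neighborFinset x then ∫ x, g x ^ 2 ∂W else 0 := by
      by_cases h : G.Adj x y
      · simp only [h, if_true, SimpleGraph.mem_neighborFinset]
        exact integral_weight_comp s(x, y) (hg.pow_const 2)
      · simp [h]
    simp_rw [h2]
    rw [Finset.sum_ite_mem, Finset.univ_inter, Finset.sum_const, G.card_neighborFinset_eq_degree,
      hG x, nsmul_eq_mul]
  simp_rw [h1]
  rw [Finset.sum_const, Finset.card_univ, nsmul_eq_mul, inv_mul_cancel_left₀]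
  exact_mod_cast Fintype.card_ne_zero

end Graph

/-- The variance of `|Z|` is nonnegative. -/
theorem sq_integral_abs_le {Ω : Type*} [MeasurableSpace Ω] {P : Measure Ω} [IsProbabilityMeasure P]
    {Z : Ω → ℝ} (hZ : MemLp Z 2 P) : (∫ ω, |Z ω| ∂P) ^ 2 ≤ ∫ ω, Z ω ^ 2 ∂P := by
  have h1 : Integrable (fun ω => |Z ω|) P := (hZ.integrable one_le_two).abs
  have h2 := hZ.integrable_sq
  set c := ∫ ω, |Z ω| ∂P with hc
  have h3 : 0 ≤ ∫ ω, (Z ω ^ 2 - 2 * c * |Z ω| + c ^ 2) ∂P := by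
    refine integral_nonneg fun ω => ?_
    have : Z ω ^ 2 - 2 * c * |Z ω| + c ^ 2 = (|Z ω| - c) ^ 2 := by rw [← sq_abs (Z ω)]; ring
    rw [Pi.zero_apply, this]
    positivity
  have h4 : Integrable (fun ω => Z ω ^ 2 - 2 * c * |Z ω|) P := h2.sub (h1.const_mul _)
  rw [integral_add h4 (integrable_const _), integral_sub h2 (h1.const_mul _), integral_const_mul, integral_const, probReal_univ, one_smul,
    ← hc] at h3
  linarith

theorem hasFiniteMoments_of_bounded {W : Measure ℝ} [IsProbabilityMeasure W] {M : ℝ}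
    (hW : ∀ᵐ x ∂W, |x| ≤ M) : HasFiniteMoments W := fun k => by
  refine Integrable.of_bound (by fun_prop) (M ^ k) ?_
  filter_upwards [hW] with x hx
  rw [norm_pow, Real.norm_eq_abs]
  gcongr

/-! ### Bounded weights: polynomial approximation on a common compact interval. -/

/-- The limiting averages of the polynomial `p`, for edge weights of law `W`. -/
noncomputable def polyMoment (d : ℕ) (W : Measure ℝ) (p : Polynomial ℝ) : ℝ :=
  ∑ k ∈ Finset.range (p.natDegree + 1), p.coeff k * treeMoment d W k

theorem ae_weightLaw {V : Type*} [Fintype V] [DecidableEq V] {W : Measure ℝ}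
    [IsProbabilityMeasure W] {q : ℝ → Prop} (hW : ∀ᵐ x ∂W, q x) :
    ∀ᵐ w ∂(weightLaw V W), ∀ e, q (w e) := by
  rw [ae_all_iff]
  intro e
  exact (measurePreserving_eval (fun _ : Sym2 V => W) e).quasiMeasurePreserving.ae hW

section Graph

variable {V : Type*} [Fintype V] [DecidableEq V] {G : SimpleGraph V} [DecidableRel G.Adj] {d : ℕ}

theorem integral_eval_spectralMeasure (p : Polynomial ℝ) (w : Sym2 V → ℝ) :
    ∫ x, p.eval x ∂(spectralMeasure G w) = ∑ k ∈ Finset.range (p.natDegree + 1),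
      p.coeff k * ((Fintype.card V : ℝ)⁻¹ * (weightedAdj G w ^ k).trace) := by
  simp_rw [← integral_pow_spectralMeasure, integral_spectralMeasure, Polynomial.eval_eq_sum_range]
  rw [Finset.sum_comm]
  simp_rw [Finset.mul_sum]
  exact Finset.sum_congr rfl fun k _ => Finset.sum_congr rfl fun j _ => by ring

theorem abs_integral_spectralMeasure_sub_integral_le [Nonempty V] (hG : G.IsRegularOfDegree d)
    {w : Sym2 V → ℝ} {M η : ℝ} (hw : ∀ e, |w e| ≤ M) {f g : ℝ → ℝ}
    (h : ∀ x ∈ Set.Icc (-(d * M)) (d * M), |f x - g x| ≤ η) :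
    |∫ x, f x ∂(spectralMeasure G w) - ∫ x, g x ∂(spectralMeasure G w)| ≤ η := by
  rw [integral_spectralMeasure, integral_spectralMeasure, ← mul_sub, ← Finset.sum_sub_distrib,
    abs_mul, abs_inv, Nat.abs_cast, inv_mul_le_iff₀ (by exact_mod_cast Fintype.card_pos)]
  refine (Finset.abs_sum_le_sum_abs _ _).trans ?_
  refine (Finset.sum_le_card_nsmul _ _ _ fun j _ => h _ ?_).trans ?_
  · exact abs_le.1 (abs_eigenvalues_le hG hw j)
  · simp

theorem memLp_trace_sub (hG : G.IsRegularOfDegree d) {W : Measure ℝ} [IsProbabilityMeasure W]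
    (hW : HasFiniteMoments W) (k : ℕ) (m : ℝ) :
    MemLp (fun w => (Fintype.card V : ℝ)⁻¹ * (weightedAdj G w ^ k).trace - m) 2
      (weightLaw V W) :=
  ((memLp_finsetSum Finset.univ fun v _ => memLp_pow_weightedAdj hG hW k v v).const_mul _).sub
    (memLp_const _)

end Graph

section Seq

variable {d : ℕ} {N : ℕ → ℕ} {G : ∀ i, SimpleGraph (Fin (N i))} [∀ i, DecidableRel (G i).Adj]
  {W : Measure ℝ} [IsProbabilityMeasure W]

theorem IsTreelikeSeq.tendsto_integral_abs_trace_sub (h : IsTreelikeSeq d N G)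
    (hW : HasFiniteMoments W) (k : ℕ) :
    Tendsto (fun i => ∫ w, |(N i : ℝ)⁻¹ * (weightedAdj (G i) w ^ k).trace - treeMoment d W k|
      ∂(weightLaw (Fin (N i)) W)) atTop (𝓝 0) := by
  have h1 := (h.tendsto_integral_sq_trace_sub hW k).sqrt
  rw [Real.sqrt_zero] at h1
  refine squeeze_zero (fun i => integral_nonneg fun w => abs_nonneg _) (fun i => ?_) h1
  refine Real.le_sqrt_of_sq_le (sq_integral_abs_le ?_)
  have := memLp_trace_sub (h.regular i) hW k (treeMoment d W k)
  rwa [Fintype.card_fin] at this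

/-- Almost surely the whole spectrum lies in `[-(d * M), d * M]`, whatever the graph. There `f` may
be exchanged for `p` at cost `η`, and the average of `p` is a combination of traces, which converge
in `L¹`. -/
theorem IsTreelikeSeq.eventually_integral_abs_sub_polyMoment_le (h : IsTreelikeSeq d N G) {M : ℝ}
    (hW : ∀ᵐ x ∂W, |x| ≤ M) (f : ℝ →ᵇ ℝ) (p : Polynomial ℝ) {η ε : ℝ}
    (hp : ∀ x ∈ Set.Icc (-(d * M)) (d * M), |f x - p.eval x| ≤ η) (hε : η < ε) :
    ∀ᶠ i in atTop, ∫ w, |∫ x, f x ∂(spectralMeasure (G i) w) - polyMoment d W p|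
      ∂(weightLaw (Fin (N i)) W) ≤ ε := by
  have hW' := hasFiniteMoments_of_bounded hW
  have h1 : Tendsto (fun i => η + ∑ k ∈ Finset.range (p.natDegree + 1), |p.coeff k| *
      ∫ w, |(N i : ℝ)⁻¹ * (weightedAdj (G i) w ^ k).trace - treeMoment d W k|
      ∂(weightLaw (Fin (N i)) W)) atTop (𝓝 (η + 0)) := by
    refine tendsto_const_nhds.add ?_
    rw [← Finset.sum_const_zero (s := Finset.range (p.natDegree + 1))]
    refine tendsto_finsetSum _ fun k _ => ?_
    simpa using (h.tendsto_integral_abs_trace_sub hW' k).const_mul |p.coeff k|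
  rw [add_zero] at h1
  filter_upwards [h1.eventually (gt_mem_nhds hε), h.eventually_pos] with i hi hpos
  refine le_trans ?_ hi.le
  have hne : Nonempty (Fin (N i)) := ⟨⟨0, hpos⟩⟩
  have hint (k : ℕ) : Integrable (fun w => |p.coeff k| *
      |(N i : ℝ)⁻¹ * (weightedAdj (G i) w ^ k).trace - treeMoment d W k|)
      (weightLaw (Fin (N i)) W) := by
    have := memLp_trace_sub (h.regular i) hW' k (treeMoment d W k)
    rw [Fintype.card_fin] at this
    exact (this.integrable one_le_two).abs.const_mul _
  simp_rw [← integral_const_mul]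
  rw [← integral_finsetSum _ fun k _ => hint k]
  have hη : η = ∫ _w, η ∂(weightLaw (Fin (N i)) W) := by simp
  rw [hη, ← integral_add (integrable_const _) (integrable_finsetSum _ fun k _ => hint k)]
  refine integral_mono_ae ((integrable_integral_spectralMeasure _ f).sub
    (integrable_const _)).abs ((integrable_const _).add
      (integrable_finsetSum _ fun k _ => hint k)) ?_
  filter_upwards [ae_weightLaw hW] with w hw
  have h2 := abs_integral_spectralMeasure_sub_integral_le (h.regular i) hw hp
  have h3 : |∫ x, p.eval x ∂(spectralMeasure (G i) w) - polyMoment d W p| ≤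
      ∑ k ∈ Finset.range (p.natDegree + 1), |p.coeff k| *
        |(N i : ℝ)⁻¹ * (weightedAdj (G i) w ^ k).trace - treeMoment d W k| := by
    rw [integral_eval_spectralMeasure, polyMoment, ← Finset.sum_sub_distrib, Fintype.card_fin]
    refine (Finset.abs_sum_le_sum_abs _ _).trans (Finset.sum_le_sum fun k _ => ?_)
    rw [← mul_sub, abs_mul]
  exact (abs_sub_le _ _ _).trans (add_le_add h2 h3)

end Seq

/-! ### Truncation of the weights. -/

section Truncation

/-- Truncation of a real number to the interval `[-M, M]`. -/
def clamp (M x : ℝ) : ℝ := max (-M) (min x M)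

theorem continuous_clamp (M : ℝ) : Continuous (clamp M) := by unfold clamp; fun_prop

theorem abs_clamp_le {M : ℝ} (hM : 0 ≤ M) (x : ℝ) : |clamp M x| ≤ M :=
  abs_le.2 ⟨le_max_left _ _, max_le (by linarith) (min_le_right _ _)⟩

theorem clamp_of_abs_le {M x : ℝ} (h : |x| ≤ M) : clamp M x = x := by
  rw [clamp, min_eq_left (abs_le.1 h).2, max_eq_right (abs_le.1 h).1]

theorem abs_clamp_le_abs {M : ℝ} (hM : 0 ≤ M) (x : ℝ) : |clamp M x| ≤ |x| := by
  by_cases h : |x| ≤ M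
  · rw [clamp_of_abs_le h]
  · exact (abs_clamp_le hM x).trans (not_le.1 h).le

theorem abs_sub_clamp_le {M : ℝ} (hM : 0 ≤ M) (x : ℝ) : |x - clamp M x| ≤ |x| := by
  rcases le_total 0 x with hx | hx
  · have h1 : 0 ≤ clamp M x := le_max_of_le_right (le_min hx hM)
    have h2 : clamp M x ≤ x := max_le (by linarith) (min_le_left _ _)
    rw [abs_of_nonneg (by linarith), abs_of_nonneg hx]
    linarith
  · have h1 : clamp M x ≤ 0 := max_le (by linarith) ((min_le_left _ _).trans hx)
    have h2 : x ≤ clamp M x := le_max_of_le_right (le_min le_rfl (by linarith))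
    rw [abs_of_nonpos (by linarith), abs_of_nonpos hx]
    linarith

theorem tendsto_clamp (x : ℝ) : Tendsto (fun n : ℕ => clamp n x) atTop (𝓝 x) := by
  refine tendsto_const_nhds.congr' ?_
  filter_upwards [eventually_ge_atTop ⌈|x|⌉₊] with n hn
  exact (clamp_of_abs_le ((Nat.le_ceil _).trans (by exact_mod_cast hn))).symm

variable {W : Measure ℝ}

instance [IsProbabilityMeasure W] (M : ℝ) : IsProbabilityMeasure (W.map (clamp M)) :=
  Measure.isProbabilityMeasure_map (continuous_clamp M).measurable.aemeasurable

theorem ae_abs_le_map_clamp {M : ℝ} (hM : 0 ≤ M) : ∀ᵐ x ∂(W.map (clamp M)), |x| ≤ M := by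
  rw [ae_map_iff (continuous_clamp M).measurable.aemeasurable
    (measurableSet_le (by fun_prop) measurable_const)]
  exact .of_forall fun x => abs_clamp_le hM x

theorem integrable_sq_sub_clamp (hW : HasFiniteMoments W) {M : ℝ} (hM : 0 ≤ M) :
    Integrable (fun x => (x - clamp M x) ^ 2) W := by
  refine (hW 2).mono' ((continuous_id.sub (continuous_clamp M)).pow 2).aestronglyMeasurable
    (.of_forall fun x => ?_)
  rw [Real.norm_of_nonneg (sq_nonneg _)]
  exact sq_le_sq.2 (abs_sub_clamp_le hM x)

theorem tendsto_integral_sq_sub_clamp (hW : HasFiniteMoments W) :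
    Tendsto (fun n : ℕ => ∫ x, (x - clamp n x) ^ 2 ∂W) atTop (𝓝 0) := by
  have h0 : (0 : ℝ) = ∫ _x, (0 : ℝ) ∂W := by simp
  rw [h0]
  refine tendsto_integral_of_dominated_convergence (fun x => x ^ 2)
    (fun n => ((continuous_id.sub (continuous_clamp n)).pow 2).aestronglyMeasurable) (hW 2)
    (fun n => .of_forall fun x => ?_) (.of_forall fun x => ?_)
  · rw [Real.norm_of_nonneg (sq_nonneg _)]
    exact sq_le_sq.2 (abs_sub_clamp_le (Nat.cast_nonneg n) x)
  · have := ((tendsto_const_nhds (x := x)).sub (tendsto_clamp x)).pow 2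
    simpa using this

variable [IsProbabilityMeasure W] {V : Type*} [Fintype V] [DecidableEq V] {G : SimpleGraph V}
  [DecidableRel G.Adj] {d : ℕ}

theorem weightLaw_map_clamp (M : ℝ) : weightLaw V (W.map (clamp M)) =
    (weightLaw V W).map fun w e => clamp M (w e) := by
  rw [weightLaw, weightLaw, Measure.pi_map_pi fun _ => (continuous_clamp M).measurable.aemeasurable]

theorem continuous_clamp_comp {E : Type*} (M : ℝ) :
    Continuous fun (w : E → ℝ) e => clamp M (w e) :=
  continuous_pi fun e => (continuous_clamp M).comp (continuous_apply e)

/-- The bound does not involve the graph, so the level `M` can be fixed before the sequence is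
given. -/
theorem integral_abs_integral_spectralMeasure_clamp_le [Nonempty V] (hG : G.IsRegularOfDegree d)
    (hW : HasFiniteMoments W) (f : ℝ →ᵇ ℝ) {η c C : ℝ}
    (hf : ∀ x y, |f x - f y| ≤ η + c * x ^ 2 + C * (x - y) ^ 2) {M : ℝ} (hM : 0 ≤ M) :
    ∫ w, |∫ x, f x ∂(spectralMeasure G w) -
        ∫ x, f x ∂(spectralMeasure G fun e => clamp M (w e))| ∂(weightLaw V W) ≤
      η + c * (d * ∫ x, x ^ 2 ∂W) + C * (d * ∫ x, (x - clamp M x) ^ 2 ∂W) := by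
  obtain ⟨i1, e1⟩ := integral_sum_sq_weightedAdj (W := W) hG measurable_id (hW 2)
  obtain ⟨i2, e2⟩ := integral_sum_sq_weightedAdj (W := W) hG (g := fun x => x - clamp M x)
    (measurable_id.sub (continuous_clamp M).measurable) (integrable_sq_sub_clamp hW hM)
  simp only [id] at e1 i1
  rw [← e1, ← e2]
  have hη : η = ∫ _w, η ∂(weightLaw V W) := by simp
  have i3 : Integrable (fun w : Sym2 V → ℝ => η + c * ((Fintype.card V : ℝ)⁻¹ *
      ∑ x, ∑ y, (if G.Adj x y then w s(x, y) else 0) ^ 2)) (weightLaw V W) :=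
    (integrable_const _).add (i1.const_mul _)
  rw [hη, ← integral_const_mul, ← integral_const_mul, ← integral_add (integrable_const _)
    (i1.const_mul _), ← integral_add i3 (i2.const_mul _)]
  have hm := measurable_integral_spectralMeasure (G := G) f.continuous
  have hi2 : Integrable (fun w => ∫ x, f x ∂(spectralMeasure G fun e => clamp M (w e)))
      (weightLaw V W) :=
    Integrable.of_bound (hm.comp (continuous_clamp_comp M).measurable).aestronglyMeasurable ‖f‖
      (.of_forall fun w => abs_integral_spectralMeasure_le _ f)
  refine integral_mono ((integrable_integral_spectralMeasure _ f).sub hi2).abs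
    (i3.add (i2.const_mul _)) fun w => ?_
  refine (abs_integral_spectralMeasure_sub_le hf _ _).trans (le_of_eq ?_)
  have e3 (x y : V) : (weightedAdj G w x y - weightedAdj G (fun e => clamp M (w e)) x y) ^ 2 =
      (if G.Adj x y then w s(x, y) - clamp M (w s(x, y)) else 0) ^ 2 := by
    by_cases h : G.Adj x y <;> simp [weightedAdj, h]
  simp only [e3]
  rfl

end Truncation

/-- The averages of `f` over the spectral measures of a treelike sequence of graphs concentrate,
up to an arbitrarily small error, around a number that does not depend on the sequence. -/
theorem exists_eventually_integral_abs_sub_le (d : ℕ) {W : Measure ℝ} [IsProbabilityMeasure W]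
    (hW : HasFiniteMoments W) (f : ℝ →ᵇ ℝ) {ε : ℝ} (hε : 0 < ε) :
    ∃ a : ℝ, ∀ (N : ℕ → ℕ) (G : ∀ i, SimpleGraph (Fin (N i))) [∀ i, DecidableRel (G i).Adj],
      IsTreelikeSeq d N G → ∀ᶠ i in atTop,
        ∫ w, |∫ x, f x ∂(spectralMeasure (G i) w) - a| ∂(weightLaw (Fin (N i)) W) ≤ ε := by
  set m := d * ∫ x, x ^ 2 ∂W with hm
  have hm0 : 0 ≤ m := mul_nonneg (Nat.cast_nonneg d) (integral_nonneg fun x => sq_nonneg x)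
  obtain ⟨C, hC0, hC⟩ := BoundedContinuousFunction.exists_abs_sub_le f
    (η := ε / 5) (c := ε / 5 / (m + 1)) (by positivity) (by positivity)
  have h1 := ((tendsto_integral_sq_sub_clamp hW).const_mul (d : ℝ)).const_mul C
  rw [mul_zero, mul_zero] at h1
  obtain ⟨n, hn⟩ := (h1.eventually (gt_mem_nhds (show 0 < ε / 5 by positivity))).exists
  obtain ⟨p, hp⟩ := exists_polynomial_near_of_continuousOn (-(d * (n : ℝ))) (d * n) f
    f.continuous.continuousOn (ε / 5) (by positivity)
  -- The number depends on `ε` through `n` and `p`, not on the sequence. Of the five shares of `ε`,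
  -- three go to `η`, `c` and `C` in the truncation bound and two to the polynomial approximation.
  refine ⟨polyMoment d (W.map (clamp n)) p, fun N G _ h => ?_⟩
  have hn0 : (0 : ℝ) ≤ n := Nat.cast_nonneg n
  filter_upwards [h.eventually_integral_abs_sub_polyMoment_le (W := W.map (clamp n))
    (ae_abs_le_map_clamp hn0) f p (η := ε / 5) (ε := 2 * ε / 5)
    (fun x hx => by rw [abs_sub_comm]; exact (hp x hx).le) (by linarith), h.eventually_pos]
    with i hi hpos
  have hne : Nonempty (Fin (N i)) := ⟨⟨0, hpos⟩⟩
  have h2 := integral_abs_integral_spectralMeasure_clamp_le (h.regular i) hW f hC hn0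
  set a := polyMoment d (W.map (clamp n)) p
  have hmeas := measurable_integral_spectralMeasure (G := G i) f.continuous
  rw [weightLaw_map_clamp, integral_map (continuous_clamp_comp (n : ℝ)).aemeasurable
    (hmeas.sub_const a).abs.aestronglyMeasurable] at hi
  have hX := integrable_integral_spectralMeasure (G := G i) (weightLaw (Fin (N i)) W) f
  have hX' : Integrable (fun w => ∫ x, f x ∂(spectralMeasure (G i) fun e => clamp n (w e)))
      (weightLaw (Fin (N i)) W) :=
    Integrable.of_bound (hmeas.comp (continuous_clamp_comp (n : ℝ)).measurable).aestronglyMeasurable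
      ‖f‖ (.of_forall fun w => abs_integral_spectralMeasure_le _ f)
  have hD : Integrable (fun w => |∫ x, f x ∂(spectralMeasure (G i) w) -
      ∫ x, f x ∂(spectralMeasure (G i) fun e => clamp n (w e))|) (weightLaw (Fin (N i)) W) :=
    (hX.sub hX').abs
  have hD' : Integrable (fun w => |∫ x, f x ∂(spectralMeasure (G i) fun e => clamp n (w e)) - a|)
      (weightLaw (Fin (N i)) W) := (hX'.sub (integrable_const _)).abs
  have h3 : ε / 5 / (m + 1) * m ≤ ε / 5 := by
    rw [div_mul_eq_mul_div, div_le_iff₀ (by positivity)]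
    nlinarith
  calc _ ≤ ∫ w, (|∫ x, f x ∂(spectralMeasure (G i) w) -
          ∫ x, f x ∂(spectralMeasure (G i) fun e => clamp n (w e))| +
        |∫ x, f x ∂(spectralMeasure (G i) fun e => clamp n (w e)) - a|)
          ∂(weightLaw (Fin (N i)) W) :=
        integral_mono (hX.sub (integrable_const _)).abs
          (hD.add hD') fun w => abs_sub_le _ _ _
    _ ≤ ε := by
        rw [integral_add hD hD']
        linarith

/-! ### Weak limits on the line: existence by tightness, and passage to the limit in moments. -/

section Limits

/-- A sequence of probability measures with bounded second moments whose averages of bounded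
continuous functions converge has a weak limit. -/
theorem exists_weaklyTendsto {μ : ℕ → Measure ℝ} [∀ i, IsProbabilityMeasure (μ i)] {B : ℝ}
    (hi : ∀ i, Integrable (fun x => x ^ 2) (μ i)) (hB : ∀ i, ∫ x, x ^ 2 ∂(μ i) ≤ B)
    (h : ∀ f : ℝ →ᵇ ℝ, ∃ a, Tendsto (fun i => ∫ x, f x ∂(μ i)) atTop (𝓝 a)) :
    ∃ ν : Measure ℝ, IsProbabilityMeasure ν ∧ WeaklyTendsto μ ν := by
  let P : ℕ → ProbabilityMeasure ℝ := fun i => ⟨μ i, inferInstance⟩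
  have hB0 : 0 ≤ B := (integral_nonneg fun x => sq_nonneg x).trans (hB 0)
  have htight : IsTightMeasureSet {x : Measure ℝ | ∃ μ ∈ Set.range P, (μ : Measure ℝ) = x} := by
    rw [isTightMeasureSet_iff_exists_isCompact_measure_compl_le]
    intro ε hε
    obtain ⟨δ, hδ, hδε⟩ : ∃ δ : ℝ, 0 < δ ∧ ENNReal.ofReal δ ≤ ε := by
      rcases eq_or_ne ε ⊤ with rfl | h
      · exact ⟨1, one_pos, le_top⟩
      · exact ⟨ε.toReal, ENNReal.toReal_pos hε.ne' h, ENNReal.ofReal_toReal_le⟩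
    obtain ⟨r, hr, hrB⟩ : ∃ r : ℝ, 0 < r ∧ B ≤ δ * r ^ 2 := by
      refine ⟨B / δ + 1, by positivity, ?_⟩
      have h1 : B = δ * (B / δ) := by field_simp
      have h0 : 0 ≤ B / δ := by positivity
      nlinarith [mul_nonneg hδ.le h0, mul_nonneg hδ.le (sq_nonneg (B / δ))]
    refine ⟨Set.Icc (-r) r, isCompact_Icc, ?_⟩
    rintro _ ⟨_, ⟨i, rfl⟩, rfl⟩
    change μ i _ ≤ ε
    refine le_trans ?_ hδε
    have h1 := mul_meas_ge_le_integral_of_nonneg (.of_forall fun x => sq_nonneg x) (hi i) (r ^ 2)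
    have h2 : (Set.Icc (-r) r)ᶜ ⊆ {x : ℝ | r ^ 2 ≤ x ^ 2} := by
      intro x hx
      by_contra hlt
      have hlt' : x ^ 2 < r ^ 2 := not_le.1 hlt
      exact hx (abs_le.1 (abs_lt_of_sq_lt_sq hlt' hr.le).le)
    have h3 : (μ i).real {x : ℝ | r ^ 2 ≤ x ^ 2} ≤ δ := by
      have h4 := (h1.trans (hB i)).trans hrB
      rw [mul_comm δ] at h4
      exact le_of_mul_le_mul_left h4 (by positivity)
    refine (measure_mono h2).trans ?_
    rw [← ofReal_measureReal]
    exact ENNReal.ofReal_le_ofReal h3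
  have hcomp := isCompact_closure_of_isTightMeasureSet htight
  -- By Prokhorov the sequence has a limit along an ultrafilter. Since every `∫ f` already converges
  -- along `atTop`, the two limits agree and no subsequence is needed.
  let F : Ultrafilter ℕ := Ultrafilter.of atTop
  have hF : (F : Filter ℕ) ≤ atTop := Ultrafilter.of_le _
  obtain ⟨ν, -, hν⟩ := hcomp.ultrafilter_le_nhds' (F.map P) (by
    rw [Ultrafilter.mem_map]
    exact Filter.univ_mem' fun i => subset_closure ⟨i, rfl⟩)
  have hν' : Tendsto P F (𝓝 ν) := hν
  refine ⟨ν, inferInstance, fun f => ?_⟩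
  obtain ⟨a, ha⟩ := h f
  have h1 := (ProbabilityMeasure.tendsto_iff_forall_integral_tendsto.1 hν') f
  rwa [tendsto_nhds_unique h1 (ha.mono_left hF)]

/-- The power function, truncated to the interval `[-M, M]`. -/
noncomputable def clampPow {M : ℝ} (hM : 0 ≤ M) (k : ℕ) : ℝ →ᵇ ℝ :=
  BoundedContinuousFunction.ofNormedAddCommGroup (fun x => clamp M x ^ k)
    ((continuous_clamp M).pow k) (M ^ k) fun x => by
      rw [norm_pow, Real.norm_eq_abs]
      gcongr
      exact abs_clamp_le hM x

/-- The difference lives on `|x| > M`, where one factor `|x|` is traded for `M`. The exponent `2 *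
(k + 1)` is even, so that a bounded moment makes the truncation error uniformly small. -/
theorem abs_pow_sub_clampPow_le {M : ℝ} (hM : 1 ≤ M) (k : ℕ) (x : ℝ) :
    |x ^ k - clampPow (zero_le_one.trans hM) k x| ≤ 2 / M * x ^ (2 * (k + 1)) := by
  have hM0 : 0 < M := by linarith
  change |x ^ k - clamp M x ^ k| ≤ _
  rw [← (even_two_mul (k + 1)).pow_abs]
  by_cases h : |x| ≤ M
  · rw [clamp_of_abs_le h, sub_self, abs_zero]
    positivity
  · have h1 : M < |x| := not_le.1 h
    have h2 : |x ^ k - clamp M x ^ k| ≤ 2 * |x| ^ k := by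
      refine (abs_sub _ _).trans ?_
      rw [abs_pow, abs_pow, two_mul]
      exact add_le_add le_rfl (pow_le_pow_left₀ (abs_nonneg _) (abs_clamp_le_abs hM0.le x) _)
    refine h2.trans ?_
    have h3 : |x| ^ k * M ≤ |x| ^ (2 * (k + 1)) := by
      calc |x| ^ k * M ≤ |x| ^ k * |x| := by gcongr
        _ = |x| ^ (k + 1) := (pow_succ _ _).symm
        _ ≤ |x| ^ (2 * (k + 1)) := pow_le_pow_right₀ (by linarith) (by omega)
    rw [div_mul_eq_mul_div, le_div_iff₀ hM0]
    linarith

/-- Weak convergence bounds the integrals of the truncated powers, and Fatou's lemma removes the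
truncation. -/
theorem integrable_even_pow_of_weaklyTendsto {μ : ℕ → Measure ℝ} {ν : Measure ℝ}
    [IsProbabilityMeasure ν] (h : WeaklyTendsto μ ν) {k : ℕ} {B : ℝ}
    (hB : ∀ᶠ i in atTop, Integrable (fun x => x ^ (2 * k)) (μ i) ∧
      ∫ x, x ^ (2 * k) ∂(μ i) ≤ B) :
    Integrable (fun x => x ^ (2 * k)) ν ∧ ∫ x, x ^ (2 * k) ∂ν ≤ B := by
  have hB0 : 0 ≤ B := by
    obtain ⟨i, -, hi⟩ := hB.exists
    exact (integral_nonneg fun x => (even_two_mul k).pow_nonneg x).trans hi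
  have h1 (n : ℕ) : ∫ x, clampPow (Nat.cast_nonneg (α := ℝ) n) (2 * k) x ∂ν ≤ B := by
    refine le_of_tendsto (h _) ?_
    filter_upwards [hB] with i hi
    refine le_trans (integral_mono_of_nonneg (.of_forall fun x => ?_) hi.1
      (.of_forall fun x => ?_)) hi.2
    · exact (even_two_mul k).pow_nonneg (clamp n x)
    · change clamp n x ^ (2 * k) ≤ x ^ (2 * k)
      rw [← (even_two_mul k).pow_abs, ← (even_two_mul k).pow_abs x]
      refine pow_le_pow_left₀ (abs_nonneg _) ?_ _
      exact abs_clamp_le_abs (Nat.cast_nonneg n) x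
  have h2 : ∫⁻ x, ENNReal.ofReal (x ^ (2 * k)) ∂ν ≤ ENNReal.ofReal B := by
    have h3 (x : ℝ) : ENNReal.ofReal (x ^ (2 * k)) = liminf (fun n : ℕ =>
        ENNReal.ofReal (clampPow (Nat.cast_nonneg (α := ℝ) n) (2 * k) x)) atTop := by
      refine (Tendsto.liminf_eq ?_).symm
      exact ENNReal.tendsto_ofReal ((tendsto_clamp x).pow (2 * k))
    simp_rw [h3]
    refine (lintegral_liminf_le fun n => by fun_prop).trans ?_
    refine (liminf_le_liminf (v := fun _ => ENNReal.ofReal B)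
      (.of_forall fun n => ?_)).trans (by simp)
    rw [← ofReal_integral_eq_lintegral_ofReal (BoundedContinuousFunction.integrable _ _)
      (.of_forall fun x => (even_two_mul k).pow_nonneg (clamp n x))]
    exact ENNReal.ofReal_le_ofReal (h1 n)
  have hnn : 0 ≤ᵐ[ν] fun x : ℝ => x ^ (2 * k) :=
    .of_forall fun x => (even_two_mul k).pow_nonneg x
  have hint : Integrable (fun x => x ^ (2 * k)) ν := by
    refine ⟨by fun_prop, ?_⟩
    rw [hasFiniteIntegral_iff_ofReal hnn]
    exact h2.trans_lt ENNReal.ofReal_lt_top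
  refine ⟨hint, ?_⟩
  rw [← ofReal_integral_eq_lintegral_ofReal hint hnn] at h2
  exact (ENNReal.ofReal_le_ofReal_iff hB0).1 h2

theorem hasFiniteMoments_of_weaklyTendsto {μ : ℕ → Measure ℝ} {ν : Measure ℝ}
    [IsProbabilityMeasure ν] (h : WeaklyTendsto μ ν)
    (hB : ∀ k : ℕ, ∃ B : ℝ, ∀ᶠ i in atTop, Integrable (fun x => x ^ (2 * k)) (μ i) ∧
      ∫ x, x ^ (2 * k) ∂(μ i) ≤ B) : HasFiniteMoments ν := by
  intro k
  obtain ⟨B, hB⟩ := hB k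
  refine ((integrable_even_pow_of_weaklyTendsto h hB).1.add (integrable_const 1)).mono'
    (by fun_prop) (.of_forall fun x => ?_)
  dsimp only [Pi.add_apply]
  rw [Real.norm_eq_abs, mul_comm, pow_mul, ← sq_abs (x ^ k)]
  nlinarith [sq_nonneg (|x ^ k| - 1)]

/-- A uniform bound on a higher even moment makes `x ^ k` uniformly integrable: it is exchanged for
its truncation at the same small cost under `μ i` and under `ν`. -/
theorem tendsto_integral_pow_of_weaklyTendsto {μ : ℕ → Measure ℝ} {ν : Measure ℝ}
    [IsProbabilityMeasure ν] (h : WeaklyTendsto μ ν) (hfin : ∀ᶠ i in atTop, IsFiniteMeasure (μ i))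
    (hmom : ∀ᶠ i in atTop, HasFiniteMoments (μ i))
    (hB : ∀ k : ℕ, ∃ B : ℝ, ∀ᶠ i in atTop, ∫ x, x ^ (2 * k) ∂(μ i) ≤ B) (k : ℕ) :
    Tendsto (fun i => ∫ x, x ^ k ∂(μ i)) atTop (𝓝 (∫ x, x ^ k ∂ν)) := by
  have hB' (k : ℕ) : ∃ B : ℝ, ∀ᶠ i in atTop, Integrable (fun x => x ^ (2 * k)) (μ i) ∧
      ∫ x, x ^ (2 * k) ∂(μ i) ≤ B := by
    obtain ⟨B, hB⟩ := hB k
    exact ⟨B, (hmom.and hB).mono fun i hi => ⟨hi.1 _, hi.2⟩⟩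
  have hν := hasFiniteMoments_of_weaklyTendsto h hB'
  obtain ⟨B, hB⟩ := hB' (k + 1)
  have hνB := (integrable_even_pow_of_weaklyTendsto h hB).2
  have key (ρ : Measure ℝ) [IsFiniteMeasure ρ] (hρ : HasFiniteMoments ρ)
      (hρB : ∫ x, x ^ (2 * (k + 1)) ∂ρ ≤ B) {M : ℝ} (hM : 1 ≤ M) :
      |∫ x, x ^ k ∂ρ - ∫ x, clampPow (zero_le_one.trans hM) k x ∂ρ| ≤ 2 / M * B := by
    rw [← integral_sub (hρ k) (BoundedContinuousFunction.integrable _ _)]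
    refine (abs_integral_le_integral_abs).trans ?_
    refine (integral_mono ((hρ k).sub (BoundedContinuousFunction.integrable _ _)).abs
      ((hρ (2 * (k + 1))).const_mul (2 / M)) fun x => abs_pow_sub_clampPow_le hM k x).trans ?_
    rw [integral_const_mul]
    gcongr
  have hB0 : 0 ≤ B := (integral_nonneg fun x => (even_two_mul (k + 1)).pow_nonneg x).trans hνB
  rw [Metric.tendsto_nhds]
  intro ε hε
  obtain ⟨M, hM, hMB⟩ : ∃ M : ℝ, 1 ≤ M ∧ 2 / M * B < ε / 3 := by
    refine ⟨6 * B / ε + 1, by simp; positivity, ?_⟩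
    rw [div_mul_eq_mul_div, div_lt_iff₀ (by positivity)]
    field_simp
    nlinarith
  filter_upwards [hfin, hmom, hB, Metric.tendsto_nhds.1 (h (clampPow (zero_le_one.trans hM) k))
    (ε / 3) (by positivity)] with i hi1 hi2 hi3 hi4
  have h1 := key (μ i) hi2 hi3.2 hM
  have h2 := key ν hν hνB hM
  rw [Real.dist_eq] at hi4 ⊢
  rw [abs_le] at h1 h2
  rw [abs_lt] at hi4 ⊢
  constructor <;> linarith [h1.1, h1.2, h2.1, h2.2, hi4.1, hi4.2]

end Limits

/-! ### The averaged spectral measure as a mixture. -/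

section Mean

variable {V : Type*} [Fintype V] [DecidableEq V] {G : SimpleGraph V} [DecidableRel G.Adj] {d : ℕ}
  {W : Measure ℝ} [IsProbabilityMeasure W]

/-- The spectral measure as a Markov kernel. -/
noncomputable def spectralKernel (G : SimpleGraph V) [DecidableRel G.Adj] :
    Kernel (Sym2 V → ℝ) ℝ := ⟨spectralMeasure G, measurable_spectralMeasure G⟩

theorem meanSpectralMeasure_eq (W : Measure ℝ) : meanSpectralMeasure G W =
    (spectralKernel G ∘ₖ Kernel.const Unit (weightLaw V W)) () :=
  Measure.comp_eq_comp_const_apply (κ := spectralKernel G)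

instance isMarkovKernel_spectralKernel [Nonempty V] : IsMarkovKernel (spectralKernel G) :=
  ⟨fun w => isProbabilityMeasure_spectralMeasure w⟩

instance isProbabilityMeasure_meanSpectralMeasure [Nonempty V] :
    IsProbabilityMeasure (meanSpectralMeasure G W) := by
  rw [meanSpectralMeasure_eq]
  infer_instance

theorem integral_meanSpectralMeasure {μ : Measure ℝ} {f : ℝ → ℝ}
    (hf : Integrable f (meanSpectralMeasure G μ)) : ∫ x, f x ∂(meanSpectralMeasure G μ) =
      ∫ w, ∫ x, f x ∂(spectralMeasure G w) ∂(weightLaw V μ) := by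
  rw [meanSpectralMeasure_eq] at hf ⊢
  rw [Kernel.integral_comp hf]
  rfl

theorem integrable_spectralMeasure {f : ℝ → ℝ} (w : Sym2 V → ℝ) :
    Integrable f (spectralMeasure G w) := by
  rcases isEmpty_or_nonempty V with hV | hV
  · simp [spectralMeasure]
  · rw [spectralMeasure]
    refine Integrable.smul_measure ?_ (by simp)
    exact integrable_finsetSum_measure.2 fun j _ => integrable_dirac (by simp)

theorem hasFiniteMoments_meanSpectralMeasure [Nonempty V] (hG : G.IsRegularOfDegree d)
    (hW : HasFiniteMoments W) : HasFiniteMoments (meanSpectralMeasure G W) := by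
  have heven (k : ℕ) : Integrable (fun x => x ^ (2 * k)) (meanSpectralMeasure G W) := by
    rw [meanSpectralMeasure_eq, integrable_comp_iff (by fun_prop)]
    refine ⟨.of_forall fun w => integrable_spectralMeasure w, ?_⟩
    have h1 := (memLp_trace_sub (V := V) hG hW (2 * k) 0).integrable one_le_two
    simp only [sub_zero] at h1
    refine h1.congr (.of_forall fun w => ?_)
    simp only [Real.norm_eq_abs, abs_pow, (even_two_mul k).pow_abs]
    exact (integral_pow_spectralMeasure w (2 * k)).symm
  intro k
  refine ((heven k).add (integrable_const 1)).mono' (by fun_prop) (.of_forall fun x => ?_)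
  dsimp only [Pi.add_apply]
  rw [Real.norm_eq_abs, mul_comm, pow_mul, ← sq_abs (x ^ k)]
  nlinarith [sq_nonneg (|x ^ k| - 1)]

end Mean

/-! ### Construction of the limiting measure from one treelike sequence. -/

section Seq

variable {d : ℕ} {N : ℕ → ℕ} {G : ∀ i, SimpleGraph (Fin (N i))} [∀ i, DecidableRel (G i).Adj]
  {W : Measure ℝ} [IsProbabilityMeasure W]

theorem IsTreelikeSeq.tendsto_integral_pow_meanSpectralMeasure (h : IsTreelikeSeq d N G)
    (hW : HasFiniteMoments W) (k : ℕ) :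
    Tendsto (fun i => ∫ x, x ^ k ∂(meanSpectralMeasure (G i) W)) atTop (𝓝 (treeMoment d W k)) := by
  rw [tendsto_iff_dist_tendsto_zero]
  refine squeeze_zero' (.of_forall fun _ => dist_nonneg) ?_ (h.tendsto_integral_abs_trace_sub hW k)
  filter_upwards [h.eventually_pos] with i hi
  have : Nonempty (Fin (N i)) := ⟨⟨0, hi⟩⟩
  have h1 := (memLp_trace_sub (h.regular i) hW k 0).integrable one_le_two
  simp only [sub_zero] at h1
  rw [integral_meanSpectralMeasure (hasFiniteMoments_meanSpectralMeasure (h.regular i) hW k),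
    Real.dist_eq]
  simp_rw [integral_pow_spectralMeasure]
  have h2 : treeMoment d W k = ∫ _w, treeMoment d W k ∂(weightLaw (Fin (N i)) W) := by simp
  rw [h2, ← integral_sub h1 (integrable_const _), ← h2]
  refine abs_integral_le_integral_abs.trans (le_of_eq ?_)
  simp

/-- The candidates for different errors are all close to the same random averages along the
reference sequence, so they form a Cauchy sequence. Its limit serves every treelike sequence,
because the candidates do. -/
theorem IsTreelikeSeq.exists_tendsto_integral_abs_sub (h₀ : IsTreelikeSeq d N G)
    (hW : HasFiniteMoments W) (f : ℝ →ᵇ ℝ) : ∃ a : ℝ,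
      ∀ (N : ℕ → ℕ) (G : ∀ i, SimpleGraph (Fin (N i))) [∀ i, DecidableRel (G i).Adj],
        IsTreelikeSeq d N G → Tendsto (fun i => ∫ w, |∫ x, f x ∂(spectralMeasure (G i) w) - a|
          ∂(weightLaw (Fin (N i)) W)) atTop (𝓝 0) := by
  choose a ha using fun n : ℕ => exists_eventually_integral_abs_sub_le d hW f
    (ε := 1 / ((n : ℝ) + 1)) (by positivity)
  have hint (V : Type) [Fintype V] [DecidableEq V] (G : SimpleGraph V) [DecidableRel G.Adj]
      (c : ℝ) : Integrable (fun w => |∫ x, f x ∂(spectralMeasure G w) - c|) (weightLaw V W) :=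
    ((integrable_integral_spectralMeasure _ f).sub (integrable_const _)).abs
  have hdist (n m : ℕ) : |a n - a m| ≤ 1 / ((n : ℝ) + 1) + 1 / ((m : ℝ) + 1) := by
    obtain ⟨i, hn, hm⟩ := ((ha n N G h₀).and (ha m N G h₀)).exists
    refine le_trans ?_ (add_le_add hn hm)
    rw [← integral_add (hint _ _ _) (hint _ _ _)]
    have h2 : |a n - a m| = ∫ _w, |a n - a m| ∂(weightLaw (Fin (N i)) W) := by simp
    rw [h2]
    refine integral_mono (integrable_const _) ((hint _ _ _).add (hint _ _ _)) fun w => ?_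
    dsimp only
    refine (abs_sub_le _ (∫ x, f x ∂(spectralMeasure (G i) w)) _).trans (le_of_eq ?_)
    rw [abs_sub_comm (a n)]
  have hcauchy : CauchySeq a := by
    refine cauchySeq_of_le_tendsto_0 (fun n : ℕ => 2 * (1 / ((n : ℝ) + 1))) (fun n m k hn hm => ?_)
      (by simpa using (tendsto_one_div_add_atTop_nhds_zero_nat (𝕜 := ℝ)).const_mul 2)
    have h1 : 1 / ((n : ℝ) + 1) ≤ 1 / ((k : ℝ) + 1) := by gcongr
    have h2 : 1 / ((m : ℝ) + 1) ≤ 1 / ((k : ℝ) + 1) := by gcongr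
    rw [Real.dist_eq]
    linarith [hdist n m]
  obtain ⟨b, hb⟩ := cauchySeq_tendsto_of_complete hcauchy
  refine ⟨b, fun N G _ h => ?_⟩
  have h3 : Tendsto (fun n : ℕ => 1 / ((n : ℝ) + 1) + |a n - b|) atTop (𝓝 0) := by
    have := (tendsto_one_div_add_atTop_nhds_zero_nat (𝕜 := ℝ)).add (hb.sub_const b).abs
    simpa using this
  rw [Metric.tendsto_nhds]
  intro ε hε
  obtain ⟨n, hn⟩ := (h3.eventually (gt_mem_nhds hε)).exists
  filter_upwards [ha n N G h] with i hi
  rw [Real.dist_eq, sub_zero, abs_of_nonneg (integral_nonneg fun w => abs_nonneg _)]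
  refine lt_of_le_of_lt ?_ hn
  have h2 : |a n - b| = ∫ _w, |a n - b| ∂(weightLaw (Fin (N i)) W) := by simp
  refine le_trans ?_ (add_le_add_left hi _)
  rw [h2, ← integral_add (hint _ _ _) (integrable_const _)]
  exact integral_mono (hint _ _ _) ((hint _ _ _).add (integrable_const _)) fun w =>
    abs_sub_le _ _ _

theorem tendsto_integral_meanSpectralMeasure (f : ℝ →ᵇ ℝ) {a : ℝ} (hpos : ∀ᶠ i in atTop, 0 < N i)
    (h : Tendsto (fun i => ∫ w, |∫ x, f x ∂(spectralMeasure (G i) w) - a|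
      ∂(weightLaw (Fin (N i)) W)) atTop (𝓝 0)) :
    Tendsto (fun i => ∫ x, f x ∂(meanSpectralMeasure (G i) W)) atTop (𝓝 a) := by
  rw [tendsto_iff_dist_tendsto_zero]
  refine squeeze_zero' (.of_forall fun _ => dist_nonneg) ?_ h
  filter_upwards [hpos] with i hi
  have : Nonempty (Fin (N i)) := ⟨⟨0, hi⟩⟩
  rw [integral_meanSpectralMeasure (f.integrable _), Real.dist_eq]
  have h2 : a = ∫ _w, a ∂(weightLaw (Fin (N i)) W) := by simp
  conv_lhs => rw [h2]
  rw [← integral_sub (integrable_integral_spectralMeasure _ f) (integrable_const _)]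
  exact abs_integral_le_integral_abs

/-- The limiting spectral measure of treelike sequences of weighted graphs exists, once there is
some treelike sequence. -/
theorem IsTreelikeSeq.exists_limit (h₀ : IsTreelikeSeq d N G) (hW : HasFiniteMoments W) :
    ∃ ν : Measure ℝ, IsProbabilityMeasure ν ∧ HasFiniteMoments ν ∧
      ∀ (N : ℕ → ℕ) (G : ∀ i, SimpleGraph (Fin (N i))) [∀ i, DecidableRel (G i).Adj],
        IsTreelikeSeq d N G →
        (∀ f : ℝ →ᵇ ℝ, Tendsto (fun i => ∫ w, |∫ x, f x ∂(spectralMeasure (G i) w) - ∫ x, f x ∂ν|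
          ∂(weightLaw (Fin (N i)) W)) atTop (𝓝 0)) ∧
        WeaklyTendsto (fun i => meanSpectralMeasure (G i) W) ν ∧
        (∀ k : ℕ, Tendsto (fun i => ∫ x, x ^ k ∂(meanSpectralMeasure (G i) W)) atTop
          (𝓝 (∫ x, x ^ k ∂ν))) ∧
        WeaklyTendstoInProbability (fun i => weightLaw (Fin (N i)) W)
          (fun i => spectralMeasure (G i)) ν := by
  choose a ha using fun f => h₀.exists_tendsto_integral_abs_sub hW f
  have hB := (h₀.tendsto_integral_pow_meanSpectralMeasure hW 2).eventually
    (gt_mem_nhds (lt_add_one _))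
  -- Finitely many of the graphs may be empty or have a large second moment; the sequence is shifted
  -- past them.
  obtain ⟨n, hn⟩ := (h₀.eventually_pos.and hB).exists_forall_of_atTop
  have hne (i : ℕ) : Nonempty (Fin (N (i + n))) := ⟨⟨0, (hn (i + n) (by omega)).1⟩⟩
  obtain ⟨ν, hν, hνlim⟩ := exists_weaklyTendsto
    (μ := fun i => meanSpectralMeasure (G (i + n)) W) (B := treeMoment d W 2 + 1)
    (fun i => hasFiniteMoments_meanSpectralMeasure (h₀.regular _) hW 2)
    (fun i => (hn (i + n) (by omega)).2.le)
    (fun f => ⟨a f, (tendsto_add_atTop_iff_nat n).2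
      (tendsto_integral_meanSpectralMeasure f h₀.eventually_pos (ha f N G h₀))⟩)
  have hνa (f : ℝ →ᵇ ℝ) : a f = ∫ x, f x ∂ν :=
    tendsto_nhds_unique ((tendsto_add_atTop_iff_nat n).2
      (tendsto_integral_meanSpectralMeasure f h₀.eventually_pos (ha f N G h₀))) (hνlim f)
  have hmain (N : ℕ → ℕ) (G : ∀ i, SimpleGraph (Fin (N i))) [∀ i, DecidableRel (G i).Adj]
      (h : IsTreelikeSeq d N G) : WeaklyTendsto (fun i => meanSpectralMeasure (G i) W) ν ∧
      (∀ᶠ i in atTop, IsFiniteMeasure (meanSpectralMeasure (G i) W)) ∧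
      (∀ᶠ i in atTop, HasFiniteMoments (meanSpectralMeasure (G i) W)) ∧
      (∀ k : ℕ, ∃ B : ℝ, ∀ᶠ i in atTop, ∫ x, x ^ (2 * k) ∂(meanSpectralMeasure (G i) W) ≤ B) := by
    refine ⟨fun f => ?_, ?_, ?_, fun k => ⟨treeMoment d W (2 * k) + 1, ?_⟩⟩
    · rw [← hνa]
      exact tendsto_integral_meanSpectralMeasure f h.eventually_pos (ha f N G h)
    · filter_upwards [h.eventually_pos] with i hi
      have : Nonempty (Fin (N i)) := ⟨⟨0, hi⟩⟩
      infer_instance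
    · filter_upwards [h.eventually_pos] with i hi
      have : Nonempty (Fin (N i)) := ⟨⟨0, hi⟩⟩
      exact hasFiniteMoments_meanSpectralMeasure (h.regular i) hW
    · exact ((h.tendsto_integral_pow_meanSpectralMeasure hW (2 * k)).eventually
        (gt_mem_nhds (lt_add_one _))).mono fun i hi => hi.le
  obtain ⟨m1, m2, m3, m4⟩ := hmain N G h₀
  refine ⟨ν, hν, hasFiniteMoments_of_weaklyTendsto m1 fun k => ?_, fun N G _ h => ?_⟩
  · obtain ⟨B, hB⟩ := m4 k
    exact ⟨B, (m3.and hB).mono fun i hi => ⟨hi.1 _, hi.2⟩⟩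
  · obtain ⟨m1, m2, m3, m4⟩ := hmain N G h
    have hL1 (f : ℝ →ᵇ ℝ) := hνa f ▸ ha f N G h
    refine ⟨hL1, m1, tendsto_integral_pow_of_weaklyTendsto m1 m2 m3 m4, fun f ε hε => ?_⟩
    -- Markov's inequality turns `L¹` convergence into convergence in probability.
    have h1 := ENNReal.tendsto_ofReal ((hL1 f).div_const ε)
    rw [zero_div, ENNReal.ofReal_zero] at h1
    refine tendsto_of_tendsto_of_tendsto_of_le_of_le tendsto_const_nhds h1 (fun _ => zero_le)
      fun i => ?_
    have hint : Integrable (fun w => |∫ x, f x ∂(spectralMeasure (G i) w) - ∫ x, f x ∂ν|)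
        (weightLaw (Fin (N i)) W) :=
      ((integrable_integral_spectralMeasure _ f).sub (integrable_const _)).abs
    have h2 := mul_meas_ge_le_integral_of_nonneg (.of_forall fun w => abs_nonneg _) hint ε
    dsimp only
    rw [← ofReal_measureReal]
    refine ENNReal.ofReal_le_ofReal ?_
    rw [le_div_iff₀ hε, mul_comm]
    exact h2

end Seq

/-! ### Regular graphs of large girth as Cayley graphs of permutations of a tree ball. -/

section Cayley

variable {d R : ℕ}

/-- The involution of the ball of radius `R` in the tree which moves every vertex along its edge
with label `a`, if that edge stays in the ball. -/
noncomputable def stepPerm (R : ℕ) (a : Fin d) : Equiv.Perm (words d R) :=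
  Function.Involutive.toPerm
    (fun l => if h : step a l.1 ∈ words d R then ⟨step a l.1, h⟩ else l) fun l => by
      by_cases h : step a l.1 ∈ words d R
      · have h1 : step a (step a l.1) = l.1 := (mem_words.1 l.2).1.step_step a
        simp [h, h1]
      · simp [h]

theorem stepPerm_apply {a : Fin d} {l : words d R} (h : step a l.1 ∈ words d R) :
    (stepPerm R a l : List (Fin d)) = step a l.1 := by
  change Subtype.val (if h : step a l.1 ∈ words d R then ⟨step a l.1, h⟩ else l) = _
  rw [dif_pos h]

theorem stepPerm_mul_self (a : Fin d) : stepPerm R a * stepPerm R a = 1 := by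
  ext1 l
  exact Function.Involutive.toPerm_involutive _ l

theorem stepPerm_mul_cancel (a : Fin d) (g : Equiv.Perm (words d R)) :
    stepPerm R a * (stepPerm R a * g) = g := by
  rw [← mul_assoc, stepPerm_mul_self, one_mul]

/-- The root of the tree. -/
def root (d R : ℕ) : words d R := ⟨[], mem_words.2 ⟨isReduced_nil, Nat.zero_le _⟩⟩

/-- The product acts by its last letter first, so the root runs through the suffixes of `l`, all of
them inside the ball. Hence no nonempty reduced word of length at most `R` acts trivially. -/
theorem prod_stepPerm_root (l : List (Fin d)) (hl : IsReduced l) (hR : l.length ≤ R) :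
    ((l.map (stepPerm R)).prod (root d R) : List (Fin d)) = l := by
  induction l with
  | nil => rfl
  | cons a l ih =>
    have h1 := ih hl.of_cons (by simp at hR; omega)
    rw [List.map_cons, List.prod_cons, Equiv.Perm.mul_apply, stepPerm_apply, h1, hl.step_eq_cons]
    rw [h1, hl.step_eq_cons]
    exact mem_words.2 ⟨hl, hR⟩

theorem stepPerm_injective (hR : 1 ≤ R) : Function.Injective (stepPerm (d := d) R) := by
  intro a b hab
  have h (a : Fin d) : (stepPerm R a (root d R) : List (Fin d)) = [a] := by
    have := prod_stepPerm_root [a] (List.isChain_singleton a) (R := R) (by simpa using hR)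
    simpa using this
  have h1 := h a
  rw [hab, h b] at h1
  simpa using h1.symm

/-- Disjoint copies, indexed by `ι`, of the Cayley graph of the permutations of the ball of radius
`R` in the tree, with respect to the involutions `stepPerm R a`. -/
def cayleyGraph (d : ℕ) {R : ℕ} (hR : 1 ≤ R) (ι : Type*) :
    SimpleGraph (Equiv.Perm (words d R) × ι) where
  Adj x y := x.2 = y.2 ∧ ∃ a : Fin d, x.1 = stepPerm R a * y.1
  symm := ⟨by
    rintro x y ⟨h, a, ha⟩
    exact ⟨h.symm, a, by rw [ha, stepPerm_mul_cancel]⟩⟩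
  loopless := ⟨by
    rintro x ⟨-, a, ha⟩
    have h1 : stepPerm R a = 1 := by simpa using ha.symm
    have := prod_stepPerm_root [a] (List.isChain_singleton a) (R := R) (by simpa using hR)
    simp [h1, root] at this⟩

variable {hR : 1 ≤ R} {ι : Type*}

/-- The last conjunct, naming the first edge, carries the induction: a repeated letter would
traverse that edge back at once, since the generators are involutions. -/
theorem exists_word_of_walk {x y : Equiv.Perm (words d R) × ι} (p : (cayleyGraph d hR ι).Walk x y)
    (hp : p.edges.IsChain (· ≠ ·)) : ∃ l : List (Fin d), IsReduced l ∧ l.length = p.length ∧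
      x.1 = (l.map (stepPerm R)).prod * y.1 ∧
      ∀ b m, l = b :: m → p.edges.head? = some s(x, (stepPerm R b * x.1, x.2)) := by
  induction p with
  | nil => exact ⟨[], isReduced_nil, rfl, by simp, by simp⟩
  | @cons x z y hxz p ih =>
    rw [SimpleGraph.Walk.edges_cons] at hp
    obtain ⟨l, h1, h2, h3, h4⟩ := ih (List.IsChain.of_cons hp)
    obtain ⟨h5, a, h6⟩ := id hxz
    refine ⟨a :: l, ?_, by rw [List.length_cons, SimpleGraph.Walk.length_cons, h2], by simp [h6, h3, mul_assoc], ?_⟩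
    · cases l with
      | nil => exact List.isChain_singleton a
      | cons b m =>
        refine List.isChain_cons_cons.2 ⟨?_, h1⟩
        rintro rfl
        have h7 := h4 _ _ rfl
        have h8 : (stepPerm R a * z.1, z.2) = x := Prod.ext h6.symm h5.symm
        rw [h8] at h7
        cases hq : p.edges with
        | nil => simp [hq] at h7
        | cons e q =>
          rw [hq] at hp h7
          simp only [List.head?_cons, Option.some.injEq] at h7
          exact (List.isChain_cons_cons.1 hp).1 (by rw [h7, Sym2.eq_swap])
    · intro b m hbm
      obtain ⟨rfl, rfl⟩ := List.cons.inj hbm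
      have h8 : (stepPerm R a * x.1, x.2) = z := by
        rw [h6, stepPerm_mul_cancel, h5]
      rw [h8]
      rfl

/-- A cycle spells a nonempty reduced word with trivial product; if it had length at most `R`, this
word would move the root. -/
theorem lt_length_of_isCycle {x : Equiv.Perm (words d R) × ι} {p : (cayleyGraph d hR ι).Walk x x}
    (hp : p.IsCycle) : R < p.length := by
  by_contra hlt
  obtain ⟨l, h1, h2, h3, -⟩ := exists_word_of_walk p (List.Pairwise.isChain hp.edges_nodup)
  have h4 : (l.map (stepPerm R)).prod = 1 := by simpa using h3.symm
  have h5 := prod_stepPerm_root l h1 (R := R) (by omega)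
  rw [h4] at h5
  have h6 : l = [] := h5.symm
  have := hp.three_le_length
  simp [h6] at h2
  omega

theorem isRegularOfDegree_cayleyGraph [(cayleyGraph d hR ι).LocallyFinite] :
    (cayleyGraph d hR ι).IsRegularOfDegree d := by
  classical
  intro x
  have h1 : (cayleyGraph d hR ι).neighborFinset x =
      Finset.univ.image fun a => (stepPerm R a * x.1, x.2) := by
    ext y
    simp only [SimpleGraph.mem_neighborFinset, Finset.mem_image, Finset.mem_univ, true_and]
    constructor
    · rintro ⟨h, a, ha⟩
      exact ⟨a, Prod.ext (by rw [ha, stepPerm_mul_cancel]) h⟩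
    · rintro ⟨a, rfl⟩
      exact ⟨rfl, a, by rw [stepPerm_mul_cancel]⟩
  rw [← SimpleGraph.card_neighborFinset_eq_degree, h1, Finset.card_image_of_injective,
    Finset.card_univ, Fintype.card_fin]
  intro a b hab
  exact stepPerm_injective hR (mul_right_cancel (Prod.ext_iff.1 hab).1)

end Cayley

theorem exists_regular_of_girth (d r : ℕ) : ∃ N, r < N ∧ ∃ G : SimpleGraph (Fin N),
    (∀ v, (G.neighborSet v).ncard = d) ∧
      ∀ v (p : G.Walk v v), p.IsCycle → r < p.length := by
  classical
  have hR : 1 ≤ r + 1 := by omega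
  -- The `r + 1` copies force more than `r` vertices even when the permutation group is trivial, as
  -- for `d = 0`.
  let V := Equiv.Perm (words d (r + 1)) × Fin (r + 1)
  let e : Fin (Fintype.card V) ≃ V := (Fintype.equivFin V).symm
  refine ⟨Fintype.card V, ?_, (cayleyGraph d hR (Fin (r + 1))).comap e, fun v => ?_,
    fun v p hp => ?_⟩
  · rw [Fintype.card_prod, Fintype.card_fin]
    have : 0 < Fintype.card (Equiv.Perm (words d (r + 1))) := Fintype.card_pos
    nlinarith
  · have h1 := isRegularOfDegree_cayleyGraph (d := d) (hR := hR) (ι := Fin (r + 1)) (e v)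
    have h2 : ((cayleyGraph d hR (Fin (r + 1))).comap e).neighborSet v =
        e ⁻¹' (cayleyGraph d hR (Fin (r + 1))).neighborSet (e v) := by
      ext; simp
    rw [h2, Set.ncard_preimage_of_injective_subset_range e.injective
      (by simp)]
    rw [← SimpleGraph.card_neighborFinset_eq_degree, ← Set.ncard_coe_finset,
      SimpleGraph.coe_neighborFinset] at h1
    exact h1
  · have h1 := lt_length_of_isCycle
      (hp.map (f := (SimpleGraph.Iso.comap e (cayleyGraph d hR (Fin (r + 1)))).toHom) e.injective)
    rw [SimpleGraph.Walk.length_map] at h1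
    omega

theorem exists_isTreelikeSeq (d : ℕ) : ∃ (N : ℕ → ℕ) (G : ∀ i, SimpleGraph (Fin (N i)))
    (_ : ∀ i, DecidableRel (G i).Adj), IsTreelikeSeq d N G := by
  classical
  choose N hN G hG hcyc using exists_regular_of_girth d
  refine ⟨N, G, fun i => inferInstance, fun i v => ?_, ?_, fun k hk => ?_⟩
  · rw [← hG i v, ← SimpleGraph.card_neighborFinset_eq_degree, ← Set.ncard_coe_finset,
      SimpleGraph.coe_neighborFinset]
  · exact tendsto_atTop_mono (fun i => (hN i).le) tendsto_id
  · refine (Asymptotics.isLittleO_zero _ _).congr' ?_ EventuallyEq.rfl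
    filter_upwards [eventually_ge_atTop k] with i hi
    have : {H : (G i).Subgraph | ∃ (v : Fin (N i)) (p : (G i).Walk v v),
        p.IsCycle ∧ p.length = k ∧ p.toSubgraph = H} = ∅ := by
      refine Set.eq_empty_of_forall_notMem ?_
      rintro H ⟨v, p, hp, rfl, -⟩
      exact absurd (hcyc i v p hp) (by omega)
    rw [numCycles, this]
    simp

/-! ### Unit weights: counting walks by the distance to the root. -/

section Radial

/-- The number of walks of length `k` in the `d`-regular tree from a vertex at distance `s` from the
root to the root. -/
noncomputable def radialWalks (d : ℕ) : ℕ → ℕ → ℝ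
  | 0, s => if s = 0 then 1 else 0
  | k + 1, 0 => d * radialWalks d k 1
  | k + 1, s + 1 => radialWalks d k s + (d - 1) * radialWalks d k (s + 2)

/-- Away from the root exactly one letter shortens the word and the other `d - 1` lengthen it. -/
theorem treeWalk_one {d : ℕ} (k : ℕ) (l : List (Fin d)) :
    treeWalk (fun _ => 1) k l = radialWalks d k l.length := by
  induction k generalizing l with
  | zero => simp [treeWalk, radialWalks]
  | succ k ih =>
    simp only [treeWalk, one_mul, ih]
    cases l with
    | nil => simp [step, radialWalks]
    | cons b l =>
      have h1 (a : Fin d) : radialWalks d k (step a (b :: l)).length =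
          radialWalks d k (l.length + 2) +
            if a = b then radialWalks d k l.length - radialWalks d k (l.length + 2) else 0 := by
        by_cases hab : a = b <;> simp [step, hab]
      simp_rw [h1]
      rw [Finset.sum_add_distrib]
      simp [radialWalks]
      ring

theorem treeMoment_dirac_one (d k : ℕ) :
    treeMoment d (Measure.dirac 1) k = radialWalks d k 0 := by
  have h1 : (Measure.pi fun _ : (words d k).sym2 => Measure.dirac (1 : ℝ)) =
      Measure.dirac fun _ => 1 := by
    refine Measure.pi_eq fun s hs => ?_
    rw [Measure.dirac_apply' _ (MeasurableSet.univ_pi hs)]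
    simp_rw [Measure.dirac_apply' _ (hs _)]
    by_cases h : ∀ i, (1 : ℝ) ∈ s i
    · simp [Set.indicator, h, Set.mem_pi]
    · obtain ⟨i, hi⟩ := not_forall.1 h
      rw [Finset.prod_eq_zero (Finset.mem_univ i) (by simp [hi])]
      refine Set.indicator_of_notMem ?_ _
      rw [Set.mem_univ_pi]
      exact h
  rw [treeMoment, h1, integral_dirac' _ _
    (continuous_treeWalk (continuous_extend_val _) k []).stronglyMeasurable]
  rw [← List.length_nil (α := Fin d), ← treeWalk_one]
  refine treeWalk_congr (R := k) (fun e he => ?_) k [] isReduced_nil (by simp)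
  exact Subtype.val_injective.extend_apply (fun _ : (words d k).sym2 => (1 : ℝ)) 0 ⟨e, he⟩

end Radial

/-! ### Spherical functions of the tree and the trigonometric integrals behind Kesten's moments. -/

section Trig

open Real

/-- The denominator of Kesten's density, in the coordinate `x = 2 * √q * cos θ`. -/
noncomputable def kestenDenom (q θ : ℝ) : ℝ := (q + 1) ^ 2 - 4 * q * cos θ ^ 2

theorem kestenDenom_eq (q θ : ℝ) : kestenDenom q θ = (q - 1) ^ 2 + 4 * q * sin θ ^ 2 := by
  rw [kestenDenom, sin_sq]; ring

theorem kestenDenom_eq_cos_two_mul (q θ : ℝ) :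
    kestenDenom q θ = q ^ 2 + 1 - 2 * q * cos (2 * θ) := by
  rw [kestenDenom, cos_two_mul]; ring

theorem kestenDenom_pos {q θ : ℝ} (hq : 1 ≤ q) (hθ : θ ∈ Set.Ioo 0 π) : 0 < kestenDenom q θ := by
  have := sin_pos_of_mem_Ioo hθ
  rw [kestenDenom_eq]
  have : 0 < 4 * q * sin θ ^ 2 := by positivity
  nlinarith [sq_nonneg (q - 1)]

theorem kestenDenom_ge {q : ℝ} (hq : 1 ≤ q) (θ : ℝ) : (q - 1) ^ 2 ≤ kestenDenom q θ := by
  rw [kestenDenom_eq]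
  have : 0 ≤ 4 * q * sin θ ^ 2 := by positivity
  linarith

/-- The `s`-th spherical function of the `(q + 1)`-regular tree times Kesten's density, in the
coordinate `x = 2 * √q * cos θ`. -/
noncomputable def spherical (q : ℝ) (s : ℕ) (θ : ℝ) : ℝ :=
  (√q)⁻¹ ^ s * (2 * q / π) *
    ((q * sin ((s + 1) * θ) - sin ((s - 1) * θ)) * sin θ / kestenDenom q θ)

/-- Together with `mul_spherical_succ`, the eigenvalue equation of the tree for radial functions,
with eigenvalue `2 * √q * cos θ`. Its coefficients are those of the recursion for `radialWalks`. -/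
theorem mul_spherical_zero {q : ℝ} (hq : 1 ≤ q) (θ : ℝ) :
    2 * √q * cos θ * spherical q 0 θ = (q + 1) * spherical q 1 θ := by
  have h1 : √q * √q = q := mul_self_sqrt (by linarith)
  have h0 : √q ≠ 0 := (sqrt_pos.2 (by linarith)).ne'
  have h2 : sin ((1 + 1) * θ) = 2 * sin θ * cos θ := by rw [one_add_one_eq_two, sin_two_mul]
  simp only [spherical, Nat.cast_zero, Nat.cast_one, zero_add, one_mul, zero_sub, neg_mul, sin_neg,
    sub_self, zero_mul, sin_zero, sub_zero, pow_zero, pow_one, h2]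
  field_simp
  have h3 : √q ^ 2 = q := by rw [sq, h1]
  rw [h3]
  ring

theorem mul_spherical_succ {q : ℝ} (hq : 1 ≤ q) (s : ℕ) (θ : ℝ) :
    2 * √q * cos θ * spherical q (s + 1) θ = spherical q s θ + q * spherical q (s + 2) θ := by
  have h1 : √q * √q = q := mul_self_sqrt (by linarith)
  have h0 : √q ≠ 0 := (sqrt_pos.2 (by linarith)).ne'
  have e1 : sin (((s + 2 : ℕ) + 1) * θ) =
      2 * cos θ * sin (((s + 1 : ℕ) + 1) * θ) - sin ((s + 1) * θ) := by
    have ha : (((s + 2 : ℕ) : ℝ) + 1) * θ = (((s + 1 : ℕ) : ℝ) + 1) * θ + θ := by push_cast; ring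
    have hb : ((s : ℝ) + 1) * θ = (((s + 1 : ℕ) : ℝ) + 1) * θ - θ := by push_cast; ring
    rw [ha, hb, sin_add, sin_sub]
    ring
  have e2 : sin (((s + 2 : ℕ) - 1) * θ) =
      2 * cos θ * sin (((s + 1 : ℕ) - 1) * θ) - sin ((s - 1) * θ) := by
    have ha : (((s + 2 : ℕ) : ℝ) - 1) * θ = (((s + 1 : ℕ) : ℝ) - 1) * θ + θ := by push_cast; ring
    have hb : ((s : ℝ) - 1) * θ = (((s + 1 : ℕ) : ℝ) - 1) * θ - θ := by push_cast; ring
    rw [ha, hb, sin_add, sin_sub]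
    ring
  have p1 : q * (√q)⁻¹ ^ (s + 2) = (√q)⁻¹ ^ s := by
    have h3 : q * (√q)⁻¹ ^ 2 = 1 := by
      rw [inv_pow, sq, h1, mul_inv_cancel₀ (by linarith)]
    rw [pow_add, mul_left_comm, h3, mul_one]
  have p2 : √q * (√q)⁻¹ ^ (s + 1) = (√q)⁻¹ ^ s := by
    rw [pow_succ]
    field_simp
  have lhs : 2 * √q * cos θ * spherical q (s + 1) θ = (√q * (√q)⁻¹ ^ (s + 1)) * (2 * q / π) *
      (2 * cos θ * (q * sin (((s + 1 : ℕ) + 1) * θ) - sin (((s + 1 : ℕ) - 1) * θ)) * sin θ /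
        kestenDenom q θ) := by
    rw [spherical]; ring
  have rhs : q * spherical q (s + 2) θ = (q * (√q)⁻¹ ^ (s + 2)) * (2 * q / π) *
      ((q * sin (((s + 2 : ℕ) + 1) * θ) - sin (((s + 2 : ℕ) - 1) * θ)) * sin θ /
        kestenDenom q θ) := by
    rw [spherical]; ring
  rw [lhs, rhs, p1, p2, e1, e2, spherical]
  ring

theorem integral_cos_int_mul {n : ℤ} (hn : n ≠ 0) : ∫ θ in (0)..π, cos (n * θ) = 0 := by
  have hn' : (n : ℝ) ≠ 0 := by exact_mod_cast hn
  rw [intervalIntegral.integral_comp_mul_left _ hn', integral_cos, sin_int_mul_pi]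
  simp

/-- An auxiliary trigonometric ratio. -/
noncomputable def cosRatio (q : ℝ) (n : ℤ) (θ : ℝ) : ℝ :=
  (q * cos ((n + 2) * θ) - cos (n * θ)) / kestenDenom q θ

theorem continuous_kestenDenom (q : ℝ) : Continuous (kestenDenom q) := by
  unfold kestenDenom; fun_prop

theorem kestenDenom_ne_zero {q : ℝ} (hq : 1 < q) (θ : ℝ) : kestenDenom q θ ≠ 0 := by
  have := kestenDenom_ge hq.le θ
  have : 0 < (q - 1) ^ 2 := by have : 0 < q - 1 := by linarith
                               positivity
  linarith

theorem continuous_cosRatio {q : ℝ} (hq : 1 < q) (n : ℤ) : Continuous (cosRatio q n) := by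
  unfold cosRatio
  exact Continuous.div (by fun_prop) (continuous_kestenDenom q) (kestenDenom_ne_zero hq)

/-- The denominator is `q ^ 2 + 1 - 2 * q * cos (2 * θ)`, so it cancels in this combination and a
single cosine is left. -/
theorem cosRatio_add_two {q : ℝ} (hq : 1 < q) (n : ℤ) (θ : ℝ) :
    cosRatio q (n + 2) θ = q * cosRatio q n θ - cos (((n + 2 : ℤ) : ℝ) * θ) := by
  have h0 := kestenDenom_ne_zero hq θ
  have e1 : cos ((((n + 2 : ℤ) : ℝ) + 2) * θ) =
      2 * cos (2 * θ) * cos (((n + 2 : ℤ) : ℝ) * θ) - cos (n * θ) := by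
    have ha : (((n + 2 : ℤ) : ℝ) + 2) * θ = ((n + 2 : ℤ) : ℝ) * θ + 2 * θ := by ring
    have hb : (n : ℝ) * θ = ((n + 2 : ℤ) : ℝ) * θ - 2 * θ := by push_cast; ring
    rw [ha, hb, cos_add, cos_sub]
    ring
  have e2 : ((n : ℝ) + 2) = ((n + 2 : ℤ) : ℝ) := by push_cast; ring
  rw [cosRatio, cosRatio, e1, e2]
  field_simp
  rw [kestenDenom_eq_cos_two_mul]
  ring

theorem integral_cosRatio_add_two {q : ℝ} (hq : 1 < q) (n : ℤ) :
    ∫ θ in (0)..π, cosRatio q (n + 2) θ =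
      q * (∫ θ in (0)..π, cosRatio q n θ) - ∫ θ in (0)..π, cos (((n + 2 : ℤ) : ℝ) * θ) := by
  simp_rw [cosRatio_add_two hq n]
  rw [intervalIntegral.integral_sub, intervalIntegral.integral_const_mul]
  · exact ((continuous_cosRatio hq n).const_mul q).intervalIntegrable _ _
  · exact (by fun_prop : Continuous fun θ : ℝ => cos (((n + 2 : ℤ) : ℝ) * θ)).intervalIntegrable _ _

theorem abs_integral_cosRatio_le {q : ℝ} (hq : 1 < q) (n : ℤ) :
    |∫ θ in (0)..π, cosRatio q n θ| ≤ (q + 1) / (q - 1) ^ 2 * π := by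
  have hq1 : 0 < (q - 1) ^ 2 := by have : 0 < q - 1 := by linarith
                                   positivity
  have h := intervalIntegral.norm_integral_le_of_norm_le_const (a := 0) (b := π)
    (f := cosRatio q n) (C := (q + 1) / (q - 1) ^ 2) fun θ _ => by
      have h1 := kestenDenom_ge hq.le θ
      rw [cosRatio, norm_div, norm_eq_abs, norm_eq_abs, abs_of_pos (hq1.trans_le h1)]
      gcongr
      refine (abs_sub _ _).trans ?_
      rw [abs_mul, abs_of_pos (by linarith : 0 < q)]
      have h2 := abs_cos_le_one ((n + 2) * θ)
      have h3 := abs_cos_le_one (n * θ)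
      nlinarith
  rwa [norm_eq_abs, sub_zero, abs_of_pos pi_pos] at h

/-- Each step `n ↦ n + 2` multiplies the integral by `q > 1`, because the extra cosine has nonzero
frequency and integrates to zero. The integrals are bounded uniformly in `n`, so they must vanish.
-/
theorem integral_cosRatio_eq_zero {q : ℝ} (hq : 1 < q) {n : ℤ} (hn : -1 ≤ n) :
    ∫ θ in (0)..π, cosRatio q n θ = 0 := by
  have h1 (j : ℕ) : ∫ θ in (0)..π, cosRatio q (n + 2 * j) θ =
      q ^ j * ∫ θ in (0)..π, cosRatio q n θ := by
    induction j with
    | zero => simp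
    | succ j ih =>
      have h2 : n + 2 * ((j + 1 : ℕ) : ℤ) = (n + 2 * j) + 2 := by push_cast; ring
      rw [h2, integral_cosRatio_add_two hq, integral_cos_int_mul (by omega), ih, pow_succ]
      ring
  by_contra hne
  have h3 := (tendsto_pow_atTop_atTop_of_one_lt hq).atTop_mul_const (abs_pos.2 hne)
  obtain ⟨j, hj⟩ := (h3.eventually_gt_atTop ((q + 1) / (q - 1) ^ 2 * π)).exists
  have h4 := abs_integral_cosRatio_le hq (n + 2 * j)
  rw [h1, abs_mul, abs_of_pos (by positivity)] at h4
  linarith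

theorem spherical_eq_cosRatio {q : ℝ} (s : ℕ) (θ : ℝ) : spherical q s θ =
    (√q)⁻¹ ^ s * (q / π) * (cosRatio q ((s : ℤ) - 2) θ - cosRatio q s θ) := by
  have e1 : 2 * (sin ((s + 1) * θ) * sin θ) = cos (s * θ) - cos ((s + 2) * θ) := by
    have ha : ((s : ℝ) + 2) * θ = (s + 1) * θ + θ := by ring
    have hb : (s : ℝ) * θ = (s + 1) * θ - θ := by ring
    rw [ha, hb, cos_add, cos_sub]
    ring
  have e2 : 2 * (sin ((s - 1) * θ) * sin θ) = cos ((s - 2) * θ) - cos (s * θ) := by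
    have ha : ((s : ℝ) - 2) * θ = (s - 1) * θ - θ := by ring
    have hb : (s : ℝ) * θ = (s - 1) * θ + θ := by ring
    rw [ha, hb, cos_add, cos_sub]
    ring
  have e3 : (q * sin ((s + 1) * θ) - sin ((s - 1) * θ)) * sin θ =
      ((q * cos (s * θ) - cos ((s - 2) * θ)) - (q * cos ((s + 2) * θ) - cos (s * θ))) / 2 := by
    linear_combination q / 2 * e1 - e2 / 2
  have e4 : (((s : ℤ) - 2 : ℤ) : ℝ) + 2 = s := by push_cast; ring
  have e5 : (((s : ℤ) - 2 : ℤ) : ℝ) = s - 2 := by push_cast; ring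
  rw [spherical, e3, cosRatio, cosRatio, e4, e5, Int.cast_natCast]
  ring

/-- For `q = 1`, that is `d = 2`, the denominator vanishes at `0` and `π` and the recursion on
`cosRatio` is not available; but the quotient simplifies. -/
theorem spherical_one_eq {s : ℕ} {θ : ℝ} (hθ : θ ∈ Set.Ioo 0 π) :
    spherical 1 s θ = cos (s * θ) / π := by
  have h := sin_pos_of_mem_Ioo hθ
  have e1 : sin ((s + 1) * θ) - sin ((s - 1) * θ) = 2 * cos (s * θ) * sin θ := by
    have ha : ((s : ℝ) + 1) * θ = s * θ + θ := by ring
    have hb : ((s : ℝ) - 1) * θ = s * θ - θ := by ring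
    rw [ha, hb, sin_add, sin_sub]
    ring
  rw [spherical, kestenDenom_eq, one_mul, e1]
  simp only [sqrt_one, inv_one, one_pow, one_mul, sub_self]
  field_simp
  ring

theorem exists_continuous_eqOn_spherical {q : ℝ} (hq : 1 ≤ q) (s : ℕ) :
    ∃ f : ℝ → ℝ, Continuous f ∧ Set.EqOn (spherical q s) f (Set.Ioo 0 π) := by
  rcases hq.eq_or_lt with rfl | hq
  · exact ⟨fun θ => cos (s * θ) / π, by fun_prop, fun θ hθ => spherical_one_eq hθ⟩
  · refine ⟨spherical q s, ?_, fun _ _ => rfl⟩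
    have : spherical q s = fun θ =>
      (√q)⁻¹ ^ s * (q / π) * (cosRatio q ((s : ℤ) - 2) θ - cosRatio q s θ) :=
      funext fun θ => spherical_eq_cosRatio s θ
    rw [this]
    exact ((continuous_cosRatio hq _).sub (continuous_cosRatio hq _)).const_mul _

theorem integral_spherical {q : ℝ} (hq : 1 ≤ q) (s : ℕ) :
    ∫ θ in Set.Ioo 0 π, spherical q s θ = if s = 0 then 1 else 0 := by
  have hpi := pi_ne_zero
  rcases hq.eq_or_lt with rfl | hq
  · rw [setIntegral_congr_fun measurableSet_Ioo fun θ hθ => spherical_one_eq hθ,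
      ← integral_Ioc_eq_integral_Ioo, ← intervalIntegral.integral_of_le pi_pos.le,
      intervalIntegral.integral_div]
    by_cases hs : s = 0
    · simp [hs, hpi]
    · have := integral_cos_int_mul (n := s) (by exact_mod_cast hs)
      rw [Int.cast_natCast] at this
      simp [this, hs]
  · simp_rw [spherical_eq_cosRatio]
    rw [← integral_Ioc_eq_integral_Ioo, ← intervalIntegral.integral_of_le pi_pos.le,
      intervalIntegral.integral_const_mul,
      intervalIntegral.integral_sub ((continuous_cosRatio hq _).intervalIntegrable _ _)
        ((continuous_cosRatio hq _).intervalIntegrable _ _),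
      integral_cosRatio_eq_zero hq (n := s) (by omega), sub_zero]
    by_cases hs : s = 0
    · subst hs
      -- Only `s = 0` involves the index `-2`, the one place where the extra cosine is the constant
      -- `1`; its integral `π` gives the normalisation.
      have h1 := integral_cosRatio_add_two hq (-2)
      have h2 := integral_cosRatio_eq_zero hq (n := 0) (by norm_num)
      rw [show (-2 + 2 : ℤ) = 0 from rfl, h2] at h1
      simp only [Int.cast_zero, zero_mul, cos_zero, intervalIntegral.integral_const, sub_zero,
        smul_eq_mul, mul_one] at h1
      simp only [Nat.cast_zero, zero_sub, pow_zero, one_mul, if_true]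
      rw [div_mul_eq_mul_div, div_eq_one_iff_eq hpi]
      linarith
    · rw [integral_cosRatio_eq_zero hq (by omega), mul_zero, if_neg hs]

theorem integrableOn_pow_mul_spherical {q : ℝ} (hq : 1 ≤ q) (k s : ℕ) :
    IntegrableOn (fun θ => (2 * √q * cos θ) ^ k * spherical q s θ) (Set.Ioo 0 π) := by
  obtain ⟨f, hf, hfe⟩ := exists_continuous_eqOn_spherical hq s
  have h1 : IntegrableOn (fun θ => (2 * √q * cos θ) ^ k * f θ) (Set.Ioo 0 π) :=
    ((by fun_prop : Continuous fun θ => (2 * √q * cos θ) ^ k * f θ).continuousOn.integrableOn_compact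
      isCompact_Icc).mono_set Set.Ioo_subset_Icc_self
  refine h1.congr_fun (fun θ hθ => ?_) measurableSet_Ioo
  simp only [hfe hθ]

/-- Both sides obey the same recursion in `k`, for all `s` at once, and at `k = 0` both are the
indicator of `s = 0`. -/
theorem integral_pow_mul_spherical {d : ℕ} (hd : 2 ≤ d) (k s : ℕ) :
    ∫ θ in Set.Ioo 0 π, (2 * √((d : ℝ) - 1) * cos θ) ^ k * spherical ((d : ℝ) - 1) s θ =
      radialWalks d k s := by
  have hq : 1 ≤ (d : ℝ) - 1 := by
    have : (2 : ℝ) ≤ d := by exact_mod_cast hd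
    linarith
  induction k generalizing s with
  | zero =>
    simp only [pow_zero, one_mul]
    exact integral_spherical hq s
  | succ k ih =>
    simp_rw [pow_succ, mul_assoc _ (2 * √((d : ℝ) - 1) * cos _)]
    cases s with
    | zero =>
      simp_rw [mul_spherical_zero hq, sub_add_cancel, mul_left_comm _ (d : ℝ)]
      rw [integral_const_mul, ih]
      rfl
    | succ s =>
      simp_rw [mul_spherical_succ hq, mul_add, mul_left_comm _ ((d : ℝ) - 1) (spherical _ _ _)]
      rw [integral_add (integrableOn_pow_mul_spherical hq k s)
        ((integrableOn_pow_mul_spherical hq k (s + 2)).const_mul _), integral_const_mul, ih, ih]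
      rfl

end Trig

/-! ### Kesten's measure and its identification with the limit for unit weights. -/

section Kesten

open Real

variable {d : ℕ}

theorem one_le_natCast_sub_one (hd : 2 ≤ d) : 1 ≤ (d : ℝ) - 1 := by
  have : (2 : ℝ) ≤ d := by exact_mod_cast hd
  linarith

theorem measurable_kestenDensity (d : ℕ) : Measurable (kestenDensity d) := by
  unfold kestenDensity
  exact Measurable.ite (measurableSet_le (by fun_prop) measurable_const) (by fun_prop)
    measurable_const

theorem sq_le_of_abs_le_two_sqrt {q x : ℝ} (hq : 0 ≤ q) (h : |x| ≤ 2 * √q) : x ^ 2 ≤ 4 * q := by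
  rw [← sq_abs]
  calc |x| ^ 2 ≤ (2 * √q) ^ 2 := by gcongr
    _ = 4 * q := by rw [mul_pow, sq_sqrt hq]; norm_num

theorem kestenDensity_nonneg (hd : 2 ≤ d) (x : ℝ) : 0 ≤ kestenDensity d x := by
  have hq := one_le_natCast_sub_one hd
  unfold kestenDensity
  split_ifs with h
  · have h1 := sq_le_of_abs_le_two_sqrt (by linarith) h
    have h2 : 0 ≤ (d : ℝ) ^ 2 - x ^ 2 := by nlinarith [sq_nonneg ((d : ℝ) - 2)]
    positivity
  · exact le_rfl

/-- Under `x = 2 * √(d - 1) * cos θ`, the density times the Jacobian is the spherical function of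
index `0`. -/
theorem abs_deriv_mul_kestenDensity (hd : 2 ≤ d) {θ : ℝ} (hθ : θ ∈ Set.Ioo 0 π) :
    |2 * √((d : ℝ) - 1) * -sin θ| * kestenDensity d (2 * √((d : ℝ) - 1) * cos θ) =
      spherical ((d : ℝ) - 1) 0 θ := by
  have hq := one_le_natCast_sub_one hd
  have hsin := sin_pos_of_mem_Ioo hθ
  have hD := kestenDenom_pos hq hθ
  set q := (d : ℝ) - 1 with hqd
  have hd' : (d : ℝ) = q + 1 := by rw [hqd]; ring
  have hs := sqrt_nonneg q
  have hqq : √q * √q = q := mul_self_sqrt (by linarith)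
  have h1 : |2 * √q * cos θ| ≤ 2 * √q := by
    rw [abs_mul, abs_of_nonneg (by positivity)]
    exact mul_le_of_le_one_right (by positivity) (abs_cos_le_one θ)
  have h2 : 4 * q - (2 * √q * cos θ) ^ 2 = (2 * √q * sin θ) ^ 2 := by
    rw [mul_pow, mul_pow, mul_pow, mul_pow, sq_sqrt (by linarith), sin_sq]
    ring
  have h3 : (d : ℝ) ^ 2 - (2 * √q * cos θ) ^ 2 = kestenDenom q θ := by
    rw [hd', kestenDenom, mul_pow, mul_pow, sq_sqrt (by linarith)]
    ring
  rw [kestenDensity, ← hqd, if_pos h1, h2, h3, sqrt_sq (by positivity), mul_neg, abs_neg,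
    abs_of_nonneg (by positivity), hd', spherical]
  have h4 : (((0 : ℕ) : ℝ) - 1) * θ = -θ := by push_cast; ring
  have h5 : (((0 : ℕ) : ℝ) + 1) * θ = θ := by push_cast; ring
  rw [h4, h5, sin_neg, pow_zero, one_mul]
  calc _ = (√q * √q) * (2 / π) * ((q + 1) * sin θ ^ 2 / kestenDenom q θ) := by
        field_simp
    _ = _ := by rw [hqq]; ring

theorem image_two_sqrt_mul_cos {c : ℝ} (hc : 0 < c) :
    (fun θ => c * cos θ) '' Set.Ioo 0 π = Set.Ioo (-c) c := by
  ext x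
  constructor
  · rintro ⟨θ, hθ, rfl⟩
    have h1 : cos θ < 1 := by
      rw [← cos_zero]
      exact strictAntiOn_cos ⟨le_rfl, pi_pos.le⟩ ⟨hθ.1.le, hθ.2.le⟩ hθ.1
    have h2 : -1 < cos θ := by
      rw [← cos_pi]
      exact strictAntiOn_cos ⟨hθ.1.le, hθ.2.le⟩ ⟨pi_pos.le, le_rfl⟩ hθ.2
    constructor <;> dsimp only <;> nlinarith
  · intro hx
    have h1 : -1 < x / c := by rw [lt_div_iff₀ hc]; linarith [hx.1]
    have h2 : x / c < 1 := by rw [div_lt_iff₀ hc]; linarith [hx.2]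
    refine ⟨arccos (x / c), ⟨arccos_pos.2 h2, ?_⟩, ?_⟩
    · refine lt_of_le_of_ne (arccos_le_pi _) fun h => ?_
      rw [arccos_eq_pi] at h
      linarith
    · dsimp only
      rw [cos_arccos h1.le h2.le]
      field_simp

theorem hasDerivWithinAt_mul_cos (c θ : ℝ) (s : Set ℝ) :
    HasDerivWithinAt (fun θ => c * cos θ) (c * -sin θ) s θ :=
  ((hasDerivAt_cos θ).const_mul c).hasDerivWithinAt

theorem injOn_mul_cos {c : ℝ} (hc : 0 < c) : Set.InjOn (fun θ => c * cos θ) (Set.Ioo 0 π) := by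
  intro x hx y hy hxy
  exact injOn_cos ⟨hx.1.le, hx.2.le⟩ ⟨hy.1.le, hy.2.le⟩ (mul_left_cancel₀ hc.ne' hxy)

theorem kestenDensity_eq_zero {x : ℝ}
    (hx : x ∉ Set.Icc (-(2 * √((d : ℝ) - 1))) (2 * √((d : ℝ) - 1))) : kestenDensity d x = 0 := by
  rw [kestenDensity, if_neg]
  exact fun h => hx (abs_le.1 h)

theorem two_sqrt_pos (hd : 2 ≤ d) : 0 < 2 * √((d : ℝ) - 1) := by
  have := sqrt_pos.2 (zero_lt_one.trans_le (one_le_natCast_sub_one hd))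
  linarith

theorem integral_kestenDensity_mul (hd : 2 ≤ d) (g : ℝ → ℝ) :
    ∫ x, kestenDensity d x * g x = ∫ θ in Set.Ioo 0 π,
      g (2 * √((d : ℝ) - 1) * cos θ) * spherical ((d : ℝ) - 1) 0 θ := by
  have hc := two_sqrt_pos hd
  rw [← setIntegral_eq_integral_of_forall_compl_eq_zero
    (s := Set.Icc (-(2 * √((d : ℝ) - 1))) (2 * √((d : ℝ) - 1)))
    (fun x hx => by rw [kestenDensity_eq_zero hx, zero_mul]), integral_Icc_eq_integral_Ioo,
    ← image_two_sqrt_mul_cos hc, integral_image_eq_integral_abs_deriv_smul measurableSet_Ioo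
      (fun θ _ => hasDerivWithinAt_mul_cos _ θ _) (injOn_mul_cos hc)]
  refine setIntegral_congr_fun measurableSet_Ioo fun θ hθ => ?_
  rw [smul_eq_mul, ← mul_assoc, abs_deriv_mul_kestenDensity hd hθ, mul_comm]

theorem integrable_kestenDensity (hd : 2 ≤ d) : Integrable (kestenDensity d) := by
  have hc := two_sqrt_pos hd
  rw [← integrableOn_iff_integrable_of_support_subset
    (s := Set.Icc (-(2 * √((d : ℝ) - 1))) (2 * √((d : ℝ) - 1)))
    (fun x hx => by_contra fun h => hx (kestenDensity_eq_zero h)), integrableOn_Icc_iff_integrableOn_Ioo,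
    ← image_two_sqrt_mul_cos hc, integrableOn_image_iff_integrableOn_abs_deriv_smul
      measurableSet_Ioo (fun θ _ => hasDerivWithinAt_mul_cos _ θ _) (injOn_mul_cos hc)]
  have h1 := integrableOn_pow_mul_spherical (one_le_natCast_sub_one hd) 0 0
  refine h1.congr_fun (fun θ hθ => ?_) measurableSet_Ioo
  dsimp only
  rw [smul_eq_mul, abs_deriv_mul_kestenDensity hd hθ, pow_zero, one_mul]

theorem integral_kestenMeasure (hd : 2 ≤ d) (g : ℝ → ℝ) :
    ∫ x, g x ∂(kestenMeasure d) = ∫ x, kestenDensity d x * g x := by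
  rw [kestenMeasure, integral_withDensity_eq_integral_toReal_smul
    (measurable_kestenDensity d).ennreal_ofReal (.of_forall fun x => ENNReal.ofReal_lt_top)]
  simp_rw [ENNReal.toReal_ofReal (kestenDensity_nonneg hd _), smul_eq_mul]

theorem integral_pow_kestenMeasure (hd : 2 ≤ d) (k : ℕ) :
    ∫ x, x ^ k ∂(kestenMeasure d) = treeMoment d (Measure.dirac 1) k := by
  rw [integral_kestenMeasure hd, integral_kestenDensity_mul hd, integral_pow_mul_spherical hd,
    treeMoment_dirac_one]

theorem isProbabilityMeasure_kestenMeasure (hd : 2 ≤ d) :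
    IsProbabilityMeasure (kestenMeasure d) := by
  refine ⟨?_⟩
  have h1 := integral_pow_mul_spherical hd 0 0
  have h2 := integral_kestenDensity_mul hd fun _ => 1
  simp only [pow_zero, one_mul, mul_one] at h1 h2
  rw [kestenMeasure, withDensity_apply _ MeasurableSet.univ, Measure.restrict_univ,
    ← ofReal_integral_eq_lintegral_ofReal (integrable_kestenDensity hd)
      (.of_forall (kestenDensity_nonneg hd)), h2, h1]
  simp [radialWalks]

theorem ae_abs_le_kestenMeasure (hd : 2 ≤ d) : ∀ᵐ x : ℝ ∂(kestenMeasure d), |x| ≤ (d : ℝ) := by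
  rw [kestenMeasure, ae_withDensity_iff (measurable_kestenDensity d).ennreal_ofReal]
  refine .of_forall fun x hx => ?_
  by_contra h
  refine hx ?_
  rw [kestenDensity_eq_zero, ENNReal.ofReal_zero]
  intro hmem
  have hq := one_le_natCast_sub_one hd
  have h1 := sq_le_of_abs_le_two_sqrt (q := (d : ℝ) - 1) (by linarith) (abs_le.2 hmem)
  exact h (abs_le_of_sq_le_sq (by nlinarith [sq_nonneg ((d : ℝ) - 2)]) (by positivity))

theorem integral_eval_kestenMeasure (hd : 2 ≤ d) (p : Polynomial ℝ) :
    Integrable (fun x => p.eval x) (kestenMeasure d) ∧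
      ∫ x, p.eval x ∂(kestenMeasure d) = polyMoment d (Measure.dirac 1) p := by
  have := isProbabilityMeasure_kestenMeasure hd
  have hm := hasFiniteMoments_of_bounded (ae_abs_le_kestenMeasure hd)
  simp_rw [Polynomial.eval_eq_sum_range]
  refine ⟨integrable_finsetSum _ fun k _ => (hm k).const_mul _, ?_⟩
  rw [integral_finsetSum _ fun k _ => (hm k).const_mul _, polyMoment]
  refine Finset.sum_congr rfl fun k _ => ?_
  rw [integral_const_mul, integral_pow_kestenMeasure hd]

/-- Both integrals are compared with the moments of one polynomial `p` close to `f` on `[-d, d]`,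
which carries Kesten's measure and all the unweighted spectra. The errors are `ε` for Kesten's
measure, `2 * ε` for `p` on a late graph and less than `ε` for `ν`, so less than `4 * ε` in total.
-/
theorem integral_eq_integral_kestenMeasure (hd : 2 ≤ d) {ν : Measure ℝ} {N : ℕ → ℕ}
    {G : ∀ i, SimpleGraph (Fin (N i))} [∀ i, DecidableRel (G i).Adj] (h : IsTreelikeSeq d N G)
    (f : ℝ →ᵇ ℝ) (hν : Tendsto (fun i => ∫ w, |∫ x, f x ∂(spectralMeasure (G i) w) - ∫ x, f x ∂ν|
      ∂(weightLaw (Fin (N i)) (Measure.dirac 1))) atTop (𝓝 0)) :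
    ∫ x, f x ∂ν = ∫ x, f x ∂(kestenMeasure d) := by
  have hK := isProbabilityMeasure_kestenMeasure hd
  by_contra hne
  set ε := |∫ x, f x ∂ν - ∫ x, f x ∂(kestenMeasure d)| / 4 with hε
  have hε0 : 0 < ε := by
    have := abs_pos.2 (sub_ne_zero.2 hne)
    positivity
  obtain ⟨p, hp⟩ := exists_polynomial_near_of_continuousOn (-(d * (1 : ℝ))) (d * 1) f
    f.continuous.continuousOn ε hε0
  obtain ⟨h1, h2⟩ := integral_eval_kestenMeasure hd p
  have h3 : |∫ x, f x ∂(kestenMeasure d) - polyMoment d (Measure.dirac 1) p| ≤ ε := by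
    rw [← h2, ← integral_sub (f.integrable _) h1]
    have h4 : ∀ᵐ x ∂(kestenMeasure d), ‖f x - p.eval x‖ ≤ ε := by
      filter_upwards [ae_abs_le_kestenMeasure hd] with x hx
      rw [Real.norm_eq_abs, abs_sub_comm]
      rw [abs_le] at hx
      exact (hp x (by rwa [mul_one])).le
    simpa using norm_integral_le_of_norm_le_const h4
  have h5 := h.eventually_integral_abs_sub_polyMoment_le (W := Measure.dirac 1) (M := 1)
    (by rw [ae_dirac_iff (measurableSet_le (by fun_prop) measurable_const)]; simp) f p
    (η := ε) (ε := 2 * ε) (fun x hx => by rw [abs_sub_comm]; exact (hp x hx).le) (by linarith)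
  obtain ⟨i, h6, h7⟩ := (h5.and (hν.eventually (gt_mem_nhds hε0))).exists
  have hint (c : ℝ) : Integrable (fun w => |∫ x, f x ∂(spectralMeasure (G i) w) - c|)
      (weightLaw (Fin (N i)) (Measure.dirac 1)) :=
    ((integrable_integral_spectralMeasure _ f).sub (integrable_const _)).abs
  set a := polyMoment d (Measure.dirac 1) p
  have h8 : |∫ x, f x ∂ν - a| ≤
      ∫ w, |∫ x, f x ∂(spectralMeasure (G i) w) - ∫ x, f x ∂ν|
        ∂(weightLaw (Fin (N i)) (Measure.dirac 1)) +
      ∫ w, |∫ x, f x ∂(spectralMeasure (G i) w) - a|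
        ∂(weightLaw (Fin (N i)) (Measure.dirac 1)) := by
    rw [← integral_add (hint _) (hint _)]
    have h9 : |∫ x, f x ∂ν - a| = ∫ _w, |∫ x, f x ∂ν - a|
      ∂(weightLaw (Fin (N i)) (Measure.dirac 1)) := by simp
    rw [h9]
    refine integral_mono (integrable_const _) ((hint _).add (hint _)) fun w => ?_
    dsimp only
    refine (abs_sub_le _ (∫ x, f x ∂(spectralMeasure (G i) w)) _).trans (le_of_eq ?_)
    rw [abs_sub_comm (∫ x, f x ∂ν)]
  have h10 := abs_sub_le (∫ x, f x ∂ν) a (∫ x, f x ∂(kestenMeasure d))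
  rw [abs_sub_comm a] at h10
  have h11 : |∫ x, f x ∂ν - ∫ x, f x ∂(kestenMeasure d)| = 4 * ε := by rw [hε]; ring
  linarith

end Kesten

/-! ### The semicircle limit of rescaled Kesten measures. -/

section Semicircle

open Real

/-- The ratio of the rescaled Kesten density to `√(1 - y ^ 2)`. -/
noncomputable def kestenRatio (d : ℕ) (y : ℝ) : ℝ :=
  4 * ((d : ℝ) - 1) * d / (2 * π * ((d : ℝ) ^ 2 - 4 * ((d : ℝ) - 1) * y ^ 2))

theorem rescaled_kestenDensity {d : ℕ} (hd : 2 ≤ d) (y : ℝ) :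
    2 * √((d : ℝ) - 1) * kestenDensity d (2 * √((d : ℝ) - 1) * y) =
      if |y| ≤ 1 then kestenRatio d y * √(1 - y ^ 2) else 0 := by
  have hc := two_sqrt_pos hd
  have hq := one_le_natCast_sub_one hd
  set q := (d : ℝ) - 1 with hqd
  have h1 : |2 * √q * y| ≤ 2 * √q ↔ |y| ≤ 1 := by
    rw [abs_mul, abs_of_pos hc, mul_le_iff_le_one_right hc]
  have h2 : (2 * √q * y) ^ 2 = 4 * q * y ^ 2 := by
    rw [mul_pow, mul_pow, sq_sqrt (by linarith)]; ring
  rw [kestenDensity, ← hqd]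
  by_cases h : |y| ≤ 1
  · rw [if_pos (h1.2 h), if_pos h, h2, kestenRatio, ← hqd]
    have h3 : √(4 * q - 4 * q * y ^ 2) = 2 * √q * √(1 - y ^ 2) := by
      rw [show 4 * q - 4 * q * y ^ 2 = (2 * √q) ^ 2 * (1 - y ^ 2) by
        rw [mul_pow, sq_sqrt (by linarith)]; ring, sqrt_mul (by positivity), sqrt_sq hc.le]
    rw [h3]
    have h4 : √q * √q = q := mul_self_sqrt (by linarith)
    calc _ = √q * √q * (4 * d / (2 * π * ((d : ℝ) ^ 2 - 4 * q * y ^ 2)) * √(1 - y ^ 2)) := by ring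
      _ = _ := by rw [h4]; ring
  · rw [if_neg (fun h' => h (h1.1 h')), if_neg h, mul_zero]

/-- The domination needed for the limit. The denominator is at least `2 * π * (d - 2) ^ 2`, which is
useless at `d = 2`, and `4 * (d - 1) * d ≤ 24 * (d - 2) ^ 2` from `d = 3` on, with equality there.
-/
theorem kestenRatio_bounds {d : ℕ} (hd : 3 ≤ d) {y : ℝ} (hy : |y| ≤ 1) :
    |kestenRatio d y| ≤ 12 / π := by
  have hd' : (3 : ℝ) ≤ d := by exact_mod_cast hd
  have hy2 : y ^ 2 ≤ 1 := by rw [← sq_abs]; exact pow_le_one₀ (abs_nonneg y) hy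
  have h1 : ((d : ℝ) - 2) ^ 2 ≤ (d : ℝ) ^ 2 - 4 * ((d : ℝ) - 1) * y ^ 2 := by nlinarith
  have h2 : 0 < ((d : ℝ) - 2) ^ 2 := by
    have : 0 < (d : ℝ) - 2 := by linarith
    positivity
  have h3 : 0 < (d : ℝ) ^ 2 - 4 * ((d : ℝ) - 1) * y ^ 2 := by linarith
  have h4 : 0 ≤ 4 * ((d : ℝ) - 1) * d := by nlinarith
  rw [kestenRatio, abs_of_nonneg (by positivity), div_le_div_iff₀ (by positivity) pi_pos]
  have h5 : 4 * ((d : ℝ) - 1) * d ≤ 24 * ((d : ℝ) ^ 2 - 4 * ((d : ℝ) - 1) * y ^ 2) := by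
    nlinarith
  nlinarith [pi_pos]

theorem tendsto_kestenRatio (y : ℝ) :
    Tendsto (fun d : ℕ => kestenRatio d y) atTop (𝓝 (2 / π)) := by
  have h1 : Tendsto (fun d : ℕ => (1 : ℝ) / d) atTop (𝓝 0) := tendsto_one_div_atTop_nhds_zero_nat
  have h2 : Tendsto (fun d : ℕ => 4 * (1 - (1 : ℝ) / d) /
      (2 * π * (1 - 4 * ((1 : ℝ) / d) * (1 - (1 : ℝ) / d) * y ^ 2))) atTop
      (𝓝 (4 * (1 - 0) / (2 * π * (1 - 4 * 0 * (1 - 0) * y ^ 2)))) := by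
    refine Tendsto.div ((tendsto_const_nhds.sub h1).const_mul 4) ?_ ?_
    · exact (tendsto_const_nhds.sub (((h1.const_mul 4).mul
        (tendsto_const_nhds.sub h1)).mul_const (y ^ 2))).const_mul (2 * π)
    · simp [pi_ne_zero]
  have h3 : 4 * (1 - 0) / (2 * π * (1 - 4 * 0 * (1 - 0) * y ^ 2)) = 2 / π := by
    field_simp
    ring
  rw [h3] at h2
  refine h2.congr' ?_
  filter_upwards [eventually_ge_atTop 1] with d hd
  have hd' : (d : ℝ) ≠ 0 := by exact_mod_cast (by omega : d ≠ 0)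
  have e1 : 4 * ((d : ℝ) - 1) * d = (d : ℝ) ^ 2 * (4 * (1 - 1 / d)) := by field_simp
  have e2 : 2 * π * ((d : ℝ) ^ 2 - 4 * ((d : ℝ) - 1) * y ^ 2) =
      (d : ℝ) ^ 2 * (2 * π * (1 - 4 * ((1 : ℝ) / d) * (1 - (1 : ℝ) / d) * y ^ 2)) := by
    field_simp
  rw [kestenRatio, e1, e2, mul_div_mul_left _ _ (pow_ne_zero 2 hd')]

theorem integral_rescaled_kestenMeasure {d : ℕ} (hd : 2 ≤ d) (f : ℝ →ᵇ ℝ) :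
    ∫ x, f x ∂((kestenMeasure d).map fun x => x / (2 * √((d : ℝ) - 1))) =
      ∫ y, (if |y| ≤ 1 then kestenRatio d y * √(1 - y ^ 2) else 0) * f y := by
  have hc := two_sqrt_pos hd
  rw [integral_map (by fun_prop) f.continuous.aestronglyMeasurable, integral_kestenMeasure hd]
  have h1 := Measure.integral_comp_mul_left
    (fun x => kestenDensity d x * f (x / (2 * √((d : ℝ) - 1)))) (2 * √((d : ℝ) - 1))
  simp_rw [← rescaled_kestenDensity hd, mul_assoc (2 * √((d : ℝ) - 1)) (kestenDensity d _)]
  rw [integral_const_mul]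
  simp only [mul_div_cancel_left₀ _ hc.ne'] at h1
  rw [h1, abs_of_pos (inv_pos.2 hc), smul_eq_mul, mul_inv_cancel_left₀ hc.ne']

theorem integral_semicircleMeasure (f : ℝ →ᵇ ℝ) : ∫ x, f x ∂semicircleMeasure =
    ∫ y, (if |y| ≤ 1 then 2 / π * √(1 - y ^ 2) else 0) * f y := by
  have hm : Measurable fun y : ℝ => if |y| ≤ 1 then 2 / π * √(1 - y ^ 2) else 0 :=
    Measurable.ite (measurableSet_le (by fun_prop) measurable_const) (by fun_prop)
      measurable_const
  rw [semicircleMeasure, integral_withDensity_eq_integral_toReal_smul hm.ennreal_ofReal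
    (.of_forall fun x => ENNReal.ofReal_lt_top)]
  refine integral_congr_ae (.of_forall fun y => ?_)
  dsimp only
  rw [ENNReal.toReal_ofReal (by split_ifs <;> positivity), smul_eq_mul]

theorem weaklyTendsto_semicircleMeasure :
    WeaklyTendsto (fun d => (kestenMeasure d).map fun x => x / (2 * √((d : ℝ) - 1)))
      semicircleMeasure := by
  intro f
  rw [integral_semicircleMeasure]
  have h1 : Tendsto (fun d : ℕ =>
      ∫ y, (if |y| ≤ 1 then kestenRatio d y * √(1 - y ^ 2) else 0) * f y) atTop
      (𝓝 (∫ y, (if |y| ≤ 1 then 2 / π * √(1 - y ^ 2) else 0) * f y)) := by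
    refine tendsto_integral_filter_of_dominated_convergence
      ((Set.Icc (-1 : ℝ) 1).indicator fun _ => 12 / π * ‖f‖) (.of_forall fun d => ?_) ?_ ?_ ?_
    · refine Measurable.aestronglyMeasurable (Measurable.mul (Measurable.ite
        (measurableSet_le (by fun_prop) measurable_const) ?_ measurable_const)
        f.continuous.measurable)
      unfold kestenRatio
      fun_prop
    · filter_upwards [eventually_ge_atTop 3] with d hd
      refine .of_forall fun y => ?_
      by_cases hy : |y| ≤ 1
      · rw [Set.indicator_of_mem (show y ∈ Set.Icc (-1 : ℝ) 1 from abs_le.1 hy), if_pos hy, norm_mul, norm_mul, Real.norm_eq_abs,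
          Real.norm_eq_abs]
        have h2 : |√(1 - y ^ 2)| ≤ 1 := by
          rw [abs_of_nonneg (sqrt_nonneg _), sqrt_le_one]
          nlinarith [sq_nonneg y]
        have h3 := kestenRatio_bounds hd hy
        calc _ ≤ 12 / π * 1 * ‖f‖ := by
              gcongr
              exact f.norm_coe_le_norm y
          _ = _ := by ring
      · rw [if_neg hy, zero_mul, norm_zero]
        exact Set.indicator_nonneg (fun _ _ => by positivity) _
    · rw [integrable_indicator_iff measurableSet_Icc]
      exact integrableOn_const (by simp)
    · refine .of_forall fun y => ?_
      by_cases hy : |y| ≤ 1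
      · simp only [if_pos hy]
        exact ((tendsto_kestenRatio y).mul_const _).mul_const _
      · simp only [if_neg hy]
        exact tendsto_const_nhds
  refine h1.congr' ?_
  filter_upwards [eventually_ge_atTop 2] with d hd
  exact (integral_rescaled_kestenMeasure hd f).symm

end Semicircle

/-! ### Assembly of the theorem. -/

/-- The limiting spectral measures exist for every degree and every weight distribution, and for
unit weights they are Kesten's measures. -/
theorem exists_limit (d : ℕ) (W : Measure ℝ) (hW : IsProbabilityMeasure W)
    (hm : HasFiniteMoments W) : ∃ ν : Measure ℝ, IsProbabilityMeasure ν ∧ HasFiniteMoments ν ∧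
      (∀ (N : ℕ → ℕ) (G : ∀ i, SimpleGraph (Fin (N i))) [∀ i, DecidableRel (G i).Adj],
        IsTreelikeSeq d N G →
        WeaklyTendsto (fun i => meanSpectralMeasure (G i) W) ν ∧
        (∀ k : ℕ, Tendsto (fun i => ∫ x, x ^ k ∂(meanSpectralMeasure (G i) W)) atTop
          (𝓝 (∫ x, x ^ k ∂ν))) ∧
        WeaklyTendstoInProbability (fun i => weightLaw (Fin (N i)) W)
          (fun i => spectralMeasure (G i)) ν) ∧
      (2 ≤ d → W = Measure.dirac 1 → ν = kestenMeasure d) := by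
  obtain ⟨N₀, G₀, _, h₀⟩ := exists_isTreelikeSeq d
  obtain ⟨ν, hν, hνm, h⟩ := h₀.exists_limit hm
  refine ⟨ν, hν, hνm, fun N G _ hG => (h N G hG).2, ?_⟩
  rintro hd rfl
  have := isProbabilityMeasure_kestenMeasure hd
  exact ext_of_forall_integral_eq_of_IsFiniteMeasure fun f =>
    integral_eq_integral_kestenMeasure hd h₀ f ((h N₀ G₀ h₀).1 f)

end SpectralLimit

theorem theorem1p1 :
    ∃ ν : ℕ → Measure ℝ → Measure ℝ,
      (∀ (d : ℕ) (W : Measure ℝ), IsProbabilityMeasure W → SpectralLimit.HasFiniteMoments W →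
        IsProbabilityMeasure (ν d W) ∧ SpectralLimit.HasFiniteMoments (ν d W) ∧
        ∀ (N : ℕ → ℕ) (G : ∀ i, SimpleGraph (Fin (N i))) [∀ i, DecidableRel (G i).Adj],
          (∀ i, (G i).IsRegularOfDegree d) →
          Tendsto N atTop atTop →
          (∀ k : ℕ, 3 ≤ k →
            (fun i => (SpectralLimit.numCycles (G i) k : ℝ)) =o[atTop] fun i => (N i : ℝ)) →
          SpectralLimit.WeaklyTendsto
              (fun i => SpectralLimit.meanSpectralMeasure (G i) W) (ν d W) ∧
          (∀ k : ℕ, Tendsto (fun i => ∫ x, x ^ k ∂(SpectralLimit.meanSpectralMeasure (G i) W))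
              atTop (𝓝 (∫ x, x ^ k ∂(ν d W)))) ∧
          SpectralLimit.WeaklyTendstoInProbability
              (fun i => SpectralLimit.weightLaw (Fin (N i)) W)
              (fun i => SpectralLimit.spectralMeasure (G i)) (ν d W)) ∧
      (∀ d : ℕ, 2 ≤ d → ν d (Measure.dirac 1) = SpectralLimit.kestenMeasure d) ∧
      SpectralLimit.WeaklyTendsto
        (fun d => (SpectralLimit.kestenMeasure d).map fun x => x / (2 * √((d : ℝ) - 1)))
        SpectralLimit.semicircleMeasure := by
  classical
  choose ν h1 h2 h3 h4 using SpectralLimit.exists_limit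
  refine ⟨fun d W => if h : IsProbabilityMeasure W ∧ SpectralLimit.HasFiniteMoments W
    then ν d W h.1 h.2 else 0, fun d W hW hm => ?_, fun d hd => ?_,
    SpectralLimit.weaklyTendsto_semicircleMeasure⟩
  · beta_reduce
    rw [dif_pos (⟨hW, hm⟩ : IsProbabilityMeasure _ ∧ SpectralLimit.HasFiniteMoments _)]
    exact ⟨h1 d W hW hm, h2 d W hW hm, fun N G _ hreg hN hcyc => h3 d W hW hm N G ⟨hreg, hN, hcyc⟩⟩
  · have hW : IsProbabilityMeasure (Measure.dirac (1 : ℝ)) := inferInstance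
    have hm : SpectralLimit.HasFiniteMoments (Measure.dirac 1) :=
      SpectralLimit.hasFiniteMoments_of_bounded (M := 1) (by
        rw [ae_dirac_iff (measurableSet_le (by fun_prop) measurable_const)]; simp)
    beta_reduce
    rw [dif_pos (⟨hW, hm⟩ : IsProbabilityMeasure _ ∧ SpectralLimit.HasFiniteMoments _)]
    exact h4 d _ hW hm hd rfl
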